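/- Let $\mathbb F$ be a finite field with $q$ elements, let $c\ge 2$, and consider (not necessarily associative, not necessarily unital) algebras over $\mathbb F$. For an algebra $A$ let $A^k$ be the linear span of the values in $A$ of all nonassociative monomials of degree $k$, and let $I(A)=\{x\in A: ax=xa=0\text{ for all }a\in A\}$ be its annihilator. Let $\mathfrak V$ be a primitive class (variety) of algebras, that is, the class of all algebras satisfying a given set of identities $w(x_1,x_2,\dots)=0$, where the $w$ are nonassociative polynomials over $\mathbb F$. Assume that $\mathfrak V$ is $c$-step nilpotent, i.e. $A^{c+1}=0$ for all $A\in\mathfrak V$ and $A^c\ne 0$ for some $A\in\mathfrak V$, and that $\mathfrak V$ is central, i.e. $I(F_n)=F_n^c$ for all $n\ge 2$, where $F_n$ is the free algebra of rank $n$ in $\mathfrak V$. For every $n$ let $\mathfrak V_n$ be the set of isomorphism classes of algebras in $\mathfrak V$ that can be generated by $n$ elements. Then every $\mathfrak V_n$ is finite, and a generic $n$-generated algebra $P$ in $\mathfrak V$ has the following two properties, in the sense that, if $T_n\subseteq\mathfrak V_n$ is the set of isomorphism classes of algebras $P$ having both of them, then $|T_n|/|\mathfrak V_n|\to 1$ as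 $n\to\infty$: (a) $|\operatorname{Aut}P|=(q-1)\left(\dfrac{|P|}{q^n}\right)^n$; (b) $\operatorname{Aut}P$ is a solvable group, and it is a semidirect product of a normal subgroup that is nilpotent of class exactly $c-1$ and a subgroup isomorphic to the multiplicative group $\mathbb F^*$. -/

import Mathlib

open Filter Topology

universe u

/-! ### Nonassociative algebras over a field -/

/-- A (not necessarily associative, not necessarily unital) algebra over `𝔽`: a vector space with a
bilinear product. -/
structure NAAlgebra (𝔽 : Type u) [Field 𝔽] where
  carrier : Type u
  [ring : NonUnitalNonAssocRing carrier]
  [module : Module 𝔽 carrier]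
  [tower : IsScalarTower 𝔽 carrier carrier]
  [comm : SMulCommClass 𝔽 carrier carrier]

namespace NAAlgebra

variable {𝔽 : Type u} [Field 𝔽]

instance : CoeSort (NAAlgebra 𝔽) (Type u) := ⟨NAAlgebra.carrier⟩

instance (A : NAAlgebra 𝔽) : NonUnitalNonAssocRing A := A.ring
instance (A : NAAlgebra 𝔽) : Module 𝔽 A := A.module
instance (A : NAAlgebra 𝔽) : IsScalarTower 𝔽 A A := A.tower
instance (A : NAAlgebra 𝔽) : SMulCommClass 𝔽 A A := A.comm

end NAAlgebra

section Algebras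

variable (𝔽 : Type u) [Field 𝔽]
  (A : Type u) [NonUnitalNonAssocRing A] [Module 𝔽 A]

/-- The `k`-th power `A ^ k`: the linear span of the values in `A` of all nonassociative monomials
of degree `k`. -/
def algPower (k : ℕ) : Submodule 𝔽 A :=
  Submodule.span 𝔽 {x | ∃ m : FreeMagma A, m.length = k ∧ FreeMagma.lift (id : A → A) m = x}

/-- A two-sided ideal of the algebra `A` (a subspace closed under multiplication by elements of `A`
on both sides). -/
structure AlgIdeal extends Submodule 𝔽 A where
  mul_mem_left' : ∀ (a : A) {x : A}, x ∈ carrier → a * x ∈ carrier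
  mul_mem_right' : ∀ (a : A) {x : A}, x ∈ carrier → x * a ∈ carrier

/-- The annihilator `I(A) = {x | ∀ a, a x = x a = 0}`. -/
def algAnnihilator [IsScalarTower 𝔽 A A] [SMulCommClass 𝔽 A A] : Submodule 𝔽 A where
  carrier := {x | ∀ a : A, a * x = 0 ∧ x * a = 0}
  zero_mem' := fun a => ⟨mul_zero a, zero_mul a⟩
  add_mem' := fun hx hy a =>
    ⟨by rw [mul_add, (hx a).1, (hy a).1, add_zero], by rw [add_mul, (hx a).2, (hy a).2, add_zero]⟩
  smul_mem' := fun r x hx a =>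
    ⟨by rw [mul_smul_comm, (hx a).1, smul_zero], by rw [smul_mul_assoc, (hx a).2, smul_zero]⟩

/-- The group of automorphisms of the algebra `A`. -/
def algAut : Subgroup (A ≃ₗ[𝔽] A) where
  carrier := {e | ∀ a b : A, e (a * b) = e a * e b}
  one_mem' := fun _ _ => rfl
  mul_mem' := fun {e f} he hf a b => by
    simp only [LinearEquiv.mul_apply]
    rw [hf, he]
  inv_mem' := fun {e} he a b => by
    change e.symm (a * b) = e.symm a * e.symm b
    apply e.injective
    rw [he]
    simp

/-- `A` is `n`-generated: some `n` elements generate it as an algebra. -/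
def IsNGenerated [IsScalarTower 𝔽 A A] [SMulCommClass 𝔽 A A] (n : ℕ) : Prop :=
  ∃ x : Fin n → A, NonUnitalAlgebra.adjoin 𝔽 (Set.range x) = ⊤

end Algebras

/-! ### Quotient algebras -/

namespace AlgIdeal

variable {𝔽 : Type u} [Field 𝔽] {A : Type u} [NonUnitalNonAssocRing A] [Module 𝔽 A]

/-- The quotient algebra of `A` by an ideal. -/
def Quot (I : AlgIdeal 𝔽 A) : Type u := A ⧸ I.toSubmodule

variable (I : AlgIdeal 𝔽 A)

instance : AddCommGroup I.Quot := inferInstanceAs (AddCommGroup (A ⧸ I.toSubmodule))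
instance : Module 𝔽 I.Quot := inferInstanceAs (Module 𝔽 (A ⧸ I.toSubmodule))

/-- The canonical projection onto the quotient algebra. -/
def proj : A →ₗ[𝔽] I.Quot := I.toSubmodule.mkQ

theorem proj_surjective : Function.Surjective I.proj := Submodule.mkQ_surjective _

theorem proj_eq_iff {x y : A} : I.proj x = I.proj y ↔ x - y ∈ I.toSubmodule :=
  Submodule.Quotient.eq _

theorem proj_mul_congr {a a' b b' : A} (ha : I.proj a = I.proj a') (hb : I.proj b = I.proj b') :
    I.proj (a * b) = I.proj (a' * b') := by
  rw [proj_eq_iff] at ha hb ⊢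
  have h : a * b - a' * b' = (a - a') * b + a' * (b - b') := by
    rw [sub_mul, mul_sub]; abel
  rw [h]
  exact add_mem (I.mul_mem_right' b ha) (I.mul_mem_left' a' hb)

instance : Mul I.Quot :=
  ⟨Quotient.map₂ (· * ·) (fun _ _ ha _ _ hb =>
    Quotient.exact (I.proj_mul_congr (Quotient.sound ha) (Quotient.sound hb)))⟩

theorem proj_mul (a b : A) : I.proj (a * b) = I.proj a * I.proj b := rfl

instance : NonUnitalNonAssocRing I.Quot :=
  { (inferInstance : AddCommGroup I.Quot), (inferInstance : Mul I.Quot) with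
    left_distrib := fun x y z => by
      obtain ⟨a, rfl⟩ := I.proj_surjective x
      obtain ⟨b, rfl⟩ := I.proj_surjective y
      obtain ⟨c, rfl⟩ := I.proj_surjective z
      simp only [← map_add, ← proj_mul, mul_add]
    right_distrib := fun x y z => by
      obtain ⟨a, rfl⟩ := I.proj_surjective x
      obtain ⟨b, rfl⟩ := I.proj_surjective y
      obtain ⟨c, rfl⟩ := I.proj_surjective z
      simp only [← map_add, ← proj_mul, add_mul]
    zero_mul := fun x => by
      obtain ⟨a, rfl⟩ := I.proj_surjective x
      have h := I.proj_mul 0 a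
      rw [zero_mul, map_zero] at h
      exact h.symm
    mul_zero := fun x => by
      obtain ⟨a, rfl⟩ := I.proj_surjective x
      have h := I.proj_mul a 0
      rw [mul_zero, map_zero] at h
      exact h.symm }

instance [IsScalarTower 𝔽 A A] : IsScalarTower 𝔽 I.Quot I.Quot :=
  ⟨fun r x y => by
    obtain ⟨a, rfl⟩ := I.proj_surjective x
    obtain ⟨b, rfl⟩ := I.proj_surjective y
    simp only [smul_eq_mul, ← map_smul, ← proj_mul, smul_mul_assoc]⟩

instance [SMulCommClass 𝔽 A A] : SMulCommClass 𝔽 I.Quot I.Quot :=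
  ⟨fun r x y => by
    obtain ⟨a, rfl⟩ := I.proj_surjective x
    obtain ⟨b, rfl⟩ := I.proj_surjective y
    simp only [smul_eq_mul, ← map_smul, ← proj_mul, mul_smul_comm]⟩

end AlgIdeal

/-! ### Primitive classes (varieties) of algebras and relatively free algebras -/

section PrimitiveClasses

variable {𝔽 : Type u} [Field 𝔽]

/-- `A` belongs to the primitive class defined by the set `W` of nonassociative polynomials in
`x₀, x₁, …`: every `w ∈ W` vanishes under all substitutions of elements of `A`. -/
def InClass (W : Set (FreeNonUnitalNonAssocAlgebra 𝔽 ℕ)) (A : Type u) [NonUnitalNonAssocRing A]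
    [Module 𝔽 A] [IsScalarTower 𝔽 A A] [SMulCommClass 𝔽 A A] : Prop :=
  ∀ w ∈ W, ∀ a : ℕ → A, FreeNonUnitalNonAssocAlgebra.lift 𝔽 a w = 0

/-- The verbal ideal of `A` defined by `W`: the least ideal that contains all values in `A` of the
polynomials in `W`. -/
def verbalIdeal (W : Set (FreeNonUnitalNonAssocAlgebra 𝔽 ℕ)) (A : Type u) [NonUnitalNonAssocRing A]
    [Module 𝔽 A] [IsScalarTower 𝔽 A A] [SMulCommClass 𝔽 A A] : AlgIdeal 𝔽 A where
  carrier := {x | ∀ I : AlgIdeal 𝔽 A,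
    (∀ w ∈ W, ∀ a : ℕ → A, FreeNonUnitalNonAssocAlgebra.lift 𝔽 a w ∈ I.toSubmodule) →
      x ∈ I.toSubmodule}
  zero_mem' := fun I _ => I.toSubmodule.zero_mem
  add_mem' := fun hx hy I hI => I.toSubmodule.add_mem (hx I hI) (hy I hI)
  smul_mem' := fun r _ hx I hI => I.toSubmodule.smul_mem r (hx I hI)
  mul_mem_left' := fun a _ hx I hI => I.mul_mem_left' a (hx I hI)
  mul_mem_right' := fun a _ hx I hI => I.mul_mem_right' a (hx I hI)

/-- The relatively free algebra `F_n` of rank `n` in the primitive class defined by `W`: the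
absolutely free algebra on `n` generators modulo its verbal ideal. -/
abbrev RelFree (W : Set (FreeNonUnitalNonAssocAlgebra 𝔽 ℕ)) (n : ℕ) : Type u :=
  (verbalIdeal W (FreeNonUnitalNonAssocAlgebra 𝔽 (Fin n))).Quot

/-- The primitive class defined by `W` is `c`-step nilpotent: `A ^ (c + 1) = 0` for all its
algebras, and `A ^ c ≠ 0` for at least one of them. -/
def IsNilpotentClass (W : Set (FreeNonUnitalNonAssocAlgebra 𝔽 ℕ)) (c : ℕ) : Prop :=
  (∀ A : NAAlgebra 𝔽, InClass W A → algPower 𝔽 A (c + 1) = ⊥) ∧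
    ∃ A : NAAlgebra 𝔽, InClass W A ∧ algPower 𝔽 A c ≠ ⊥

/-- A `c`-step nilpotent primitive class is central if `I(F_n) = F_n ^ c` for all ranks `n ≥ 2`. -/
def IsCentralClass (W : Set (FreeNonUnitalNonAssocAlgebra 𝔽 ℕ)) (c : ℕ) : Prop :=
  ∀ n : ℕ, 2 ≤ n → algAnnihilator 𝔽 (RelFree W n) = algPower 𝔽 (RelFree W n) c

/-- The `n`-generated algebras in the primitive class defined by `W`. -/
def NGenAlgebra (W : Set (FreeNonUnitalNonAssocAlgebra 𝔽 ℕ)) (n : ℕ) : Type (u + 1) :=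
  {A : NAAlgebra 𝔽 // InClass W A ∧ IsNGenerated 𝔽 A n}

/-- Isomorphism of algebras. -/
instance isoSetoid (W : Set (FreeNonUnitalNonAssocAlgebra 𝔽 ℕ)) (n : ℕ) :
    Setoid (NGenAlgebra W n) where
  r A B := ∃ e : A.1 ≃ₗ[𝔽] B.1, ∀ a b : A.1, e (a * b) = e a * e b
  iseqv :=
    { refl := fun A => ⟨LinearEquiv.refl 𝔽 A.1, fun _ _ => rfl⟩
      symm := fun {A B} ⟨e, he⟩ => ⟨e.symm, fun a b => e.injective (by rw [he]; simp)⟩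
      trans := fun {A B C} ⟨e, he⟩ ⟨f, hf⟩ =>
        ⟨e.trans f, fun a b => by simp only [LinearEquiv.trans_apply]; rw [he, hf]⟩ }

/-- The set of isomorphism classes of `n`-generated algebras in the primitive class defined
by `W`. -/
def IsoClass (W : Set (FreeNonUnitalNonAssocAlgebra 𝔽 ℕ)) (n : ℕ) : Type (u + 1) :=
  Quotient (isoSetoid W n)

/-- The isomorphism class of an algebra. -/
def IsoClass.mk {W : Set (FreeNonUnitalNonAssocAlgebra 𝔽 ℕ)} {n : ℕ} (A : NGenAlgebra W n) :
    IsoClass W n :=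
  Quotient.mk (isoSetoid W n) A

end PrimitiveClasses

/-! ### Generic properties -/

/-- A generic element of the sequence of finite sets `S n` lies in the sequence of subsets
`T n ⊆ S n`: `|T n| / |S n| → 1` as `n → ∞`. -/
def IsGeneric (S : ℕ → Type*) (T : ∀ n, Set (S n)) : Prop :=
  (∀ n, Finite (S n)) ∧
    Tendsto (fun n => ((T n).ncard : ℝ) / (Nat.card (S n) : ℝ)) atTop (𝓝 1)

/-- `G` is the (internal) semidirect product of a normal subgroup `N` and a subgroup `H`. -/
def IsInternalSemidirect {G : Type*} [Group G] (N H : Subgroup G) : Prop :=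
  N.Normal ∧ N ⊓ H = ⊥ ∧ N ⊔ H = ⊤

/-! Write F for the relatively free algebra of rank n, C = F^c, d = dim C and D = ⌊d/2⌋⌈d/2⌉. Every
n-generated algebra of the class is F/J for an ideal J, and nilpotency makes every subspace of C an
ideal. An isomorphism between quotients by two subspaces of C lifts to an endomorphism of F, which
acts on C only through its linear part, one of q^(n²) matrices. As C has at least q^D subspaces,
there are at least q^(D - n²) isomorphism classes (`RelFree.card_le_card_isoClass`).

Call I ≤ C rigid if only scalar linear substitutions preserve it. If I is rigid and P = F/I, every
automorphism of P has the form x_i ↦ l x_i + p_i with p_i in P². Conversely, all such substitutions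
with l ≠ 0 give automorphisms, because a substitution with scalar linear part l acts on C as l^c and
so preserves I. Thus Aut P is a split extension of 𝔽^* by the automorphisms congruent to the
identity modulo P². These number |P²|^n = (|P|/q^n)^n, and commutators of elementary automorphisms
show that they form a group of class exactly c - 1 (`IsFreeBasis.algAut_structure`,
`nilpotencyClass_congAut`).

It remains to show that all other ideals are rare, and there are two kinds.

Ideals not contained in C: multiplication by the n generators enlarges dimensions by a factor of
order n (`IsFreeBasis.mul_finrank_le`). With centrality, an ideal that has e > 0 dimensions outside
C must contain a subspace of C of dimension at least a large multiple of e, and this subspace is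
determined by J + C. That leaves too little freedom for J ∩ C (`IsFreeBasis.card_ideal_not_le`).

Subspaces of C that are not rigid: a nonscalar invertible g acts on C so that g - l has rank at
least n - c for every scalar l (`IsFreeBasis.le_finrank_map_linEndo`), and an operator this far from
all homotheties has few invariant subspaces (`card_invariant_le`). Summing over the at most q^(n²)
matrices g costs little.

Both bounds save a factor q^Z with Z of order d. The same growth of dimensions gives n² ≤ 4c²d, so Z
= 2n² + n is available for large n, and the bad classes form a proportion of at most 2q^(-n). -/

/-! ### Powers of an algebra, generating families and homomorphisms -/

section Powers

variable {𝔽 : Type u} [Field 𝔽] {A : Type u} [NonUnitalNonAssocRing A] [Module 𝔽 A]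

theorem FreeMagma.one_le_length {α : Type*} (m : FreeMagma α) : 1 ≤ m.length := m.length_pos

theorem FreeMagma.length_mul {α : Type*} (u v : FreeMagma α) :
    (u * v).length = u.length + v.length := rfl

theorem lift_mem_algPower (m : FreeMagma A) :
    FreeMagma.lift (id : A → A) m ∈ algPower 𝔽 A m.length :=
  Submodule.subset_span ⟨m, rfl, rfl⟩

theorem mul_mem_of_span [IsScalarTower 𝔽 A A] [SMulCommClass 𝔽 A A] {s t : Set A}
    {N : Submodule 𝔽 A} (h : ∀ a ∈ s, ∀ b ∈ t, a * b ∈ N) {x y : A}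
    (hx : x ∈ Submodule.span 𝔽 s) (hy : y ∈ Submodule.span 𝔽 t) : x * y ∈ N := by
  induction hx using Submodule.span_induction with
  | zero => rw [zero_mul]; exact zero_mem _
  | add a b _ _ ha hb => rw [add_mul]; exact add_mem ha hb
  | smul r a _ ha => rw [smul_mul_assoc]; exact Submodule.smul_mem _ _ ha
  | mem a ha =>
    induction hy using Submodule.span_induction with
    | zero => rw [mul_zero]; exact zero_mem _
    | add a b _ _ ha hb => rw [mul_add]; exact add_mem ha hb
    | smul r a _ ha => rw [mul_smul_comm]; exact Submodule.smul_mem _ _ ha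
    | mem b hb => exact h a ha b hb

theorem algPower_mul [IsScalarTower 𝔽 A A] [SMulCommClass 𝔽 A A] {i j : ℕ} {x y : A}
    (hx : x ∈ algPower 𝔽 A i) (hy : y ∈ algPower 𝔽 A j) : x * y ∈ algPower 𝔽 A (i + j) := by
  refine mul_mem_of_span ?_ hx hy
  rintro _ ⟨m, rfl, rfl⟩ _ ⟨m', rfl, rfl⟩
  rw [← map_mul]
  exact lift_mem_algPower (m * m')

theorem algPower_one : algPower 𝔽 A 1 = ⊤ := by
  rw [eq_top_iff]
  exact fun x _ => Submodule.subset_span ⟨FreeMagma.of x, rfl, rfl⟩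

/-- A product of two letters inside the monomial is itself an element of `A`, so it can be replaced
by a single letter. -/
theorem FreeMagma.exists_shorter (m : FreeMagma A) (hm : 2 ≤ m.length) :
    ∃ m' : FreeMagma A, m'.length + 1 = m.length ∧
      FreeMagma.lift (id : A → A) m' = FreeMagma.lift (id : A → A) m := by
  induction m using FreeMagma.recOnMul with
  | ih1 x => simp [FreeMagma.length] at hm
  | ih2 u v hu hv =>
    by_cases h1 : 2 ≤ u.length
    · obtain ⟨u', hu', he⟩ := hu h1
      exact ⟨u' * v, by rw [length_mul, length_mul]; omega, by rw [map_mul, map_mul, he]⟩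
    · by_cases h2 : 2 ≤ v.length
      · obtain ⟨v', hv', he⟩ := hv h2
        exact ⟨u * v', by rw [length_mul, length_mul]; omega, by rw [map_mul, map_mul, he]⟩
      · have := u.one_le_length
        have := v.one_le_length
        exact ⟨FreeMagma.of (FreeMagma.lift id (u * v)), by
          rw [length_mul]; change 1 + 1 = _; omega, rfl⟩

theorem algPower_succ_le {k : ℕ} (hk : 1 ≤ k) : algPower 𝔽 A (k + 1) ≤ algPower 𝔽 A k := by
  refine Submodule.span_le.2 ?_
  rintro _ ⟨m, hm, rfl⟩
  obtain ⟨m', h1, h2⟩ := m.exists_shorter (by omega)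
  exact Submodule.subset_span ⟨m', by omega, h2⟩

theorem algPower_le {i j : ℕ} (hi : 1 ≤ i) (hij : i ≤ j) :
    algPower 𝔽 A j ≤ algPower 𝔽 A i := by
  induction j, hij using Nat.le_induction with
  | base => exact le_rfl
  | succ j hij ih => exact (algPower_succ_le (hi.trans hij)).trans ih

theorem algPower_mul_left [IsScalarTower 𝔽 A A] [SMulCommClass 𝔽 A A] {k : ℕ} (a : A) {x : A}
    (hx : x ∈ algPower 𝔽 A k) : a * x ∈ algPower 𝔽 A (k + 1) := by
  rw [add_comm]
  exact algPower_mul (algPower_one (𝔽 := 𝔽) (A := A) ▸ Submodule.mem_top) hx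

theorem algPower_mul_right [IsScalarTower 𝔽 A A] [SMulCommClass 𝔽 A A] {k : ℕ} (a : A) {x : A}
    (hx : x ∈ algPower 𝔽 A k) : x * a ∈ algPower 𝔽 A (k + 1) :=
  algPower_mul hx (algPower_one (𝔽 := 𝔽) (A := A) ▸ Submodule.mem_top)

theorem mul_mem_algPower_two [IsScalarTower 𝔽 A A] [SMulCommClass 𝔽 A A] (a b : A) :
    a * b ∈ algPower 𝔽 A 2 :=
  algPower_mul_left a (algPower_one (𝔽 := 𝔽) (A := A) ▸ Submodule.mem_top)

variable {B : Type u} [NonUnitalNonAssocRing B] [Module 𝔽 B]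

theorem hom_freeMagma_lift {α : Type*} (φ : A →ₙₐ[𝔽] B) (y : α → A) (m : FreeMagma α) :
    φ (FreeMagma.lift y m) = FreeMagma.lift (fun i => φ (y i)) m := by
  induction m using FreeMagma.recOnMul with
  | ih1 x => rfl
  | ih2 u v hu hv => rw [map_mul, map_mul, map_mul, hu, hv]

theorem lift_id_map {α : Type*} (y : α → A) (m : FreeMagma α) :
    FreeMagma.lift (id : A → A) (FreeMagma.map y m) = FreeMagma.lift y m := by
  induction m using FreeMagma.recOnMul with
  | ih1 x => rfl
  | ih2 u v hu hv => rw [map_mul, map_mul, map_mul, hu, hv]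

theorem FreeMagma.length_map {α β : Type*} (y : α → β) (m : FreeMagma α) :
    (FreeMagma.map y m).length = m.length := by
  induction m using FreeMagma.recOnMul with
  | ih1 x => rfl
  | ih2 u v hu hv => rw [map_mul, length_mul, length_mul, hu, hv]

theorem lift_mem_algPower' {α : Type*} (y : α → A) (m : FreeMagma α) :
    FreeMagma.lift y m ∈ algPower 𝔽 A m.length := by
  rw [← lift_id_map, ← FreeMagma.length_map y]
  exact lift_mem_algPower _

theorem map_mem_algPower (φ : A →ₙₐ[𝔽] B) {k : ℕ} {x : A} (hx : x ∈ algPower 𝔽 A k) :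
    φ x ∈ algPower 𝔽 B k := by
  induction hx using Submodule.span_induction with
  | zero => rw [map_zero]; exact zero_mem _
  | add a b _ _ ha hb => rw [map_add]; exact add_mem ha hb
  | smul r a _ ha => rw [map_smul]; exact Submodule.smul_mem _ _ ha
  | mem a ha =>
    obtain ⟨m, rfl, rfl⟩ := ha
    rw [hom_freeMagma_lift]
    exact lift_mem_algPower' _ _

theorem exists_mem_algPower_of_surjective (φ : A →ₙₐ[𝔽] B) (hφ : Function.Surjective φ) {k : ℕ}
    {y : B} (hy : y ∈ algPower 𝔽 B k) : ∃ x ∈ algPower 𝔽 A k, φ x = y := by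
  induction hy using Submodule.span_induction with
  | zero => exact ⟨0, zero_mem _, map_zero _⟩
  | add a b _ _ ha hb =>
    obtain ⟨x, hx, rfl⟩ := ha
    obtain ⟨y, hy, rfl⟩ := hb
    exact ⟨x + y, add_mem hx hy, map_add _ _ _⟩
  | smul r a _ ha =>
    obtain ⟨x, hx, rfl⟩ := ha
    exact ⟨r • x, Submodule.smul_mem _ _ hx, map_smul _ _ _⟩
  | mem a ha =>
    obtain ⟨m, rfl, rfl⟩ := ha
    choose g hg using hφ
    refine ⟨FreeMagma.lift g m, lift_mem_algPower' _ _, ?_⟩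
    rw [hom_freeMagma_lift]
    simp only [hg]
    rfl

/-- The span of the values at `x` of all monomials equals the whole algebra. -/
def MonomialsSpan (𝔽 : Type u) [Field 𝔽] {A : Type u} [NonUnitalNonAssocRing A] [Module 𝔽 A]
    {ι : Type*} (x : ι → A) : Prop :=
  Submodule.span 𝔽 (Set.range (FreeMagma.lift x : FreeMagma ι → A)) = ⊤

theorem MonomialsSpan.induction {ι : Type*} {x : ι → A} (hx : MonomialsSpan 𝔽 x)
    {p : A → Prop} (a : A) (mem : ∀ m, p (FreeMagma.lift x m)) (zero : p 0)
    (add : ∀ a b, p a → p b → p (a + b)) (smul : ∀ (r : 𝔽) a, p a → p (r • a)) : p a := by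
  have ha : a ∈ Submodule.span 𝔽 (Set.range (FreeMagma.lift x : FreeMagma ι → A)) :=
    hx ▸ Submodule.mem_top
  induction ha using Submodule.span_induction with
  | zero => exact zero
  | add a b _ _ ha hb => exact add a b ha hb
  | smul r a _ ha => exact smul r a ha
  | mem a ha => obtain ⟨m, rfl⟩ := ha; exact mem m

theorem monomialsSpan_of_adjoin [IsScalarTower 𝔽 A A] [SMulCommClass 𝔽 A A] {ι : Type*}
    {x : ι → A} (hx : NonUnitalAlgebra.adjoin 𝔽 (Set.range x) = ⊤) : MonomialsSpan 𝔽 x := by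
  rw [MonomialsSpan, eq_top_iff]
  intro a _
  have ha : a ∈ NonUnitalAlgebra.adjoin 𝔽 (Set.range x) := hx ▸ NonUnitalAlgebra.mem_top
  induction ha using NonUnitalAlgebra.adjoin_induction with
  | mem a ha => obtain ⟨i, rfl⟩ := ha; exact Submodule.subset_span ⟨FreeMagma.of i, rfl⟩
  | add a b _ _ ha hb => exact add_mem (ha trivial) (hb trivial)
  | zero => exact zero_mem _
  | smul r a _ ha => exact Submodule.smul_mem _ _ (ha trivial)
  | mul a b _ _ ha hb =>
    refine mul_mem_of_span ?_ (ha trivial) (hb trivial)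
    rintro _ ⟨m, rfl⟩ _ ⟨m', rfl⟩
    exact Submodule.subset_span ⟨m * m', map_mul _ _ _⟩

/-- Expanding the letters of a monomial in the generators never lowers its degree but may raise it,
whence the inequality `k ≤ m.length`. -/
theorem MonomialsSpan.algPower_le [IsScalarTower 𝔽 A A] [SMulCommClass 𝔽 A A] {ι : Type*}
    {x : ι → A} (hx : MonomialsSpan 𝔽 x) {k : ℕ} :
    algPower 𝔽 A k ≤ Submodule.span 𝔽 {a | ∃ m : FreeMagma ι, k ≤ m.length ∧
      FreeMagma.lift x m = a} := by
  refine Submodule.span_le.2 ?_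
  rintro _ ⟨m, rfl, rfl⟩
  induction m using FreeMagma.recOnMul with
  | ih1 a =>
    change a ∈ _
    refine hx.induction a (fun m => Submodule.subset_span ⟨m, m.one_le_length, rfl⟩)
      (zero_mem _) (fun _ _ => add_mem) (fun r _ => Submodule.smul_mem _ r)
  | ih2 u v hu hv =>
    rw [map_mul]
    refine mul_mem_of_span ?_ hu hv
    rintro _ ⟨m, hm, rfl⟩ _ ⟨m', hm', rfl⟩
    exact Submodule.subset_span ⟨m * m', add_le_add hm hm', map_mul _ _ _⟩

theorem lift_eq_zero_of_nilpotent {c : ℕ} (hc : algPower 𝔽 A (c + 1) = ⊥) {ι : Type*}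
    (x : ι → A) {m : FreeMagma ι} (hm : c + 1 ≤ m.length) : FreeMagma.lift x m = 0 := by
  have := algPower_le (𝔽 := 𝔽) (by omega) hm (lift_mem_algPower' (𝔽 := 𝔽) x m)
  rwa [hc] at this

theorem MonomialsSpan.algPower_eq_span [IsScalarTower 𝔽 A A] [SMulCommClass 𝔽 A A] {ι : Type*}
    {x : ι → A} (hx : MonomialsSpan 𝔽 x) {c : ℕ} (hc : algPower 𝔽 A (c + 1) = ⊥) :
    algPower 𝔽 A c = Submodule.span 𝔽 {a | ∃ m : FreeMagma ι, m.length = c ∧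
      FreeMagma.lift x m = a} := by
  apply le_antisymm
  · refine hx.algPower_le.trans (Submodule.span_le.2 ?_)
    rintro _ ⟨m, hm, rfl⟩
    rcases hm.eq_or_lt with h | h
    · exact Submodule.subset_span ⟨m, h.symm, rfl⟩
    · rw [lift_eq_zero_of_nilpotent hc x h]
      exact zero_mem _
  · refine Submodule.span_le.2 ?_
    rintro _ ⟨m, rfl, rfl⟩
    exact lift_mem_algPower' _ _

theorem FreeMagma.finite_length_le {ι : Type*} [Finite ι] (k : ℕ) :
    {m : FreeMagma ι | m.length ≤ k}.Finite := by
  induction k with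
  | zero =>
    convert Set.finite_empty
    ext m
    have := m.one_le_length
    simp only [Set.mem_ofPred_eq, Set.mem_empty_iff_false, iff_false]
    omega
  | succ k ih =>
    refine ((Set.finite_range (FreeMagma.of : ι → FreeMagma ι)).union
      (Set.Finite.image2 (· * ·) ih ih)).subset ?_
    intro m hm
    induction m using FreeMagma.recOnMul with
    | ih1 x => exact Or.inl ⟨x, rfl⟩
    | ih2 u v _ _ =>
      have h1 := u.one_le_length
      have h2 := v.one_le_length
      simp only [Set.mem_ofPred_eq, length_mul] at hm
      exact Or.inr ⟨u, by simp only [Set.mem_ofPred_eq]; omega, v,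
        by simp only [Set.mem_ofPred_eq]; omega, rfl⟩

theorem MonomialsSpan.finite_of_nilpotent [Finite 𝔽] {ι : Type*} [Finite ι]
    {x : ι → A} (hx : MonomialsSpan 𝔽 x) {c : ℕ} (hc : algPower 𝔽 A (c + 1) = ⊥) :
    Finite A := by
  have : Module.Finite 𝔽 A := by
    refine ⟨Submodule.fg_def.2 ⟨FreeMagma.lift x '' {m | m.length ≤ c},
      (FreeMagma.finite_length_le c).image _, ?_⟩⟩
    rw [eq_top_iff, ← hx, Submodule.span_le]
    rintro _ ⟨m, rfl⟩
    by_cases hm : m.length ≤ c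
    · exact Submodule.subset_span ⟨m, hm, rfl⟩
    · rw [lift_eq_zero_of_nilpotent hc x (by omega)]
      exact zero_mem _
  exact Module.finite_of_finite 𝔽

theorem MonomialsSpan.hom_ext {ι : Type*} {x : ι → A} (hx : MonomialsSpan 𝔽 x)
    {φ ψ : A →ₙₐ[𝔽] B} (h : ∀ i, φ (x i) = ψ (x i)) : φ = ψ := by
  ext a
  refine hx.induction (p := fun a => φ a = ψ a) a (fun m => ?_) (by simp)
    (fun a b ha hb => by rw [map_add, map_add, ha, hb])
    (fun r a ha => by rw [map_smul, map_smul, ha])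
  rw [hom_freeMagma_lift, hom_freeMagma_lift]
  simp only [h]

/-- Values on proper products lie in the square anyway, so only the single letters have to be
compared. -/
theorem MonomialsSpan.sub_mem_two [IsScalarTower 𝔽 B B] [SMulCommClass 𝔽 B B] {ι : Type*}
    {x : ι → A} (hx : MonomialsSpan 𝔽 x) {φ ψ : A →ₙₐ[𝔽] B}
    (h : ∀ i, φ (x i) - ψ (x i) ∈ algPower 𝔽 B 2) (a : A) : φ a - ψ a ∈ algPower 𝔽 B 2 := by
  refine hx.induction (p := fun a => φ a - ψ a ∈ algPower 𝔽 B 2) a (fun m => ?_) (by simp)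
    (fun a b ha hb => ?_) (fun r a ha => ?_)
  · induction m using FreeMagma.recOnMul with
    | ih1 i => exact h i
    | ih2 u v _ _ =>
      rw [map_mul, map_mul, map_mul]
      exact sub_mem (mul_mem_algPower_two _ _) (mul_mem_algPower_two _ _)
  · rw [map_add, map_add, add_sub_add_comm]
    exact add_mem ha hb
  · rw [map_smul, map_smul, ← smul_sub]
    exact Submodule.smul_mem _ _ ha

/-- Homomorphisms that agree modulo `B ^ (r + 1)` on `A` agree modulo `B ^ (k + r)` on `A ^ k`. -/
theorem sub_mem_algPower_add [IsScalarTower 𝔽 B B] [SMulCommClass 𝔽 B B] {φ ψ : A →ₙₐ[𝔽] B}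
    {r : ℕ} (h : ∀ a, φ a - ψ a ∈ algPower 𝔽 B (r + 1)) {k : ℕ} {a : A}
    (ha : a ∈ algPower 𝔽 A k) : φ a - ψ a ∈ algPower 𝔽 B (k + r) := by
  induction ha using Submodule.span_induction with
  | zero => simp
  | add a b _ _ ha hb => rw [map_add, map_add, add_sub_add_comm]; exact add_mem ha hb
  | smul r a _ ha => rw [map_smul, map_smul, ← smul_sub]; exact Submodule.smul_mem _ _ ha
  | mem a ha =>
    obtain ⟨m, rfl, rfl⟩ := ha
    induction m using FreeMagma.recOnMul with
    | ih1 a => rw [add_comm]; exact h a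
    | ih2 u v hu hv =>
      rw [map_mul, map_mul, map_mul]
      have e : ∀ a b a' b' : B, a * b - a' * b' = (a - a') * b + a' * (b - b') := by
        intro a b a' b'
        rw [sub_mul, mul_sub]; abel
      rw [e, FreeMagma.length_mul]
      have h1 := algPower_mul hu (map_mem_algPower φ (lift_mem_algPower (𝔽 := 𝔽) v))
      have h2 := algPower_mul (map_mem_algPower ψ (lift_mem_algPower (𝔽 := 𝔽) u)) hv
      rw [show u.length + r + v.length = u.length + v.length + r by ring] at h1
      rw [← add_assoc] at h2
      exact add_mem h1 h2

theorem MonomialsSpan.exists_sub_mem_two [IsScalarTower 𝔽 A A] [SMulCommClass 𝔽 A A] {ι : Type*}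
    [Fintype ι] {x : ι → A} (hx : MonomialsSpan 𝔽 x) (a : A) :
    ∃ r : ι → 𝔽, a - ∑ i, r i • x i ∈ algPower 𝔽 A 2 := by
  classical
  refine hx.induction (p := fun a => ∃ r : ι → 𝔽, a - ∑ i, r i • x i ∈ algPower 𝔽 A 2) a
    (fun m => ?_) ⟨0, by simp⟩ ?_ ?_
  · induction m using FreeMagma.recOnMul with
    | ih1 i =>
      refine ⟨Pi.single i 1, ?_⟩
      rw [Finset.sum_eq_single i (fun j _ hj => by rw [Pi.single_eq_of_ne hj, zero_smul])
        (fun h => absurd (Finset.mem_univ i) h)]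
      simp
    | ih2 u v _ _ => exact ⟨0, by simpa using mul_mem_algPower_two _ _⟩
  · rintro a b ⟨r, hr⟩ ⟨s, hs⟩
    refine ⟨r + s, ?_⟩
    simp only [Pi.add_apply, add_smul, Finset.sum_add_distrib, add_sub_add_comm]
    exact add_mem hr hs
  · rintro t a ⟨r, hr⟩
    refine ⟨t • r, ?_⟩
    simp only [Pi.smul_apply, smul_eq_mul, mul_smul, ← Finset.smul_sum, ← smul_sub]
    exact Submodule.smul_mem _ _ hr

end Powers

/-! ### Free bases and the decomposition by supports of monomials -/

/-- The set of letters that occur in a nonassociative monomial. -/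
def FreeMagma.support {ι : Type*} [DecidableEq ι] : FreeMagma ι → Finset ι
  | FreeMagma.of i => {i}
  | FreeMagma.mul u v => u.support ∪ v.support

section Support

variable {𝔽 : Type u} [Field 𝔽] {A : Type u} [NonUnitalNonAssocRing A] [Module 𝔽 A]

section Letters

variable {ι : Type*} [DecidableEq ι]

theorem FreeMagma.support_of (i : ι) : (FreeMagma.of i).support = {i} := rfl

theorem FreeMagma.support_mul (u v : FreeMagma ι) :
    (u * v).support = u.support ∪ v.support := rfl

theorem FreeMagma.card_support_le (m : FreeMagma ι) : m.support.card ≤ m.length := by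
  induction m using FreeMagma.recOnMul with
  | ih1 i => exact le_rfl
  | ih2 u v hu hv =>
    rw [support_mul, length_mul]
    exact (Finset.card_union_le _ _).trans (add_le_add hu hv)

theorem FreeMagma.lift_congr {B : Type*} [Mul B] {y z : ι → B} (m : FreeMagma ι)
    (h : ∀ i ∈ m.support, y i = z i) : FreeMagma.lift y m = FreeMagma.lift z m := by
  induction m using FreeMagma.recOnMul with
  | ih1 i => exact h i (by simp [support_of])
  | ih2 u v hu hv =>
    rw [map_mul, map_mul, hu fun i hi => h i (Finset.mem_union_left _ hi),
      hv fun i hi => h i (Finset.mem_union_right _ hi)]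

theorem lift_eq_zero_of_mem_support {y : ι → A} (m : FreeMagma ι) {i : ι}
    (hi : i ∈ m.support) (h : y i = 0) : FreeMagma.lift y m = 0 := by
  induction m using FreeMagma.recOnMul with
  | ih1 j => rw [FreeMagma.support_of, Finset.mem_singleton] at hi; subst hi; exact h
  | ih2 u v hu hv =>
    rw [FreeMagma.support_mul, Finset.mem_union] at hi
    rw [map_mul]
    rcases hi with hi | hi
    · rw [hu hi, zero_mul]
    · rw [hv hi, mul_zero]

end Letters

/-- The family `x` generates `A`, and every map from `x` to `A` extends to an endomorphism:
`A` is free with basis `x` in the variety that it generates. -/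
structure IsFreeBasis (𝔽 : Type u) [Field 𝔽] {A : Type u} [NonUnitalNonAssocRing A] [Module 𝔽 A]
    {ι : Type*} (x : ι → A) : Prop where
  gen : MonomialsSpan 𝔽 x
  ext : ∀ y : ι → A, ∃ φ : A →ₙₐ[𝔽] A, ∀ i, φ (x i) = y i

/-- A subspace is fully invariant if all endomorphisms map it into itself. -/
def FullyInvariant (Z : Submodule 𝔽 A) : Prop := ∀ φ : A →ₙₐ[𝔽] A, ∀ z ∈ Z, φ z ∈ Z

namespace IsFreeBasis

variable {ι : Type*} {x : ι → A} (hx : IsFreeBasis 𝔽 x)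

/-- The endomorphism with prescribed values on the basis. -/
noncomputable def endo (y : ι → A) : A →ₙₐ[𝔽] A := (hx.ext y).choose

theorem endo_apply (y : ι → A) (i : ι) : hx.endo y (x i) = y i := (hx.ext y).choose_spec i

theorem endo_lift (y : ι → A) (m : FreeMagma ι) :
    hx.endo y (FreeMagma.lift x m) = FreeMagma.lift y m := by
  rw [hom_freeMagma_lift]
  simp only [endo_apply]

variable [DecidableEq ι] [Fintype ι]

omit [Fintype ι] in
include hx in
-- Setting `x i` to zero is an endomorphism `κ` that kills exactly the monomials containing `i`. So
-- `κ` selects the monomials without `i` and `1 - κ` those with `i`; composing over `i ∈ I` gives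
-- the projection. Being built from endomorphisms, it preserves fully invariant subspaces.
theorem exists_suppProj_aux (I Q : Finset ι) : ∃ p : A →ₗ[𝔽] A,
    (∀ m : FreeMagma ι, p (FreeMagma.lift x m) =
      if m.support ∩ I = Q ∩ I then FreeMagma.lift x m else 0) ∧
    ∀ Z : Submodule 𝔽 A, FullyInvariant Z → ∀ z ∈ Z, p z ∈ Z := by
  induction I using Finset.induction_on with
  | empty => exact ⟨LinearMap.id, by simp, fun Z _ z hz => hz⟩
  | insert i I hi ih =>
    obtain ⟨p, hp, hZ⟩ := ih
    let κ : A →ₗ[𝔽] A := (hx.endo fun j => if j = i then 0 else x j : A →ₗ[𝔽] A)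
    have hκ : ∀ m : FreeMagma ι, κ (FreeMagma.lift x m) =
        if i ∈ m.support then 0 else FreeMagma.lift x m := by
      intro m
      change hx.endo _ _ = _
      rw [endo_lift]
      split_ifs with h
      · exact lift_eq_zero_of_mem_support m h (if_pos rfl)
      · refine FreeMagma.lift_congr m fun j hj => if_neg ?_
        rintro rfl
        exact h hj
    have key : ∀ S : Finset ι, (S ∩ insert i I = Q ∩ insert i I) ↔
        ((i ∈ S ↔ i ∈ Q) ∧ S ∩ I = Q ∩ I) := by
      intro S
      simp only [Finset.ext_iff, Finset.mem_inter, Finset.mem_insert]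
      constructor
      · intro h
        exact ⟨by simpa using h i, fun a => by
          have := h a
          by_cases ha : a ∈ I
          · simpa [ha] using this
          · simp [ha]⟩
      · rintro ⟨h1, h2⟩ a
        have := h2 a
        by_cases hai : a = i
        · subst hai; simp [h1]
        · simpa [hai] using this
    by_cases hQ : i ∈ Q
    · refine ⟨p - κ ∘ₗ p, fun m => ?_, fun Z hZi z hz =>
        sub_mem (hZ Z hZi z hz) (hZi _ _ (hZ Z hZi z hz))⟩
      simp only [LinearMap.sub_apply, LinearMap.comp_apply, hp, key, hQ, iff_true]
      by_cases h1 : m.support ∩ I = Q ∩ I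
      · by_cases h2 : i ∈ m.support
        · simp [h1, h2, hκ]
        · simp [h1, h2, hκ]
      · simp [h1]
    · refine ⟨κ ∘ₗ p, fun m => ?_, fun Z hZi z hz => hZi _ _ (hZ Z hZi z hz)⟩
      simp only [LinearMap.comp_apply, hp, key, hQ, iff_false]
      by_cases h1 : m.support ∩ I = Q ∩ I
      · by_cases h2 : i ∈ m.support
        · simp [h1, h2, hκ]
        · simp [h1, h2, hκ]
      · simp [h1]

/-- The projection onto the span of the monomials with support exactly `Q`. -/
noncomputable def suppProj (Q : Finset ι) : A →ₗ[𝔽] A :=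
  (hx.exists_suppProj_aux Finset.univ Q).choose

theorem suppProj_lift (Q : Finset ι) (m : FreeMagma ι) :
    hx.suppProj Q (FreeMagma.lift x m) = if m.support = Q then FreeMagma.lift x m else 0 := by
  have := (hx.exists_suppProj_aux Finset.univ Q).choose_spec.1 m
  rw [suppProj, this]
  simp only [Finset.inter_univ]

theorem suppProj_mem (Q : Finset ι) {Z : Submodule 𝔽 A} (hZ : FullyInvariant Z) {z : A}
    (hz : z ∈ Z) : hx.suppProj Q z ∈ Z :=
  (hx.exists_suppProj_aux Finset.univ Q).choose_spec.2 Z hZ z hz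

theorem sum_suppProj (a : A) : ∑ Q, hx.suppProj Q a = a := by
  refine hx.gen.induction (p := fun a => ∑ Q, hx.suppProj Q a = a) a (fun m => ?_) (by simp)
    (fun a b ha hb => ?_) (fun r a ha => ?_)
  · simp [suppProj_lift]
  · simp only [map_add, Finset.sum_add_distrib, ha, hb]
  · simp only [map_smul, ← Finset.smul_sum, ha]

omit [Fintype ι] in
theorem union_singleton_eq_iff {S Q : Finset ι} {t : ι} (ht : t ∈ Q) :
    S ∪ {t} = Q ↔ S = Q.erase t ∨ S = Q := by
  constructor
  · rintro rfl
    by_cases h : t ∈ S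
    · right
      rw [Finset.union_eq_left.2 (by simpa using h)]
    · left
      ext a
      simp only [Finset.mem_erase, Finset.mem_union, Finset.mem_singleton]
      by_cases ha : a = t
      · subst ha; simp [h]
      · simp [ha]
  · rintro (rfl | rfl)
    · ext a
      simp only [Finset.mem_erase, Finset.mem_union, Finset.mem_singleton]
      by_cases ha : a = t
      · subst ha; simp [ht]
      · simp [ha]
    · exact Finset.union_eq_left.2 (by simpa using ht)

/-- Multiplying a monomial by `x t` produces support `Q` exactly from the supports `Q` and `Q \
{t}`. -/
theorem suppProj_mul_of_mem [IsScalarTower 𝔽 A A] {Q : Finset ι} {t : ι} (ht : t ∈ Q) (a : A) :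
    hx.suppProj Q (a * x t) =
      hx.suppProj (Q.erase t) a * x t + hx.suppProj Q a * x t := by
  refine hx.gen.induction (p := fun a => hx.suppProj Q (a * x t) =
      hx.suppProj (Q.erase t) a * x t + hx.suppProj Q a * x t) a (fun m => ?_) (by simp)
    (fun a b ha hb => ?_) (fun r a ha => ?_)
  · have e : FreeMagma.lift x m * x t = FreeMagma.lift x (m * FreeMagma.of t) := by
      rw [map_mul, FreeMagma.lift_of]
    rw [e, suppProj_lift, ← e, suppProj_lift, suppProj_lift, FreeMagma.support_mul,
      FreeMagma.support_of]
    simp only [union_singleton_eq_iff ht]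
    by_cases h1 : m.support = Q
    · have : m.support ≠ Q.erase t := fun h => by
        have := h1 ▸ ht
        rw [h] at this
        simp at this
      rw [if_pos (Or.inr h1), if_neg this, if_pos h1, zero_mul, zero_add]
    · by_cases h2 : m.support = Q.erase t
      · rw [if_pos (Or.inl h2), if_pos h2, if_neg h1, zero_mul, add_zero]
      · rw [if_neg (by tauto), if_neg h1, if_neg h2, zero_mul, zero_add]
  · simp only [add_mul, map_add, ha, hb]; abel
  · simp only [smul_mul_assoc, map_smul, ha, smul_add]

theorem suppProj_mul_of_mem' [SMulCommClass 𝔽 A A] {Q : Finset ι} {t : ι} (ht : t ∈ Q) (a : A) :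
    hx.suppProj Q (x t * a) =
      x t * hx.suppProj (Q.erase t) a + x t * hx.suppProj Q a := by
  refine hx.gen.induction (p := fun a => hx.suppProj Q (x t * a) =
      x t * hx.suppProj (Q.erase t) a + x t * hx.suppProj Q a) a (fun m => ?_) (by simp)
    (fun a b ha hb => ?_) (fun r a ha => ?_)
  · have e : x t * FreeMagma.lift x m = FreeMagma.lift x (FreeMagma.of t * m) := by
      rw [map_mul, FreeMagma.lift_of]
    rw [e, suppProj_lift, ← e, suppProj_lift, suppProj_lift, FreeMagma.support_mul,
      FreeMagma.support_of, Finset.union_comm]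
    simp only [union_singleton_eq_iff ht]
    by_cases h1 : m.support = Q
    · have : m.support ≠ Q.erase t := fun h => by
        have := h1 ▸ ht
        rw [h] at this
        simp at this
      rw [if_pos (Or.inr h1), if_neg this, if_pos h1, mul_zero, zero_add]
    · by_cases h2 : m.support = Q.erase t
      · rw [if_pos (Or.inl h2), if_pos h2, if_neg h1, mul_zero, add_zero]
      · rw [if_neg (by tauto), if_neg h1, if_neg h2, mul_zero, zero_add]
  · simp only [mul_add, map_add, ha, hb]; abel
  · simp only [mul_smul_comm, map_smul, ha, smul_add]

theorem suppProj_eq_zero_of_lift {Q : Finset ι} (h : ∀ m : FreeMagma ι, m.support = Q →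
    FreeMagma.lift x m = 0) (a : A) : hx.suppProj Q a = 0 := by
  refine hx.gen.induction (p := fun a => hx.suppProj Q a = 0) a (fun m => ?_) (by simp)
    (fun a b ha hb => by rw [map_add, ha, hb, add_zero]) (fun r a ha => by
      rw [map_smul, ha, smul_zero])
  rw [suppProj_lift]
  split_ifs with hm
  · exact h m hm
  · rfl

theorem suppProj_mul_of_notMem [IsScalarTower 𝔽 A A] {Q : Finset ι} {t : ι} (ht : t ∉ Q) (a : A) :
    hx.suppProj Q (a * x t) = 0 := by
  refine hx.gen.induction (p := fun a => hx.suppProj Q (a * x t) = 0) a (fun m => ?_) (by simp)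
    (fun a b ha hb => by rw [add_mul, map_add, ha, hb, add_zero]) (fun r a ha => by
      rw [smul_mul_assoc, map_smul, ha, smul_zero])
  have e : FreeMagma.lift x m * x t = FreeMagma.lift x (m * FreeMagma.of t) := by
    rw [map_mul, FreeMagma.lift_of]
  rw [e, suppProj_lift, if_neg]
  rintro rfl
  simp [FreeMagma.support_mul, FreeMagma.support_of] at ht

theorem suppProj_mul_of_notMem' [SMulCommClass 𝔽 A A] {Q : Finset ι} {t : ι} (ht : t ∉ Q) (a : A) :
    hx.suppProj Q (x t * a) = 0 := by
  refine hx.gen.induction (p := fun a => hx.suppProj Q (x t * a) = 0) a (fun m => ?_) (by simp)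
    (fun a b ha hb => by rw [mul_add, map_add, ha, hb, add_zero]) (fun r a ha => by
      rw [mul_smul_comm, map_smul, ha, smul_zero])
  have e : x t * FreeMagma.lift x m = FreeMagma.lift x (FreeMagma.of t * m) := by
    rw [map_mul, FreeMagma.lift_of]
  rw [e, suppProj_lift, if_neg]
  rintro rfl
  simp [FreeMagma.support_mul, FreeMagma.support_of] at ht

theorem suppProj_eq_zero {c : ℕ} (hc : algPower 𝔽 A (c + 1) = ⊥) {Q : Finset ι}
    (hQ : c < Q.card) (a : A) : hx.suppProj Q a = 0 :=
  hx.suppProj_eq_zero_of_lift (fun m hm => lift_eq_zero_of_nilpotent hc x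
    (by have := m.card_support_le; rw [hm] at this; omega)) a

/-- Endomorphisms that agree on the letters of `Q` agree on the image of `suppProj Q`. -/
theorem hom_suppProj_congr {φ ψ : A →ₙₐ[𝔽] A} {Q : Finset ι} (h : ∀ i ∈ Q, φ (x i) = ψ (x i))
    (a : A) : φ (hx.suppProj Q a) = ψ (hx.suppProj Q a) := by
  refine hx.gen.induction (p := fun a => φ (hx.suppProj Q a) = ψ (hx.suppProj Q a)) a
    (fun m => ?_) (by simp) (fun a b ha hb => by simp only [map_add, ha, hb])
    (fun r a ha => by simp only [map_smul, ha])
  rw [suppProj_lift]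
  split_ifs with hm
  · rw [hom_freeMagma_lift, hom_freeMagma_lift]
    exact FreeMagma.lift_congr m fun i hi => h i (hm ▸ hi)
  · rw [map_zero, map_zero]

end IsFreeBasis

/-! ### Annihilators modulo a fully invariant subspace, tested on generators -/

/-- The elements that multiply all of `A` into `Z`. -/
def annStep [IsScalarTower 𝔽 A A] [SMulCommClass 𝔽 A A] (Z : Submodule 𝔽 A) :
    Submodule 𝔽 A where
  carrier := {x | ∀ a : A, a * x ∈ Z ∧ x * a ∈ Z}
  zero_mem' := fun a => by simp
  add_mem' := fun hx hy a =>
    ⟨by rw [mul_add]; exact add_mem (hx a).1 (hy a).1,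
      by rw [add_mul]; exact add_mem (hx a).2 (hy a).2⟩
  smul_mem' := fun r x hx a =>
    ⟨by rw [mul_smul_comm]; exact Z.smul_mem r (hx a).1,
      by rw [smul_mul_assoc]; exact Z.smul_mem r (hx a).2⟩

variable [IsScalarTower 𝔽 A A] [SMulCommClass 𝔽 A A]

namespace IsFreeBasis

variable {ι : Type*} [DecidableEq ι] [Fintype ι] {x : ι → A} (hx : IsFreeBasis 𝔽 x)

/-- One generator `x t` that does not occur in the component is a universal test element: it can be
sent to any `b` while the letters of `S` follow `φ`. -/
theorem hom_suppProj_mem_annStep {Z : Submodule 𝔽 A} (hZ : FullyInvariant Z) {S : Finset ι}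
    {t : ι} (ht : t ∉ S) {a : A} (h1 : hx.suppProj S a * x t ∈ Z)
    (h2 : x t * hx.suppProj S a ∈ Z) (φ : A →ₙₐ[𝔽] A) : φ (hx.suppProj S a) ∈ annStep Z := by
  intro b
  let ψ := hx.endo fun i => if i = t then b else φ (x i)
  have hψ : φ (hx.suppProj S a) = ψ (hx.suppProj S a) := by
    refine hx.hom_suppProj_congr (fun i hi => ?_) a
    rw [endo_apply, if_neg]
    rintro rfl
    exact ht hi
  have hb : b = ψ (x t) := by rw [endo_apply, if_pos rfl]
  rw [hψ, hb, ← map_mul, ← map_mul]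
  exact ⟨hZ _ _ h2, hZ _ _ h1⟩

/-- Downward induction on `S`. The component of `a * x t` with support `S ∪ {t}` is the sum of two
products, of the `S`-component and of the `S ∪ {t}`-component of `a` with `x t`. The second is in
`Z` by induction, hence so is the first, and `t` is free in `S`. The induction starts because the
full support has more than `c` letters. -/
theorem hom_suppProj_mem_annStep_of_gen {c : ℕ} (hc : algPower 𝔽 A (c + 1) = ⊥)
    (hn : c < Fintype.card ι) {Z : Submodule 𝔽 A} (hZ : FullyInvariant Z) {a : A}
    (h : ∀ t, a * x t ∈ Z ∧ x t * a ∈ Z) (S : Finset ι) (φ : A →ₙₐ[𝔽] A) :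
    φ (hx.suppProj S a) ∈ annStep Z := by
  induction hk : Fintype.card ι - S.card using Nat.strong_induction_on generalizing S φ with
  | _ k ih =>
    by_cases hS : S = Finset.univ
    · rw [hx.suppProj_eq_zero hc (by rwa [hS, Finset.card_univ]), map_zero]
      exact zero_mem _
    · obtain ⟨t, ht⟩ : ∃ t, t ∉ S := by
        by_contra hcon
        push Not at hcon
        exact hS (Finset.eq_univ_of_forall hcon)
      have hcard : S.card < Fintype.card ι := (Finset.card_lt_iff_ne_univ S).2 hS
      have h1 := ih (Fintype.card ι - (insert t S).card)
        (by rw [Finset.card_insert_of_notMem ht]; omega) (insert t S) (NonUnitalAlgHom.id 𝔽 A) rfl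
      change hx.suppProj (insert t S) a ∈ annStep Z at h1
      have h2 := hx.suppProj_mem (insert t S) hZ (h t).1
      have h3 := hx.suppProj_mem (insert t S) hZ (h t).2
      rw [hx.suppProj_mul_of_mem (Finset.mem_insert_self t S), Finset.erase_insert ht] at h2
      rw [hx.suppProj_mul_of_mem' (Finset.mem_insert_self t S), Finset.erase_insert ht] at h3
      exact hx.hom_suppProj_mem_annStep hZ ht
        ((Submodule.add_mem_iff_left _ (h1 (x t)).2).1 h2)
        ((Submodule.add_mem_iff_left _ (h1 (x t)).1).1 h3) φ

include hx in
theorem hom_mem_annStep_of_gen {c : ℕ} (hc : algPower 𝔽 A (c + 1) = ⊥)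
    (hn : c < Fintype.card ι) {Z : Submodule 𝔽 A} (hZ : FullyInvariant Z) {a : A}
    (h : ∀ t, a * x t ∈ Z ∧ x t * a ∈ Z) (φ : A →ₙₐ[𝔽] A) : φ a ∈ annStep Z := by
  rw [← hx.sum_suppProj a, map_sum]
  exact sum_mem fun S _ => hx.hom_suppProj_mem_annStep_of_gen hc hn hZ h S φ

include hx in
-- This is not formal, since endomorphisms need not be surjective; it depends on having more than
-- `c` free generators.
theorem fullyInvariant_annStep {c : ℕ} (hc : algPower 𝔽 A (c + 1) = ⊥)
    (hn : c < Fintype.card ι) {Z : Submodule 𝔽 A} (hZ : FullyInvariant Z) :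
    FullyInvariant (annStep Z) := fun φ _ ha =>
  hx.hom_mem_annStep_of_gen hc hn hZ (fun t => ⟨(ha (x t)).2, (ha (x t)).1⟩) φ

end IsFreeBasis

end Support

/-! ### Two dimension inequalities -/

section LinearAlgebra

variable {K V V' : Type*} [Field K] [AddCommGroup V] [Module K V] [AddCommGroup V']
  [Module K V'] [Module.Finite K V] [Module.Finite K V']

open Module

omit [Module.Finite K V'] in
theorem finrank_map_add_finrank_inf_ker (f : V →ₗ[K] V') (S : Submodule K V) :
    finrank K (S.map f) + finrank K ↥(S ⊓ LinearMap.ker f) = finrank K S := by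
  have h := LinearMap.finrank_range_add_finrank_ker (f.domRestrict S)
  rw [LinearMap.range_domRestrict, LinearMap.ker_domRestrict] at h
  rw [← h]
  congr 1
  have : (LinearMap.ker f).comap S.subtype = (S ⊓ LinearMap.ker f).submoduleOf S := by
    simp [Submodule.submoduleOf]
  rw [this]
  exact ((Submodule.submoduleOfEquivOfLe inf_le_left).finrank_eq).symm

/-- `f` embeds S / (S ∩ f⁻¹T₀) into T₁ / T₀. -/
theorem finrank_add_le_of_map_le (f : V →ₗ[K] V') {S : Submodule K V} {T₀ T₁ : Submodule K V'}
    (hT : T₀ ≤ T₁) (hf : S.map f ≤ T₁) :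
    finrank K S + finrank K T₀ ≤ finrank K ↥(S ⊓ T₀.comap f) + finrank K T₁ := by
  have h1 := finrank_map_add_finrank_inf_ker f S
  have h2 := finrank_map_add_finrank_inf_ker f (S ⊓ T₀.comap f)
  have h3 := Submodule.finrank_sup_add_finrank_inf_eq (S.map f) T₀
  have h4 : finrank K ↥(S.map f ⊔ T₀) ≤ finrank K T₁ := Submodule.finrank_mono (sup_le hf hT)
  have h5 : (S ⊓ T₀.comap f).map f = S.map f ⊓ T₀ := by
    apply SetLike.coe_injective
    exact (Set.image_inter_preimage f S T₀)
  have h6 : S ⊓ T₀.comap f ⊓ LinearMap.ker f = S ⊓ LinearMap.ker f := by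
    ext y
    simp only [Submodule.mem_inf, Submodule.mem_comap, LinearMap.mem_ker]
    constructor
    · tauto
    · rintro ⟨h, h'⟩
      exact ⟨⟨h, h' ▸ zero_mem _⟩, h'⟩
  rw [h5, h6] at h2
  omega

/-- The pair (f, g) maps S₁ into (T₁ / T₀)² with kernel inside S₀. Later `f` and `g` are right and
left multiplication by a generator, which is the origin of the factor 2. -/
theorem finrank_add_two_mul_le (f g : V →ₗ[K] V') {S₀ S₁ : Submodule K V}
    {T₀ T₁ : Submodule K V'} (hT : T₀ ≤ T₁) (hf : S₁.map f ≤ T₁) (hg : S₁.map g ≤ T₁)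
    (h : ∀ y ∈ S₁, f y ∈ T₀ → g y ∈ T₀ → y ∈ S₀) :
    finrank K S₁ + 2 * finrank K T₀ ≤ finrank K S₀ + 2 * finrank K T₁ := by
  have h1 := finrank_add_le_of_map_le f hT hf
  have h2 := finrank_add_le_of_map_le g (S := S₁ ⊓ T₀.comap f) hT
    ((Submodule.map_mono inf_le_left).trans hg)
  have h3 : finrank K ↥(S₁ ⊓ T₀.comap f ⊓ T₀.comap g) ≤ finrank K S₀ :=
    Submodule.finrank_mono fun y hy => h y hy.1.1 hy.1.2 hy.2
  omega

end LinearAlgebra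

/-! ### Binary weights: a total order on supports that is additive under adjoining a letter -/

section Weights

/-- The weight of a set: the natural number whose binary digits are given by the set. -/
def binaryWeight {n : ℕ} (S : Finset (Fin n)) : ℕ := ∑ i ∈ S, 2 ^ (i : ℕ)

theorem binaryWeight_eq {n : ℕ} (S : Finset (Fin n)) :
    binaryWeight S = ∑ i ∈ S.map Fin.valEmbedding, 2 ^ i := by
  rw [Finset.sum_map]; rfl

theorem binaryWeight_injective {n : ℕ} :
    Function.Injective (binaryWeight : Finset (Fin n) → ℕ) := by
  intro S T h
  rw [binaryWeight_eq, binaryWeight_eq] at h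
  exact Finset.map_injective _ (Finset.geomSum_injective le_rfl h)

theorem binaryWeight_lt {n : ℕ} (S : Finset (Fin n)) : binaryWeight S < 2 ^ n := by
  rw [binaryWeight_eq]
  refine Nat.geomSum_lt le_rfl fun k hk => ?_
  obtain ⟨i, -, rfl⟩ := Finset.mem_map.1 hk
  exact i.2

theorem binaryWeight_insert {n : ℕ} {S : Finset (Fin n)} {t : Fin n} (ht : t ∉ S) :
    binaryWeight (insert t S) = 2 ^ (t : ℕ) + binaryWeight S := Finset.sum_insert ht

theorem sum_binaryWeight {n : ℕ} (f : ℕ → ℕ) :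
    ∑ S : Finset (Fin n), f (binaryWeight S) = ∑ m ∈ Finset.range (2 ^ n), f m := by
  have himg : Finset.univ.image (binaryWeight : Finset (Fin n) → ℕ) = Finset.range (2 ^ n) := by
    refine Finset.eq_of_subset_of_card_le ?_ ?_
    · intro m hm
      obtain ⟨S, -, rfl⟩ := Finset.mem_image.1 hm
      exact Finset.mem_range.2 (binaryWeight_lt S)
    · rw [Finset.card_image_of_injective _ binaryWeight_injective]
      simp
  rw [← himg, Finset.sum_image fun _ _ _ _ h => binaryWeight_injective h]

/-- A set R arises as `insert t S` with `t ∉ S` in as many ways as it has elements. -/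
theorem sum_sum_insert {n : ℕ} (f : Finset (Fin n) → ℕ) :
    ∑ S : Finset (Fin n), ∑ t ∈ Sᶜ, f (insert t S) = ∑ S : Finset (Fin n), S.card * f S := by
  have h : ∀ S : Finset (Fin n), S.card * f S = ∑ t ∈ S, f S := fun S => by simp
  simp_rw [h]
  rw [Finset.sum_sigma', Finset.sum_sigma']
  refine Finset.sum_bij' (fun p _ => ⟨insert p.2 p.1, p.2⟩) (fun p _ => ⟨p.1.erase p.2, p.2⟩)
    ?_ ?_ ?_ ?_ ?_
  · rintro ⟨S, t⟩ _; simp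
  · rintro ⟨S, t⟩ _; simp
  · rintro ⟨S, t⟩ h
    simp only [Finset.mem_sigma, Finset.mem_univ, true_and, Finset.mem_compl] at h
    simp [Finset.erase_insert h]
  · rintro ⟨S, t⟩ h
    simp only [Finset.mem_sigma, Finset.mem_univ, true_and] at h
    simp [Finset.insert_erase h]
  · rintro ⟨S, t⟩ _; rfl

end Weights

/-! ### Growth of dimensions under multiplication by the generators -/

section Ratio

variable {𝔽 : Type u} [Field 𝔽] {A : Type u} [NonUnitalNonAssocRing A] [Module 𝔽 A]
variable {n : ℕ} {x : Fin n → A} (hx : IsFreeBasis 𝔽 x)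

open Module

namespace IsFreeBasis

/-- The elements of `E` whose components of weight at least `m` lie in `Z`. -/
noncomputable def suppFilt (E Z : Submodule 𝔽 A) (m : ℕ) : Submodule 𝔽 A where
  carrier := {y | y ∈ E ∧ ∀ R, m ≤ binaryWeight R → hx.suppProj R y ∈ Z}
  zero_mem' := ⟨zero_mem _, fun R _ => by rw [map_zero]; exact zero_mem _⟩
  add_mem' := fun ha hb => ⟨add_mem ha.1 hb.1, fun R hR => by
    rw [map_add]; exact add_mem (ha.2 R hR) (hb.2 R hR)⟩
  smul_mem' := fun r a ha => ⟨E.smul_mem r ha.1, fun R hR => by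
    rw [map_smul]; exact Z.smul_mem r (ha.2 R hR)⟩

theorem suppFilt_mono (E Z : Submodule 𝔽 A) : Monotone (hx.suppFilt E Z) :=
  fun _ _ h _ hy => ⟨hy.1, fun R hR => hy.2 R (h.trans hR)⟩

theorem suppFilt_zero (E : Submodule 𝔽 A) {Z : Submodule 𝔽 A} (hZ : FullyInvariant Z) :
    hx.suppFilt E Z 0 = E ⊓ Z := by
  ext y
  refine ⟨fun hy => ⟨hy.1, ?_⟩, fun hy => ⟨hy.1, fun R _ => hx.suppProj_mem R hZ hy.2⟩⟩
  rw [← hx.sum_suppProj y]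
  exact sum_mem fun R _ => hy.2 R (Nat.zero_le _)

theorem suppFilt_top (E Z : Submodule 𝔽 A) : hx.suppFilt E Z (2 ^ n) = E := by
  ext y
  exact ⟨fun hy => hy.1, fun hy => ⟨hy, fun R hR =>
    absurd hR (not_le.2 (binaryWeight_lt R))⟩⟩

variable [Module.Finite 𝔽 A]

/-- The binary weights run through 0, …, 2^n - 1 exactly once, so the sum over all supports
telescopes along the filtration. -/
theorem sum_finrank_suppFilt (E : Submodule 𝔽 A) {Z : Submodule 𝔽 A} (hZ : FullyInvariant Z) :
    ∑ S : Finset (Fin n), (finrank 𝔽 (hx.suppFilt E Z (binaryWeight S + 1)) -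
      finrank 𝔽 (hx.suppFilt E Z (binaryWeight S))) = finrank 𝔽 E - finrank 𝔽 ↥(E ⊓ Z) := by
  rw [sum_binaryWeight fun m => finrank 𝔽 (hx.suppFilt E Z (m + 1)) -
      finrank 𝔽 (hx.suppFilt E Z m),
    Finset.sum_range_tsub fun i j h => Submodule.finrank_mono (hx.suppFilt_mono E Z h),
    suppFilt_top, suppFilt_zero _ _ hZ]

omit [Module.Finite 𝔽 A] in
theorem suppFilt_succ_eq {c : ℕ} (hc : algPower 𝔽 A (c + 1) = ⊥) (E Z : Submodule 𝔽 A)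
    {S : Finset (Fin n)} (hS : c < S.card) :
    hx.suppFilt E Z (binaryWeight S + 1) = hx.suppFilt E Z (binaryWeight S) := by
  refine le_antisymm (fun y hy => ⟨hy.1, fun R hR => ?_⟩) (hx.suppFilt_mono E Z (Nat.le_succ _))
  rcases hR.eq_or_lt with h | h
  · rw [← binaryWeight_injective h, hx.suppProj_eq_zero hc hS]
    exact zero_mem _
  · exact hy.2 R h

variable [IsScalarTower 𝔽 A A] [SMulCommClass 𝔽 A A]

/-- Here leading supports are compared. Multiplication by `x t` carries leading support `S` to `S ∪
{t}`: a heavier component of the product comes only from components of `y` heavier than `S`, because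
weights add. By `hom_suppProj_mem_annStep` the leading component lies in `annStep Z` as soon as both
its products with `x t` lie in `Z`. -/
theorem finrank_suppFilt_jump {Z : Submodule 𝔽 A} (hZ : FullyInvariant Z)
    {E E' : Submodule 𝔽 A} (hE : ∀ y ∈ E, ∀ t, y * x t ∈ E' ∧ x t * y ∈ E')
    {S : Finset (Fin n)} {t : Fin n} (ht : t ∉ S) :
    finrank 𝔽 (hx.suppFilt E (annStep Z) (binaryWeight S + 1)) -
      finrank 𝔽 (hx.suppFilt E (annStep Z) (binaryWeight S)) ≤
    2 * (finrank 𝔽 (hx.suppFilt E' Z (binaryWeight (insert t S) + 1)) -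
      finrank 𝔽 (hx.suppFilt E' Z (binaryWeight (insert t S)))) := by
  have hw := binaryWeight_insert ht
  have herase : ∀ Q : Finset (Fin n), t ∈ Q →
      binaryWeight Q = 2 ^ (t : ℕ) + binaryWeight (Q.erase t) := fun Q hQ => by
    conv_lhs => rw [← Finset.insert_erase hQ]
    exact binaryWeight_insert (Finset.notMem_erase t Q)
  have key := finrank_add_two_mul_le (K := 𝔽) (LinearMap.mulRight 𝔽 (x t))
    (LinearMap.mulLeft 𝔽 (x t))
    (S₀ := hx.suppFilt E (annStep Z) (binaryWeight S))
    (S₁ := hx.suppFilt E (annStep Z) (binaryWeight S + 1))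
    (T₀ := hx.suppFilt E' Z (binaryWeight (insert t S)))
    (T₁ := hx.suppFilt E' Z (binaryWeight (insert t S) + 1))
    (hx.suppFilt_mono _ _ (Nat.le_succ _)) ?_ ?_ ?_
  · omega
  · rintro _ ⟨y, hy, rfl⟩
    refine ⟨(hE y hy.1 t).1, fun Q hQ => ?_⟩
    rw [LinearMap.mulRight_apply]
    by_cases htQ : t ∈ Q
    · rw [hx.suppProj_mul_of_mem htQ]
      exact add_mem ((hy.2 _ (by have := herase Q htQ; omega)) (x t)).2
        ((hy.2 _ (by have := Nat.two_pow_pos (t : ℕ); omega)) (x t)).2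
    · rw [hx.suppProj_mul_of_notMem htQ]
      exact zero_mem _
  · rintro _ ⟨y, hy, rfl⟩
    refine ⟨(hE y hy.1 t).2, fun Q hQ => ?_⟩
    rw [LinearMap.mulLeft_apply]
    by_cases htQ : t ∈ Q
    · rw [hx.suppProj_mul_of_mem' htQ]
      exact add_mem ((hy.2 _ (by have := herase Q htQ; omega)) (x t)).1
        ((hy.2 _ (by have := Nat.two_pow_pos (t : ℕ); omega)) (x t)).1
    · rw [hx.suppProj_mul_of_notMem' htQ]
      exact zero_mem _
  · intro y hy h1 h2
    refine ⟨hy.1, fun R hR => ?_⟩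
    rcases hR.eq_or_lt with h | h
    · have hRS := binaryWeight_injective h
      subst hRS
      have h1 := h1.2 (insert t S) le_rfl
      have h2 := h2.2 (insert t S) le_rfl
      -- The component of `y` at `S ∪ {t}` is heavier than `S`, so its products are already in `Z`;
      -- removing them isolates the component at `S`.
      have h3 := hy.2 (insert t S) (by have := Nat.two_pow_pos (t : ℕ); omega) (x t)
      rw [LinearMap.mulRight_apply, hx.suppProj_mul_of_mem (Finset.mem_insert_self t S),
        Finset.erase_insert ht] at h1
      rw [LinearMap.mulLeft_apply, hx.suppProj_mul_of_mem' (Finset.mem_insert_self t S),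
        Finset.erase_insert ht] at h2
      exact hx.hom_suppProj_mem_annStep hZ ht ((Submodule.add_mem_iff_left _ h3.2).1 h1)
        ((Submodule.add_mem_iff_left _ h3.1).1 h2) (NonUnitalAlgHom.id 𝔽 A)
    · exact hy.2 R h

include hx in
/-- Multiplication by the basis multiplies dimensions by a factor of order at least `n`. -/
theorem mul_finrank_le {c : ℕ} (hc : algPower 𝔽 A (c + 1) = ⊥) (hn : c < n)
    {Z : Submodule 𝔽 A} (hZ : FullyInvariant Z) {E E' : Submodule 𝔽 A}
    (hE : ∀ y ∈ E, ∀ t, y * x t ∈ E' ∧ x t * y ∈ E') :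
    (n - c) * (finrank 𝔽 E - finrank 𝔽 ↥(E ⊓ annStep Z)) ≤
      2 * c * (finrank 𝔽 E' - finrank 𝔽 ↥(E' ⊓ Z)) := by
  rw [← hx.sum_finrank_suppFilt E (hx.fullyInvariant_annStep hc (by simpa using hn) hZ),
    ← hx.sum_finrank_suppFilt E' hZ, Finset.mul_sum]
  calc _ ≤ ∑ S : Finset (Fin n), ∑ t ∈ Sᶜ,
        2 * (finrank 𝔽 (hx.suppFilt E' Z (binaryWeight (insert t S) + 1)) -
          finrank 𝔽 (hx.suppFilt E' Z (binaryWeight (insert t S)))) := by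
        refine Finset.sum_le_sum fun S _ => ?_
        by_cases hS : c < S.card
        · rw [hx.suppFilt_succ_eq hc _ _ hS, Nat.sub_self, mul_zero]
          exact Nat.zero_le _
        -- At least n - c letters are absent from `S`, and each yields a bound for the same jump.
        · calc _ ≤ Sᶜ.card * _ := Nat.mul_le_mul_right _ (by
                rw [Finset.card_compl, Fintype.card_fin]; omega)
            _ = ∑ t ∈ Sᶜ, _ := by rw [Finset.sum_const, smul_eq_mul]
            _ ≤ _ := Finset.sum_le_sum fun t ht =>
                hx.finrank_suppFilt_jump hZ hE (Finset.mem_compl.1 ht)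
    _ = ∑ S : Finset (Fin n), S.card * (2 * (finrank 𝔽 (hx.suppFilt E' Z (binaryWeight S + 1)) -
          finrank 𝔽 (hx.suppFilt E' Z (binaryWeight S)))) :=
        sum_sum_insert fun S => 2 * (finrank 𝔽 (hx.suppFilt E' Z (binaryWeight S + 1)) -
          finrank 𝔽 (hx.suppFilt E' Z (binaryWeight S)))
    _ ≤ _ := by
        rw [Finset.mul_sum]
        refine Finset.sum_le_sum fun S _ => ?_
        by_cases hS : c < S.card
        · rw [hx.suppFilt_succ_eq hc _ _ hS, Nat.sub_self, mul_zero, mul_zero]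
          exact Nat.zero_le _
        · rw [← mul_assoc, mul_comm _ 2]
          exact Nat.mul_le_mul_right _ (Nat.mul_le_mul_left _ (not_lt.1 hS))

end IsFreeBasis

end Ratio

/-! ### Generators independent modulo the square -/

section MinimalGenerators

variable {𝔽 : Type u} [Field 𝔽] {A : Type u} [NonUnitalNonAssocRing A] [Module 𝔽 A]

theorem algPower_two_le {N : Submodule 𝔽 A} (h : ∀ a b : A, a * b ∈ N) : algPower 𝔽 A 2 ≤ N := by
  refine Submodule.span_le.2 ?_
  rintro _ ⟨m, hm, rfl⟩
  cases m using FreeMagma.recOnMul with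
  | ih1 a => simp [FreeMagma.length] at hm
  | ih2 u v => rw [map_mul]; exact h _ _

variable [IsScalarTower 𝔽 A A] [SMulCommClass 𝔽 A A]

theorem algPower_eq_top_of_two (h : algPower 𝔽 A 2 = ⊤) (k : ℕ) : algPower 𝔽 A (k + 1) = ⊤ := by
  induction k with
  | zero => exact algPower_one
  | succ k ih =>
    rw [eq_top_iff, ← h]
    exact algPower_two_le fun a b => algPower_mul_right b (ih ▸ Submodule.mem_top)

omit [IsScalarTower 𝔽 A A] [SMulCommClass 𝔽 A A] in
/-- A finite generating family that is linearly independent modulo `A ^ 2`. -/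
structure IsMinGen (𝔽 : Type u) [Field 𝔽] {A : Type u} [NonUnitalNonAssocRing A] [Module 𝔽 A]
    {ι : Type*} [Fintype ι] (x : ι → A) : Prop where
  gen : MonomialsSpan 𝔽 x
  ind : ∀ r : ι → 𝔽, ∑ i, r i • x i ∈ algPower 𝔽 A 2 → r = 0

/-- In a relation modulo A² with a nonzero coefficient at `j`, send `x j` to an arbitrary `b` and
the other generators to 0. This gives A = A², so all powers equal A, against nilpotency. -/
theorem IsFreeBasis.isMinGen {ι : Type*} [Fintype ι] {x : ι → A} (hx : IsFreeBasis 𝔽 x) {c : ℕ}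
    (hc : algPower 𝔽 A (c + 1) = ⊥) (hne : algPower 𝔽 A c ≠ ⊥) : IsMinGen 𝔽 x := by
  classical
  refine ⟨hx.gen, fun r hr => ?_⟩
  by_contra hcon
  obtain ⟨j, hj⟩ := Function.ne_iff.1 hcon
  have h2 : algPower 𝔽 A 2 = ⊤ := by
    rw [eq_top_iff]
    intro b _
    have h := map_mem_algPower (hx.endo fun i => if i = j then b else 0) hr
    simp only [map_sum, map_smul, IsFreeBasis.endo_apply, smul_ite, smul_zero,
      Finset.sum_ite_eq', Finset.mem_univ, if_true] at h
    exact (Submodule.smul_mem_iff _ hj).1 h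
  have h3 := algPower_eq_top_of_two h2 c
  rw [hc] at h3
  exact hne (eq_bot_iff.2 (le_top.trans h3.ge))

namespace IsMinGen

variable {ι : Type*} [Fintype ι] {x : ι → A} (hx : IsMinGen 𝔽 x)

omit [IsScalarTower 𝔽 A A] [SMulCommClass 𝔽 A A] in
include hx in
theorem coord_unique {a : A} {r s : ι → 𝔽} (hr : a - ∑ i, r i • x i ∈ algPower 𝔽 A 2)
    (hs : a - ∑ i, s i • x i ∈ algPower 𝔽 A 2) : r = s := by
  have h := sub_mem hs hr
  rw [sub_sub_sub_cancel_left, ← Finset.sum_sub_distrib] at h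
  simp only [← sub_smul] at h
  have := hx.ind (fun i => r i - s i) h
  ext i
  exact sub_eq_zero.1 (congrFun this i)

/-- The coordinates of an element modulo `A ^ 2`. -/
noncomputable def coord : A →ₗ[𝔽] (ι → 𝔽) where
  toFun a := (hx.gen.exists_sub_mem_two a).choose
  map_add' a b := by
    refine hx.coord_unique (hx.gen.exists_sub_mem_two (a + b)).choose_spec ?_
    simp only [Pi.add_apply, add_smul, Finset.sum_add_distrib, add_sub_add_comm]
    exact add_mem (hx.gen.exists_sub_mem_two a).choose_spec
      (hx.gen.exists_sub_mem_two b).choose_spec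
  map_smul' t a := by
    refine hx.coord_unique (hx.gen.exists_sub_mem_two (t • a)).choose_spec ?_
    simp only [Pi.smul_apply, smul_eq_mul, mul_smul, ← Finset.smul_sum, ← smul_sub,
      RingHom.id_apply]
    exact Submodule.smul_mem _ _ (hx.gen.exists_sub_mem_two a).choose_spec

theorem coord_spec (a : A) : a - ∑ i, hx.coord a i • x i ∈ algPower 𝔽 A 2 :=
  (hx.gen.exists_sub_mem_two a).choose_spec

theorem coord_sum (r : ι → 𝔽) : hx.coord (∑ i, r i • x i) = r :=
  hx.coord_unique (hx.coord_spec _) (by simp)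

theorem ker_coord : LinearMap.ker hx.coord = algPower 𝔽 A 2 := by
  ext a
  rw [LinearMap.mem_ker]
  constructor
  · intro h
    simpa [h] using hx.coord_spec a
  · intro h
    exact hx.coord_unique (hx.coord_spec a) (by simpa using h)

theorem range_coord : LinearMap.range hx.coord = ⊤ :=
  LinearMap.range_eq_top.2 fun r => ⟨_, hx.coord_sum r⟩

include hx in
theorem finrank_eq [Module.Finite 𝔽 A] :
    Module.finrank 𝔽 A = Fintype.card ι + Module.finrank 𝔽 (algPower 𝔽 A 2) := by
  rw [← LinearMap.finrank_range_add_finrank_ker hx.coord, range_coord, ker_coord, finrank_top,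
    Module.finrank_fintype_fun_eq_card]

end IsMinGen

end MinimalGenerators

/-! ### The upper annihilator series and the dimension of ideals outside the last power -/

section UpperSeries

variable {𝔽 : Type u} [Field 𝔽] {A : Type u} [NonUnitalNonAssocRing A] [Module 𝔽 A]
  [IsScalarTower 𝔽 A A] [SMulCommClass 𝔽 A A]

open Module

/-- The upper annihilator series of an algebra. -/
def annSeries (𝔽 : Type u) [Field 𝔽] (A : Type u) [NonUnitalNonAssocRing A] [Module 𝔽 A]
    [IsScalarTower 𝔽 A A] [SMulCommClass 𝔽 A A] : ℕ → Submodule 𝔽 A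
  | 0 => ⊥
  | k + 1 => annStep (annSeries 𝔽 A k)

theorem annSeries_one : annSeries 𝔽 A 1 = algAnnihilator 𝔽 A := by
  ext y
  change (∀ a : A, a * y ∈ (⊥ : Submodule 𝔽 A) ∧ y * a ∈ (⊥ : Submodule 𝔽 A)) ↔
    ∀ a : A, a * y = 0 ∧ y * a = 0
  simp only [Submodule.mem_bot]

theorem annStep_mono {Z Z' : Submodule 𝔽 A} (h : Z ≤ Z') : annStep Z ≤ annStep Z' :=
  fun _ hy a => ⟨h (hy a).1, h (hy a).2⟩

theorem annSeries_le_succ (k : ℕ) : annSeries 𝔽 A k ≤ annSeries 𝔽 A (k + 1) := by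
  induction k with
  | zero => exact bot_le
  | succ k ih => exact annStep_mono ih

theorem annSeries_mono : Monotone (annSeries 𝔽 A) := monotone_nat_of_le_succ annSeries_le_succ

theorem algPower_le_annSeries {c : ℕ} (hc : algPower 𝔽 A (c + 1) = ⊥) (k j : ℕ)
    (h : c + 1 ≤ j + k) (hj : 1 ≤ j) : algPower 𝔽 A j ≤ annSeries 𝔽 A k := by
  induction k generalizing j with
  | zero =>
    refine (algPower_le (by omega) h).trans ?_
    rw [hc]; exact bot_le
  | succ k ih =>
    intro y hy a
    have := ih (j + 1) (by omega) (by omega)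
    exact ⟨this (algPower_mul_left a hy), this (algPower_mul_right a hy)⟩

theorem annSeries_eq_top {c : ℕ} (hc : algPower 𝔽 A (c + 1) = ⊥) : annSeries 𝔽 A c = ⊤ := by
  rw [eq_top_iff, ← algPower_one]
  exact algPower_le_annSeries hc c 1 (by omega) le_rfl

/-- The span of the products of elements of `E` with the elements of the family `x`. -/
def prodSpan {ι : Type*} (x : ι → A) (E : Submodule 𝔽 A) : Submodule 𝔽 A :=
  Submodule.span 𝔽 {z | ∃ y ∈ E, ∃ t, y * x t = z ∨ x t * y = z}

omit [IsScalarTower 𝔽 A A] [SMulCommClass 𝔽 A A] in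
theorem prodSpan_le {ι : Type*} {x : ι → A} {E N : Submodule 𝔽 A}
    (h : ∀ y ∈ E, ∀ t, y * x t ∈ N ∧ x t * y ∈ N) : prodSpan x E ≤ N := by
  refine Submodule.span_le.2 ?_
  rintro _ ⟨y, hy, t, rfl | rfl⟩
  exacts [(h y hy t).1, (h y hy t).2]

omit [IsScalarTower 𝔽 A A] [SMulCommClass 𝔽 A A] in
theorem mul_mem_prodSpan {ι : Type*} {x : ι → A} {E : Submodule 𝔽 A} {y : A} (hy : y ∈ E)
    (t : ι) : y * x t ∈ prodSpan x E ∧ x t * y ∈ prodSpan x E :=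
  ⟨Submodule.subset_span ⟨y, hy, t, Or.inl rfl⟩, Submodule.subset_span ⟨y, hy, t, Or.inr rfl⟩⟩

namespace IsFreeBasis

variable {n : ℕ} {x : Fin n → A} (hx : IsFreeBasis 𝔽 x)

include hx

theorem fullyInvariant_annSeries {c : ℕ} (hc : algPower 𝔽 A (c + 1) = ⊥) (hn : c < n) (k : ℕ) :
    FullyInvariant (annSeries 𝔽 A k) := by
  induction k with
  | zero =>
    intro φ z hz
    rw [(Submodule.mem_bot 𝔽).1 hz, map_zero]
    exact zero_mem _
  | succ k ih => exact hx.fullyInvariant_annStep hc (by simpa using hn) ih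

variable [Module.Finite 𝔽 A]

/-- Intersect J with the upper annihilator series. By the growth estimate each jump is at most 2c/(n
- c) ≤ 1 times the preceding one, so the dimension of J outside the annihilator is at most c times
the jump at level 2. That jump is in turn at most 2c/(n - c) times the dimension of the products of
J ∩ Ann₂ with the generators. Centrality identifies the annihilator with `A ^ c`. -/
theorem mul_finrank_ideal_le {c : ℕ} (hc0 : 1 ≤ c) (hc : algPower 𝔽 A (c + 1) = ⊥)
    (hcent : algAnnihilator 𝔽 A = algPower 𝔽 A c) (hn : 3 * c ≤ n) (J : Submodule 𝔽 A)
    (hJ : ∀ y ∈ J, ∀ t, y * x t ∈ J ∧ x t * y ∈ J) :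
    (n - c) * (finrank 𝔽 J - finrank 𝔽 ↥(J ⊓ algPower 𝔽 A c)) ≤
      2 * c ^ 2 * finrank 𝔽 (prodSpan x (J ⊓ annSeries 𝔽 A 2)) := by
  have hcn : c < n := by omega
  set f : ℕ → ℕ := fun k => finrank 𝔽 ↥(J ⊓ annSeries 𝔽 A k) with hf
  have hmono : Monotone f := fun i j h =>
    Submodule.finrank_mono (inf_le_inf_left _ (annSeries_mono h))
  have hinf : ∀ k, J ⊓ annSeries 𝔽 A (k + 1) ⊓ annSeries 𝔽 A k = J ⊓ annSeries 𝔽 A k :=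
    fun k => by rw [inf_assoc, inf_eq_right.2 (annSeries_le_succ k)]
  have h1 : ∀ k, (n - c) * (f (k + 2) - f (k + 1)) ≤ 2 * c * (f (k + 1) - f k) := by
    intro k
    have := hx.mul_finrank_le hc hcn (hx.fullyInvariant_annSeries hc hcn k)
      (E := J ⊓ annSeries 𝔽 A (k + 2)) (E' := J ⊓ annSeries 𝔽 A (k + 1))
      (fun y hy t => ⟨⟨(hJ y hy.1 t).1, (hy.2 (x t)).2⟩, (hJ y hy.1 t).2, (hy.2 (x t)).1⟩)
    rw [hinf] at this
    change _ * (_ - finrank 𝔽 ↥(J ⊓ annSeries 𝔽 A (k + 1 + 1) ⊓ annSeries 𝔽 A (k + 1))) ≤ _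
      at this
    rw [hinf] at this
    exact this
  have h2 : (n - c) * (f 2 - f 1) ≤ 2 * c * finrank 𝔽 (prodSpan x (J ⊓ annSeries 𝔽 A 2)) := by
    have := hx.mul_finrank_le hc hcn (hx.fullyInvariant_annSeries hc hcn 0)
      (E := J ⊓ annSeries 𝔽 A 2) (E' := prodSpan x (J ⊓ annSeries 𝔽 A 2))
      (fun y hy t => mul_mem_prodSpan hy t)
    change _ * (_ - finrank 𝔽 ↥(J ⊓ annSeries 𝔽 A (1 + 1) ⊓ annSeries 𝔽 A 1)) ≤ _ at this
    rw [hinf] at this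
    exact this.trans (Nat.mul_le_mul_left _ (Nat.sub_le _ _))
  have h3 : ∀ k, f (k + 2) - f (k + 1) ≤ f 2 - f 1 := by
    intro k
    induction k with
    | zero => exact le_rfl
    | succ k ih =>
      refine le_trans ?_ ih
      -- Since 2c ≤ n - c, the growth estimate forbids a jump larger than its predecessor.
      have := h1 (k + 1)
      by_contra hlt
      push Not at hlt
      have h4 : (n - c) * (f (k + 1 + 1) - f (k + 1)) <
          (n - c) * (f (k + 1 + 2) - f (k + 1 + 1)) := Nat.mul_lt_mul_of_pos_left hlt (by omega)
      have h5 : 2 * c * (f (k + 1 + 1) - f (k + 1)) ≤ (n - c) * (f (k + 1 + 1) - f (k + 1)) :=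
        Nat.mul_le_mul_right _ (by omega)
      omega
  have h4 : ∀ k, f (k + 1) - f 1 ≤ k * (f 2 - f 1) := by
    intro k
    induction k with
    | zero => simp
    | succ k ih =>
      have := h3 k
      have e1 := hmono (show 1 ≤ k + 1 by omega)
      have e2 := hmono (show k + 1 ≤ k + 2 by omega)
      rw [Nat.succ_mul]
      change f (k + 2) - f 1 ≤ _
      omega
  have h5 : f c = finrank 𝔽 J := by
    rw [hf]; simp only; rw [annSeries_eq_top hc, inf_top_eq]
  have h6 : f 1 = finrank 𝔽 ↥(J ⊓ algPower 𝔽 A c) := by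
    rw [hf]; simp only; rw [annSeries_one, hcent]
  rw [← h5, ← h6]
  have h7 := h4 (c - 1)
  rw [Nat.sub_add_cancel hc0] at h7
  calc (n - c) * (f c - f 1) ≤ (n - c) * (c * (f 2 - f 1)) :=
        Nat.mul_le_mul_left _ (h7.trans (Nat.mul_le_mul_right _ (Nat.sub_le _ _)))
    _ = c * ((n - c) * (f 2 - f 1)) := by ring
    _ ≤ c * (2 * c * finrank 𝔽 (prodSpan x (J ⊓ annSeries 𝔽 A 2))) := Nat.mul_le_mul_left _ h2
    _ = _ := by ring

omit hx [Module.Finite 𝔽 A] in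
theorem prodSpan_annSeries_two_le {c : ℕ} (hcent : algAnnihilator 𝔽 A = algPower 𝔽 A c)
    (J : Submodule 𝔽 A) : prodSpan x (J ⊓ annSeries 𝔽 A 2) ≤ algPower 𝔽 A c := by
  rw [← hcent, ← annSeries_one]
  exact prodSpan_le fun y hy t => ⟨(hy.2 (x t)).2, (hy.2 (x t)).1⟩

/-- The preceding estimate for J = A: for large n almost the whole dimension of A is in `A ^ c`. -/
theorem mul_finrank_sub_le {c : ℕ} (hc0 : 1 ≤ c) (hc : algPower 𝔽 A (c + 1) = ⊥)
    (hcent : algAnnihilator 𝔽 A = algPower 𝔽 A c) (hn : 3 * c ≤ n) :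
    (n - c) * (finrank 𝔽 A - finrank 𝔽 (algPower 𝔽 A c)) ≤
      2 * c ^ 2 * finrank 𝔽 (algPower 𝔽 A c) := by
  have h := hx.mul_finrank_ideal_le hc0 hc hcent hn ⊤ (fun _ _ _ => ⟨trivial, trivial⟩)
  rw [top_inf_eq, finrank_top] at h
  exact h.trans (Nat.mul_le_mul_left _
    (Submodule.finrank_mono (prodSpan_annSeries_two_le hcent ⊤)))

theorem le_finrank_sub {c : ℕ} (hc2 : 2 ≤ c) (hc : algPower 𝔽 A (c + 1) = ⊥)
    (hne : algPower 𝔽 A c ≠ ⊥) : n ≤ finrank 𝔽 A - finrank 𝔽 (algPower 𝔽 A c) := by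
  have h1 := (hx.isMinGen hc hne).finrank_eq
  rw [Fintype.card_fin] at h1
  have h2 : finrank 𝔽 (algPower 𝔽 A c) ≤ finrank 𝔽 (algPower 𝔽 A 2) :=
    Submodule.finrank_mono (algPower_le (by norm_num) hc2)
  omega

end IsFreeBasis

end UpperSeries

/-! ### Extension of linear data, and multilinear monomials -/

theorem LinearIndependent.exists_linearMap {K V W ι : Type*} [Field K] [AddCommGroup V]
    [Module K V] [AddCommGroup W] [Module K W] {v : ι → V} (hv : LinearIndependent K v)
    (y : ι → W) : ∃ f : V →ₗ[K] W, ∀ i, f (v i) = y i := by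
  obtain ⟨f, hf⟩ := LinearMap.exists_extend ((Module.Basis.span hv).constr K y)
  refine ⟨f, fun i => ?_⟩
  have h := (Module.Basis.span hv).constr_basis K y i
  rw [← hf] at h
  simpa [Module.Basis.span_apply] using h

theorem exists_linearIndependent_extend_pair {K V : Type*} [Field K] [AddCommGroup V] [Module K V]
    [Module.Finite K V] {a b : V} (h : LinearIndependent K ![a, b]) (c : ℕ)
    (hc : c + 2 ≤ Module.finrank K V) :
    ∃ w : ℕ → V, w 0 = a ∧ w 1 = b ∧ LinearIndependent K (fun i : Fin (c + 2) => w i) := by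
  induction c with
  | zero =>
    refine ⟨fun i => if i = 0 then a else b, rfl, rfl, ?_⟩
    convert h using 1
    ext i
    fin_cases i <;> rfl
  | succ c ih =>
    obtain ⟨w, h0, h1, hw⟩ := ih (by omega)
    obtain ⟨z, hz⟩ := exists_linearIndependent_snoc_of_lt_finrank hw (by omega)
    refine ⟨fun i => if i = c + 2 then z else w i, by simp [h0], by simp [h1], ?_⟩
    have he : (fun i : Fin (c + 1 + 2) => if (i : ℕ) = c + 2 then z else w i) =
        Fin.snoc (fun i : Fin (c + 2) => w i) z := by
      funext i
      refine Fin.lastCases ?_ (fun j => ?_) i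
      · simp
      · have : (j : ℕ) ≠ c + 2 := by omega
        simp [this]
    rw [he]
    exact hz

/-- A nonassociative monomial is linear if no letter occurs in it twice. -/
def FreeMagma.IsLinear {ι : Type*} [DecidableEq ι] : FreeMagma ι → Prop
  | FreeMagma.of _ => True
  | FreeMagma.mul u v => u.IsLinear ∧ v.IsLinear ∧ Disjoint u.support v.support

section Multilinear

variable {𝔽 : Type u} [Field 𝔽] {A : Type u} [NonUnitalNonAssocRing A] [Module 𝔽 A]

/-- Every value of a monomial of degree `k` is a value of a linear monomial of degree `k`. -/
theorem FreeMagma.exists_linear (m : FreeMagma A) (o : ℕ) : ∃ (m' : FreeMagma ℕ) (y : ℕ → A),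
    m'.IsLinear ∧ m'.support = Finset.Ico o (o + m.length) ∧
      FreeMagma.lift y m' = FreeMagma.lift id m := by
  induction m using FreeMagma.recOnMul generalizing o with
  | ih1 a =>
    refine ⟨FreeMagma.of o, fun _ => a, trivial, ?_, rfl⟩
    ext i
    simp [support_of, FreeMagma.length]
  | ih2 u v hu hv =>
    obtain ⟨u', y, hu1, hu2, hu3⟩ := hu o
    obtain ⟨v', z, hv1, hv2, hv3⟩ := hv (o + u.length)
    refine ⟨u' * v', fun i => if i < o + u.length then y i else z i, ⟨hu1, hv1, ?_⟩, ?_, ?_⟩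
    · rw [hu2, hv2]
      exact Finset.Ico_disjoint_Ico_consecutive _ _ _
    · rw [support_mul, hu2, hv2, length_mul, ← add_assoc]
      exact Finset.Ico_union_Ico_eq_Ico (by omega) (by omega)
    · rw [map_mul, map_mul, ← hu3, ← hv3]
      congr 1
      · refine lift_congr _ fun i hi => if_pos ?_
        rw [hu2, Finset.mem_Ico] at hi
        exact hi.2
      · refine lift_congr _ fun i hi => if_neg ?_
        rw [hv2, Finset.mem_Ico] at hi
        omega

theorem FreeMagma.exists_slot [IsScalarTower 𝔽 A A] [SMulCommClass 𝔽 A A] {ι : Type*}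
    [DecidableEq ι] {m : FreeMagma ι} (hm : m.IsLinear) {i : ι} (hi : i ∈ m.support)
    (y : ι → A) : ∃ L : A →ₗ[𝔽] A, ∀ a, FreeMagma.lift (Function.update y i a) m = L a := by
  induction m using FreeMagma.recOnMul with
  | ih1 j =>
    rw [support_of, Finset.mem_singleton] at hi
    subst hi
    exact ⟨LinearMap.id, fun a => by simp⟩
  | ih2 u v hu hv =>
    obtain ⟨h1, h2, h3⟩ := hm
    rw [support_mul, Finset.mem_union] at hi
    have hconst : ∀ w : FreeMagma ι, i ∉ w.support → ∀ a,
        FreeMagma.lift (Function.update y i a) w = FreeMagma.lift y w := fun w hw a =>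
      lift_congr w fun j hj => Function.update_of_ne (by rintro rfl; exact hw hj) _ _
    rcases hi with hi | hi
    · obtain ⟨L, hL⟩ := hu h1 hi
      refine ⟨LinearMap.mulRight 𝔽 (FreeMagma.lift y v) ∘ₗ L, fun a => ?_⟩
      rw [map_mul, hL, hconst v (Finset.disjoint_left.1 h3 hi)]
      rfl
    · obtain ⟨L, hL⟩ := hv h2 hi
      refine ⟨LinearMap.mulLeft 𝔽 (FreeMagma.lift y u) ∘ₗ L, fun a => ?_⟩
      rw [map_mul, hL, hconst u (Finset.disjoint_right.1 h3 hi)]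
      rfl

end Multilinear

/-! ### Linear substitutions of a free basis -/

section LinearSubstitutions

variable {𝔽 : Type u} [Field 𝔽] {A : Type u} [NonUnitalNonAssocRing A] [Module 𝔽 A]
  {n : ℕ}

open Module

/-- The linear combination of the family `x` with given coefficients. -/
def linComb (x : Fin n → A) : (Fin n → 𝔽) →ₗ[𝔽] A where
  toFun r := ∑ i, r i • x i
  map_add' r s := by simp [add_smul, Finset.sum_add_distrib]
  map_smul' t r := by simp [mul_smul, Finset.smul_sum]

theorem linComb_apply (x : Fin n → A) (r : Fin n → 𝔽) : linComb x r = ∑ i, r i • x i := rfl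

theorem linComb_single (x : Fin n → A) (i : Fin n) :
    linComb x (Pi.single i (1 : 𝔽)) = x i := by
  rw [linComb_apply, Finset.sum_eq_single i
    (fun j _ hj => by rw [Pi.single_eq_of_ne hj, zero_smul])
    (fun h => absurd (Finset.mem_univ i) h), Pi.single_eq_same, one_smul]

namespace IsFreeBasis

variable {x : Fin n → A} (hx : IsFreeBasis 𝔽 x)

include hx in
theorem exists_endo_linComb (ψ : (Fin n → 𝔽) →ₗ[𝔽] A) :
    ∃ φ : A →ₙₐ[𝔽] A, ∀ r, φ (linComb x r) = ψ r := by
  refine ⟨hx.endo fun i => ψ (Pi.single i 1), fun r => ?_⟩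
  rw [linComb_apply, map_sum]
  simp only [map_smul, endo_apply]
  simp only [← map_smul, ← map_sum]
  congr 1
  ext j
  simp [Finset.sum_apply, Pi.single_apply]

/-- The endomorphism that a linear substitution of the basis extends to. -/
noncomputable def linEndo (g : (Fin n → 𝔽) →ₗ[𝔽] (Fin n → 𝔽)) : A →ₙₐ[𝔽] A :=
  (hx.exists_endo_linComb (linComb x ∘ₗ g)).choose

theorem linEndo_linComb (g : (Fin n → 𝔽) →ₗ[𝔽] (Fin n → 𝔽)) (r : Fin n → 𝔽) :
    hx.linEndo g (linComb x r) = linComb x (g r) :=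
  (hx.exists_endo_linComb (linComb x ∘ₗ g)).choose_spec r

theorem linEndo_comp (g h : (Fin n → 𝔽) →ₗ[𝔽] (Fin n → 𝔽)) (a : A) :
    hx.linEndo g (hx.linEndo h a) = hx.linEndo (g ∘ₗ h) a := by
  have : (hx.linEndo g).comp (hx.linEndo h) = hx.linEndo (g ∘ₗ h) := hx.gen.hom_ext fun i => by
    rw [← linComb_single (𝔽 := 𝔽) x i, linEndo_linComb]
    change hx.linEndo g (hx.linEndo h _) = _
    rw [linEndo_linComb, linEndo_linComb]
    rfl
  exact congrArg (fun φ : A →ₙₐ[𝔽] A => φ a) this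

theorem linEndo_id (a : A) : hx.linEndo LinearMap.id a = a := by
  have : hx.linEndo LinearMap.id = NonUnitalAlgHom.id 𝔽 A := hx.gen.hom_ext fun i => by
    rw [← linComb_single (𝔽 := 𝔽) x i, linEndo_linComb]
    rfl
  exact congrArg (fun φ : A →ₙₐ[𝔽] A => φ a) this

variable [IsScalarTower 𝔽 A A] [SMulCommClass 𝔽 A A]

omit [IsScalarTower 𝔽 A A] [SMulCommClass 𝔽 A A] in
theorem linEndo_injective {g : (Fin n → 𝔽) →ₗ[𝔽] (Fin n → 𝔽)} (hg : Function.Injective g) :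
    Function.Injective (hx.linEndo g) := by
  let e := LinearEquiv.ofInjectiveEndo g hg
  have h : ∀ a, hx.linEndo (e.symm : (Fin n → 𝔽) →ₗ[𝔽] (Fin n → 𝔽)) (hx.linEndo g a) = a := by
    intro a
    rw [linEndo_comp]
    have : (e.symm : (Fin n → 𝔽) →ₗ[𝔽] (Fin n → 𝔽)) ∘ₗ g = LinearMap.id := by
      refine LinearMap.ext fun r => ?_
      exact e.symm_apply_apply _
    rw [this, linEndo_id]
  exact Function.LeftInverse.injective h

/-- A linear substitution which is not a homothety is far from being a homothety on `A ^ c`. -/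
theorem le_finrank_map_linEndo [Module.Finite 𝔽 A] {c : ℕ} (hc2 : 2 ≤ c) (hcn : c ≤ n)
    (hne : algPower 𝔽 A c ≠ ⊥) {g : (Fin n → 𝔽) →ₗ[𝔽] (Fin n → 𝔽)} (hg : Function.Injective g)
    (hgs : ∀ l : 𝔽, g ≠ l • LinearMap.id) (l : 𝔽) :
    n - c ≤ finrank 𝔽 ((algPower 𝔽 A c).map
      ((hx.linEndo g : A →ₗ[𝔽] A) - l • LinearMap.id)) := by
  obtain ⟨c, rfl⟩ : ∃ c', c = c' + 2 := ⟨c - 2, by omega⟩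
  obtain ⟨m, Y, hm, hsupp, hmY⟩ : ∃ (m : FreeMagma ℕ) (Y : ℕ → A), m.IsLinear ∧
      m.support = Finset.Ico 0 (c + 2) ∧ FreeMagma.lift Y m ≠ 0 := by
    by_contra hcon
    push Not at hcon
    refine hne (eq_bot_iff.2 (Submodule.span_le.2 ?_))
    rintro _ ⟨m, hm, rfl⟩
    obtain ⟨m', y, h1, h2, h3⟩ := m.exists_linear 0
    rw [zero_add, hm] at h2
    rw [← h3]
    exact hcon m' y h1 h2
  have hmlen : ∀ v : ℕ → A, FreeMagma.lift v m ∈ algPower 𝔽 A (c + 2) := fun v => by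
    refine algPower_le (by omega) ?_ (lift_mem_algPower' v m)
    have := m.card_support_le
    rwa [hsupp, Nat.card_Ico, Nat.sub_zero] at this
  -- A map that sends every vector to a multiple of itself is a homothety. The vectors `v₀` and `g
  -- v₀` become the letters 0 and 1 of the family `w`.
  obtain ⟨v₀, hv₀⟩ : ∃ v, LinearIndependent 𝔽 ![v, g v] := by
    by_contra hcon
    push Not at hcon
    obtain ⟨a, ha⟩ := g.exists_eq_smul_id_of_forall_notLinearIndependent hcon
    exact hgs a ha
  obtain ⟨w, hw0, hw1, hw⟩ := exists_linearIndependent_extend_pair hv₀ c (by simpa using hcn)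
  -- the slot `1` of the monomial is varied
  obtain ⟨L, hL⟩ := FreeMagma.exists_slot (𝔽 := 𝔽) hm (i := 1) (by rw [hsupp]; simp)
    (fun i => linComb x (w i))
  let Φ : (Fin n → 𝔽) →ₗ[𝔽] A :=
    ((hx.linEndo g : A →ₗ[𝔽] A) - l • LinearMap.id) ∘ₗ L ∘ₗ linComb x
  have hrange : LinearMap.range Φ ≤ (algPower 𝔽 A (c + 2)).map
      ((hx.linEndo g : A →ₗ[𝔽] A) - l • LinearMap.id) := by
    rintro _ ⟨r, rfl⟩
    exact ⟨L (linComb x r), by rw [← hL]; exact hmlen _, rfl⟩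
  -- For `y` outside the span, some endomorphism `φ` sends `y` to `Y 1`, `w 1` to 0 and the other `w
  -- i` to `Y i`. The monomial with `y` in slot 1 goes to the nonzero value at `Y`, while its image
  -- under `g` goes to 0, because its letter 0 has become `g (w 0) = w 1`. Hence the two are not
  -- proportional with a factor l ≠ 0; for l = 0 injectivity of the substitution is used instead.
  have hker : LinearMap.ker Φ ≤ Submodule.span 𝔽 (Set.range fun i : Fin (c + 2) => w i) := by
    intro y hy
    by_contra hyw
    have hli : LinearIndependent 𝔽 (Fin.cons y (fun i : Fin (c + 2) => w i) :
        Fin (c + 3) → (Fin n → 𝔽)) := linearIndependent_finCons.2 ⟨hw, hyw⟩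
    obtain ⟨ψ, hψ⟩ := hli.exists_linearMap
      (Fin.cons (Y 1) (fun i : Fin (c + 2) => if i = 1 then 0 else Y i) : Fin (c + 3) → A)
    obtain ⟨φ, hφ⟩ := hx.exists_endo_linComb ψ
    have hφy : φ (linComb x y) = Y 1 := by
      rw [hφ]; simpa using hψ 0
    have hφw : ∀ i < c + 2, φ (linComb x (w i)) = if i = 1 then 0 else Y i := by
      intro i hi
      have h := hψ (Fin.succ ⟨i, hi⟩)
      simp only [Fin.cons_succ] at h
      rw [hφ, h]
      congr 1
      simp [Fin.ext_iff]
    set a := L (linComb x y) with ha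
    have ha' : a = FreeMagma.lift (Function.update (fun i => linComb x (w i)) 1 (linComb x y)) m :=
      (hL _).symm
    have hφa : φ a = FreeMagma.lift Y m := by
      rw [ha', hom_freeMagma_lift]
      refine FreeMagma.lift_congr m fun i hi => ?_
      rw [hsupp, Finset.mem_Ico] at hi
      by_cases h1 : i = 1
      · subst h1; rw [Function.update_self, hφy]
      · rw [Function.update_of_ne h1, hφw i hi.2, if_neg h1]
    have hΦ : hx.linEndo g a = l • a := by
      have : Φ y = 0 := hy
      exact sub_eq_zero.1 this
    by_cases hl : l = 0
    · rw [hl, zero_smul] at hΦ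
      have h0 : a = 0 := hx.linEndo_injective hg (by rw [hΦ, map_zero])
      rw [h0, map_zero] at hφa
      exact hmY hφa.symm
    · have h0 : φ (hx.linEndo g a) = 0 := by
        rw [ha', hom_freeMagma_lift, hom_freeMagma_lift]
        refine lift_eq_zero_of_mem_support m (i := 0) (by rw [hsupp]; simp) ?_
        rw [Function.update_of_ne (by norm_num), hw0, linEndo_linComb, ← hw1,
          hφw 1 (by omega), if_pos rfl]
      rw [hΦ, map_smul, hφa, smul_eq_zero] at h0
      exact h0.elim hl hmY
  have h1 := LinearMap.finrank_range_add_finrank_ker Φ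
  have h2 := Submodule.finrank_mono hrange
  have h3 := Submodule.finrank_mono hker
  rw [finrank_span_eq_card hw, Fintype.card_fin] at h3
  rw [Module.finrank_fintype_fun_eq_card, Fintype.card_fin] at h1
  omega

end IsFreeBasis

end LinearSubstitutions

/-! ### Counting devices -/

section DoubleCounting

/-- In the applications `α` consists of subspaces and `β` of tuples from which the subspace can be
reconstructed. -/
theorem Nat.card_mul_le_of_relation {α β : Type*} [Finite α] [Finite β] (r : α → β → Prop)
    {b : ℕ} (h : ∀ x, b ≤ Nat.card {y // r x y}) (hu : ∀ x x' y, r x y → r x' y → x = x') :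
    Nat.card α * b ≤ Nat.card β := by
  have := Fintype.ofFinite α
  calc Nat.card α * b = ∑ _x : α, b := by simp [Nat.card_eq_fintype_card]
    _ ≤ ∑ x : α, Nat.card {y // r x y} := Finset.sum_le_sum fun x _ => h x
    _ = Nat.card (Σ x : α, {y // r x y}) := Nat.card_sigma.symm
    _ ≤ Nat.card β := by
      refine Nat.card_le_card_of_injective (fun p : (Σ x : α, {y // r x y}) => p.2.1) ?_
      rintro ⟨x, y, hy⟩ ⟨x', y', hy'⟩ h
      obtain rfl : y = y' := h
      obtain rfl := hu _ _ _ hy hy'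
      rfl

theorem Nat.card_mul_le_of_cover {α γ : Type*} [Finite α] [Finite γ] (R : α → γ → Prop) {a b : ℕ}
    (hR : ∀ x, ∃ g, R x g) (h : ∀ g, Nat.card {x // R x g} * a ≤ b) :
    Nat.card α * a ≤ Nat.card γ * b := by
  have := Fintype.ofFinite γ
  choose f hf using hR
  have h1 : Nat.card α ≤ ∑ g : γ, Nat.card {x // R x g} := by
    rw [← Nat.card_sigma]
    refine Nat.card_le_card_of_injective (fun x => ⟨f x, x, hf x⟩) ?_
    intro x x' h
    simp only [Sigma.mk.injEq] at h
    obtain ⟨h1, h2⟩ := h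
    have h2 := (Subtype.heq_iff_coe_eq fun y => by rw [h1]).1 h2
    exact h2
  calc Nat.card α * a ≤ (∑ g : γ, Nat.card {x // R x g}) * a := Nat.mul_le_mul_right _ h1
    _ = ∑ g : γ, Nat.card {x // R x g} * a := Finset.sum_mul ..
    _ ≤ ∑ _g : γ, b := Finset.sum_le_sum fun g _ => h g
    _ = _ := by simp [Nat.card_eq_fintype_card]

theorem Nat.mul_le_card_prod {X Y : Type*} [Finite X] [Finite Y] {g : X → Prop}
    {r : X → Y → Prop} {a b : ℕ} (hg : a ≤ Nat.card {x // g x})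
    (hr : ∀ x, g x → b ≤ Nat.card {y // r x y}) :
    a * b ≤ Nat.card {p : X × Y // r p.1 p.2} := by
  have := Fintype.ofFinite {x // g x}
  calc a * b ≤ Nat.card {x // g x} * b := Nat.mul_le_mul_right _ hg
    _ = ∑ _x : {x // g x}, b := by simp [Nat.card_eq_fintype_card]
    _ ≤ ∑ x : {x // g x}, Nat.card {y // r x y} := Finset.sum_le_sum fun x _ => hr x x.2
    _ = Nat.card (Σ x : {x // g x}, {y // r x y}) := Nat.card_sigma.symm
    _ ≤ _ := by
      refine Nat.card_le_card_of_injective (fun p => ⟨(p.1.1, p.2.1), p.2.2⟩) ?_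
      rintro ⟨⟨x, hx⟩, y, hy⟩ ⟨⟨x', hx'⟩, y', hy'⟩ h
      simp only [Subtype.mk.injEq, Prod.mk.injEq] at h
      obtain ⟨rfl, rfl⟩ := h
      rfl

theorem Nat.pow_le_card_tuples {X : Type*} [Finite X] {good : ∀ m : ℕ, (Fin m → X) → Prop}
    {b : ℕ} (M : ℕ) (h0 : good 0 Fin.elim0)
    (hs : ∀ m < M, ∀ w, good m w →
      b ≤ Nat.card {a : X // good (m + 1) (Fin.cons a w : Fin (m + 1) → X)}) :
    b ^ M ≤ Nat.card {w : Fin M → X // good M w} := by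
  induction M with
  | zero =>
    have : Nonempty {w : Fin 0 → X // good 0 w} := ⟨⟨_, h0⟩⟩
    rw [pow_zero]
    exact Nat.card_pos
  | succ M ih =>
    have h := Nat.mul_le_card_prod (r := fun w a => good (M + 1) (Fin.cons a w : Fin (M + 1) → X))
      (ih fun m hm => hs m (by omega)) (fun w hw => hs M (by omega) w hw)
    rw [pow_succ]
    refine h.trans (Nat.card_le_card_of_injective
      (fun p => (⟨(Fin.cons p.1.2 p.1.1 : Fin (M + 1) → X), p.2⟩ :
        {w : Fin (M + 1) → X // good (M + 1) w})) ?_)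
    rintro ⟨⟨w, a⟩, h⟩ ⟨⟨w', a'⟩, h'⟩ he
    simp only [Subtype.mk.injEq] at he
    obtain ⟨rfl, rfl⟩ := Fin.cons_injective2 he
    rfl

end DoubleCounting

/-! ### Numbers of subspaces and of generating tuples -/

section CountSubspaces

open Module

variable {K V : Type*} [Field K] [Finite K] [AddCommGroup V] [Module K V] [Finite V]

omit [Finite V] in
theorem two_le_natCard_field : 2 ≤ Nat.card K := Finite.one_lt_card

omit [Finite K] in
theorem natCard_submodule (W : Submodule K V) : Nat.card W = Nat.card K ^ finrank K W :=
  Module.natCard_eq_pow_finrank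

/-- At least half of a space lies outside a union of few small subspaces. -/
theorem pow_le_card_sdiff {W : Submodule K V} {B : Set V} {k : ℕ} (hk : finrank K W = k + 1)
    (hB : B.ncard ≤ Nat.card K ^ k) : Nat.card K ^ k ≤ Nat.card {a : V // a ∈ W ∧ a ∉ B} := by
  have h1 : Nat.card {a : V // a ∈ W ∧ a ∉ B} = ((W : Set V) \ B).ncard := rfl
  have h2 := Set.le_ncard_sdiff B (W : Set V)
  have h3 : (W : Set V).ncard = Nat.card K ^ (k + 1) := by
    rw [← hk, ← natCard_submodule]; rfl
  have h4 : 2 * Nat.card K ^ k ≤ Nat.card K ^ (k + 1) := by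
    rw [pow_succ, mul_comm]
    exact Nat.mul_le_mul_left _ two_le_natCard_field
  rw [h1]
  omega

/-- Vectors are chosen one at a time outside the current proper subspace of W, which excludes at
most q^(dim W - 1) of the elements of W. The loss of a factor of order q^m against the exact count
is harmless later. -/
theorem pow_le_card_tuples_span {U W : Submodule K V} (hUW : U ≤ W) {m : ℕ}
    (hm : finrank K W = finrank K U + m) :
    (Nat.card K ^ (finrank K W - 1)) ^ m ≤
      Nat.card {w : Fin m → V // U ⊔ Submodule.span K (Set.range w) = W} := by
  have h := Nat.pow_le_card_tuples (X := V) (b := Nat.card K ^ (finrank K W - 1))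
    (good := fun j w => U ⊔ Submodule.span K (Set.range w) ≤ W ∧
      finrank K ↥(U ⊔ Submodule.span K (Set.range w)) = finrank K U + j) m (by
      constructor
      · simpa using hUW
      · rw [Set.range_eq_empty, Submodule.span_empty, sup_bot_eq, add_zero]) ?_
  · refine h.trans (Nat.card_le_card_of_injective (fun w => ⟨w.1, ?_⟩) ?_)
    · exact Submodule.eq_of_le_of_finrank_eq w.2.1 (by rw [w.2.2, hm])
    · intro w w' h
      exact Subtype.ext (Subtype.mk.inj h)
  · rintro j hj w ⟨hw1, hw2⟩
    have hpos : finrank K W = finrank K W - 1 + 1 := by omega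
    refine (pow_le_card_sdiff (B := (U ⊔ Submodule.span K (Set.range w) : Submodule K V))
      hpos ?_).trans (Nat.card_le_card_of_injective (fun a => ⟨a.1, ?_⟩) ?_)
    · change Nat.card ↥(U ⊔ Submodule.span K (Set.range w)) ≤ _
      rw [natCard_submodule, hw2]
      exact Nat.pow_le_pow_right Nat.card_pos (by omega)
    · have e : U ⊔ Submodule.span K (Set.range (Fin.cons a.1 w : Fin (j + 1) → V)) =
          U ⊔ Submodule.span K (Set.range w) ⊔ Submodule.span K {a.1} := by
        rw [Fin.range_cons, Submodule.span_insert, sup_comm (Submodule.span K {a.1}), sup_assoc]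
      rw [e]
      refine ⟨sup_le hw1 ((Submodule.span_singleton_le_iff_mem _ _).2 a.2.1), ?_⟩
      rw [Submodule.finrank_sup_span_singleton a.2.2, hw2, add_assoc]
    · intro w w' h
      exact Subtype.ext (Subtype.mk.inj h)

omit [Finite K] in
theorem natCard_tuples (m : ℕ) : Nat.card (Fin m → V) = Nat.card K ^ (finrank K V * m) := by
  rw [Nat.card_fun, Module.natCard_eq_pow_finrank (K := K) (V := V), Nat.card_fin, pow_mul]

theorem card_submodule_finrank_eq (k : ℕ) (P : Submodule K V → Prop) :
    Nat.card {W : Submodule K V // P W ∧ finrank K W = k} * Nat.card K ^ ((k - 1) * k) ≤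
      Nat.card K ^ (finrank K V * k) := by
  rw [← natCard_tuples]
  refine Nat.card_mul_le_of_relation
    (fun W (w : Fin k → V) => ⊥ ⊔ Submodule.span K (Set.range w) = W.1) ?_ ?_
  · rintro ⟨W, -, hW⟩
    have := pow_le_card_tuples_span (U := ⊥) (W := W) bot_le (m := k) (by simp [hW])
    rwa [hW, ← pow_mul] at this
  · rintro ⟨W, _⟩ ⟨W', _⟩ w h h'
    exact Subtype.ext (h.symm.trans h')

omit [Finite K] in
/-- There are at least `q ^ (k l)` subspaces in a space of dimension `k + l`. -/
theorem pow_le_card_submodule (k l : ℕ) (h : finrank K V = k + l) :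
    Nat.card K ^ (k * l) ≤ Nat.card (Submodule K V) := by
  have e : V ≃ₗ[K] (Fin k → K) × (Fin l → K) := LinearEquiv.ofFinrankEq _ _ (by simp [h])
  have h1 : Nat.card ((Fin k → K) →ₗ[K] (Fin l → K)) = Nat.card K ^ (k * l) := by
    rw [Module.natCard_eq_pow_finrank (K := K), Module.finrank_linearMap]
    simp
  rw [← h1]
  -- Distinct linear maps K^k → K^l have distinct graphs.
  refine Nat.card_le_card_of_injective
    (fun f => (LinearMap.graph f).comap (e : V →ₗ[K] (Fin k → K) × (Fin l → K))) ?_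
  intro f g hfg
  simp only at hfg
  have h2 := Submodule.comap_injective_of_surjective 
    (f := (e : V →ₗ[K] (Fin k → K) × (Fin l → K))) e.surjective hfg
  ext1 i
  refine LinearMap.ext fun r => ?_
  have h3 : (LinearMap.single K (fun _ => K) i r, f (LinearMap.single K (fun _ => K) i r)) ∈
      LinearMap.graph g := by
    rw [← h2]; exact (LinearMap.mem_graph_iff _ _).2 rfl
  exact (LinearMap.mem_graph_iff _ _).1 h3

omit [Finite K] in
theorem exists_submodule_le_finrank_eq (W : Submodule K V) {m : ℕ} (hm : m ≤ finrank K W) :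
    ∃ U ≤ W, finrank K U = m := by
  let b := Module.finBasis K W
  let v : Fin m → V := fun i => (b (Fin.castLE hm i) : V)
  have hv : LinearIndependent K v :=
    ((b.linearIndependent.comp _ (Fin.castLE_injective hm)).map' W.subtype
      W.ker_subtype)
  refine ⟨Submodule.span K (Set.range v), Submodule.span_le.2 ?_, by
    rw [finrank_span_eq_card hv, Fintype.card_fin]⟩
  rintro _ ⟨i, rfl⟩
  exact (b (Fin.castLE hm i)).2

end CountSubspaces

/-! ### Invariant subspaces of an operator far from all homotheties -/

section InvariantSubspaces

open Module

variable {K V : Type*} [Field K] [Finite K] [AddCommGroup V] [Module K V] [Finite V]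
  (T : V →ₗ[K] V)

/-- The span of a family and of its image under `T`. -/
def orbitSpan {m : ℕ} (w : Fin m → V) : Submodule K V :=
  Submodule.span K (Set.range w) ⊔ (Submodule.span K (Set.range w)).map T

omit [Finite K] [Finite V] in
theorem orbitSpan_cons {m : ℕ} (a : V) (w : Fin m → V) :
    orbitSpan T (Fin.cons a w : Fin (m + 1) → V) =
      orbitSpan T w ⊔ Submodule.span K {a} ⊔ Submodule.span K {T a} := by
  rw [orbitSpan, orbitSpan, Fin.range_cons, Submodule.span_insert, Submodule.map_sup,
    Submodule.map_span T {a}, Set.image_singleton, sup_comm (Submodule.span K {a}),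
    sup_comm (Submodule.span K {T a}), sup_sup_sup_comm, sup_assoc (_ ⊔ _)]

omit [Finite K] in
theorem finrank_inf_comap_le (f : V →ₗ[K] V) (W P : Submodule K V) :
    finrank K ↥(W ⊓ P.comap f) ≤ finrank K P + finrank K ↥(W ⊓ LinearMap.ker f) := by
  rw [← finrank_map_add_finrank_inf_ker f (W ⊓ P.comap f)]
  refine add_le_add (Submodule.finrank_mono ?_) (Submodule.finrank_mono ?_)
  · rintro _ ⟨y, hy, rfl⟩
    exact hy.2
  · exact inf_le_inf_right _ inf_le_left

/-- In an invariant subspace on which `T` is far from all homotheties, many families of length `s`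
are linearly independent together with their images. -/
theorem pow_le_card_orbit_tuples {W : Submodule K V} (hW : ∀ w ∈ W, T w ∈ W) {s : ℕ}
    (hs : 2 * s + 1 ≤ finrank K W)
    (hfar : ∀ l : K, finrank K ↥(W ⊓ LinearMap.ker (T - l • LinearMap.id)) + (2 * s + 1) ≤
      finrank K W) :
    (Nat.card K ^ (finrank K W - 1)) ^ s ≤
      Nat.card {w : Fin s → V // orbitSpan T w ≤ W ∧ finrank K (orbitSpan T w) = 2 * s} := by
  have := Fintype.ofFinite K
  refine Nat.pow_le_card_tuples (X := V)
    (good := fun j w => orbitSpan T w ≤ W ∧ finrank K (orbitSpan T w) = 2 * j) s ?_ ?_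
  · have : orbitSpan T (Fin.elim0 : Fin 0 → V) = ⊥ := by
      rw [orbitSpan, Set.range_eq_empty, Submodule.span_empty, Submodule.map_bot, sup_bot_eq]
    rw [this]
    exact ⟨bot_le, by simp⟩
  · rintro j hj w ⟨hw1, hw2⟩
    set P := orbitSpan T w with hP
    set k := finrank K W with hk
    have hq := two_le_natCard_field (K := K)
    -- These are the vectors `a` of W for which `a` and `T a` fail to be independent modulo P,
    -- together with P: either `a ∈ P` or `T a - l a ∈ P` for some `l`. Each of the q + 1 pieces has
    -- dimension at most k - 3.
    let B : Set V := (P : Set V) ∪ ⋃ l : K, ((W ⊓ P.comap (T - l • LinearMap.id) :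
      Submodule K V) : Set V)
    have hB : B.ncard ≤ Nat.card K ^ (k - 1) := by
      have h1 : (P : Set V).ncard ≤ Nat.card K ^ (k - 3) := by
        change Nat.card P ≤ _
        rw [natCard_submodule, hw2]
        exact Nat.pow_le_pow_right Nat.card_pos (by omega)
      have h2 : ∀ l : K, ((W ⊓ P.comap (T - l • LinearMap.id) : Submodule K V) : Set V).ncard ≤
          Nat.card K ^ (k - 3) := by
        intro l
        change Nat.card ↥(W ⊓ P.comap (T - l • LinearMap.id)) ≤ _
        rw [natCard_submodule]
        refine Nat.pow_le_pow_right Nat.card_pos ?_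
        have h3 := finrank_inf_comap_le (T - l • LinearMap.id) W P
        have h4 := hfar l
        omega
      have h3 : (⋃ l : K, ((W ⊓ P.comap (T - l • LinearMap.id) : Submodule K V) : Set V)).ncard ≤
          Nat.card K * Nat.card K ^ (k - 3) := by
        have : (⋃ l : K, ((W ⊓ P.comap (T - l • LinearMap.id) : Submodule K V) : Set V)) =
            ⋃ l ∈ (Finset.univ : Finset K),
              ((W ⊓ P.comap (T - l • LinearMap.id) : Submodule K V) : Set V) := by simp
        rw [this]
        refine (Finset.set_ncard_biUnion_le _ _).trans ?_
        refine (Finset.sum_le_sum fun l _ => h2 l).trans ?_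
        simp [Nat.card_eq_fintype_card]
      have h4 : B.ncard ≤ Nat.card K ^ (k - 3) + Nat.card K * Nat.card K ^ (k - 3) :=
        (Set.ncard_union_le _ _).trans (add_le_add h1 h3)
      have h5 : Nat.card K ^ (k - 1) = Nat.card K * (Nat.card K * Nat.card K ^ (k - 3)) := by
        rw [← pow_succ', ← pow_succ']
        congr 1
        omega
      have h6 : 2 * (Nat.card K * Nat.card K ^ (k - 3)) ≤ Nat.card K ^ (k - 1) := by
        rw [h5]
        exact Nat.mul_le_mul_right _ hq
      have h7 : Nat.card K ^ (k - 3) ≤ Nat.card K * Nat.card K ^ (k - 3) :=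
        Nat.le_mul_of_pos_left _ (by omega)
      omega
    have hpos : k = k - 1 + 1 := by omega
    refine (pow_le_card_sdiff (B := B) (hk.symm.trans hpos) hB).trans
      (Nat.card_le_card_of_injective (fun a => ⟨a.1, ?_⟩) ?_)
    · obtain ⟨a, haW, haB⟩ := a
      simp only
      rw [orbitSpan_cons]
      have ha1 : a ∉ P := fun h => haB (Or.inl h)
      have ha2 : T a ∉ P ⊔ Submodule.span K {a} := by
        intro h
        obtain ⟨p, hp, z, hz, hpz⟩ := Submodule.mem_sup.1 h
        obtain ⟨l, rfl⟩ := Submodule.mem_span_singleton.1 hz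
        refine haB (Or.inr (Set.mem_iUnion.2 ⟨l, haW, ?_⟩))
        change T a - l • a ∈ P
        rw [← hpz, add_sub_cancel_right]
        exact hp
      refine ⟨sup_le (sup_le hw1 ?_) ?_, ?_⟩
      · exact (Submodule.span_singleton_le_iff_mem _ _).2 haW
      · exact (Submodule.span_singleton_le_iff_mem _ _).2 (hW a haW)
      · rw [Submodule.finrank_sup_span_singleton ha2, Submodule.finrank_sup_span_singleton ha1, hw2]
        ring
    · intro w w' h
      exact Subtype.ext (Subtype.mk.inj h)

/-- An invariant W of dimension k is recovered from only k - s vectors: s of them together with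
their images span dimension 2s, and k - 2s more complete the span. -/
theorem card_invariant_far_le (k s : ℕ) :
    Nat.card {W : Submodule K V // ((∀ w ∈ W, T w ∈ W) ∧ 2 * s + 1 ≤ k ∧
      ∀ l : K, finrank K ↥(W ⊓ LinearMap.ker (T - l • LinearMap.id)) + (2 * s + 1) ≤ k) ∧
      finrank K W = k} * Nat.card K ^ ((k - 1) * (k - s)) ≤
    Nat.card K ^ (finrank K V * (k - s)) := by
  by_cases hks : 2 * s + 1 ≤ k
  swap
  · have : IsEmpty {W : Submodule K V // ((∀ w ∈ W, T w ∈ W) ∧ 2 * s + 1 ≤ k ∧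
        ∀ l : K, finrank K ↥(W ⊓ LinearMap.ker (T - l • LinearMap.id)) + (2 * s + 1) ≤ k) ∧
        finrank K W = k} := ⟨fun W => hks W.2.1.2.1⟩
    rw [Nat.card_of_isEmpty, zero_mul]
    exact Nat.zero_le _
  have e : Nat.card ((Fin s → V) × (Fin (k - 2 * s) → V)) =
      Nat.card K ^ (finrank K V * (k - s)) := by
    rw [Nat.card_prod, natCard_tuples (K := K), natCard_tuples (K := K), ← pow_add, ← mul_add]
    congr 2
    omega
  rw [← e]
  refine Nat.card_mul_le_of_relation (fun W p =>
    (orbitSpan T p.1 ⊔ Submodule.span K (Set.range p.2) = W.1)) ?_ ?_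
  · rintro ⟨W, ⟨hW, -, hfar⟩, hk⟩
    have h1 := pow_le_card_orbit_tuples T hW (s := s) (by omega) (by rwa [hk])
    have h2 := Nat.mul_le_card_prod (Y := Fin (k - 2 * s) → V)
      (r := fun w u => orbitSpan T w ⊔ Submodule.span K (Set.range u) = W) h1
      (b := (Nat.card K ^ (k - 1)) ^ (k - 2 * s)) (fun w hw => by
        have := pow_le_card_tuples_span (K := K) hw.1 (m := k - 2 * s) (by omega)
        rwa [hk] at this)
    rw [hk, ← pow_add, ← pow_mul] at h2
    convert h2 using 3
    omega
  · rintro ⟨W, _⟩ ⟨W', _⟩ w h h'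
    exact Subtype.ext (h.symm.trans h')

/-- The number of `k`-dimensional subspaces that meet a fixed subspace in dimension at least
`k - ρ`. -/
theorem card_near_le (k ρ : ℕ) (hρ : ρ ≤ k) (P : Submodule K V → Prop) (Z : Submodule K V) :
    Nat.card {W : Submodule K V // (P W ∧ k - ρ ≤ finrank K ↥(W ⊓ Z)) ∧
      finrank K W = k} * Nat.card K ^ ((k - ρ - 1) * (k - ρ) + (k - 1) * ρ) ≤
    Nat.card K ^ (finrank K Z * (k - ρ) + finrank K V * ρ) := by
  have e : Nat.card ((Fin (k - ρ) → Z) × (Fin ρ → V)) =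
      Nat.card K ^ (finrank K Z * (k - ρ) + finrank K V * ρ) := by
    rw [Nat.card_prod, natCard_tuples (K := K), natCard_tuples (K := K), ← pow_add]
  rw [← e]
  -- W is recorded by k - ρ vectors that span a part of W ∩ Z and ρ vectors that complete it, so
  -- most vectors are drawn from the smaller space Z.
  refine Nat.card_mul_le_of_relation (fun W p =>
    (Submodule.span K (Set.range p.1)).map Z.subtype ⊔ Submodule.span K (Set.range p.2) = W.1)
    ?_ ?_
  · rintro ⟨W, ⟨-, hW⟩, hk⟩
    have hZ : finrank K (W.comap Z.subtype) = finrank K ↥(W ⊓ Z) := by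
      rw [(Submodule.equivMapOfInjective Z.subtype Z.injective_subtype
        (W.comap Z.subtype)).finrank_eq, Submodule.map_comap_subtype, inf_comm]
    obtain ⟨U, hU, hUk⟩ := exists_submodule_le_finrank_eq (W.comap Z.subtype) (m := k - ρ)
      (by omega)
    have hUm : finrank K (U.map Z.subtype) = k - ρ := by
      rw [← hUk]
      exact (Submodule.equivMapOfInjective Z.subtype Z.injective_subtype U).finrank_eq.symm
    have h1 := pow_le_card_tuples_span (K := K) (U := ⊥) (W := U) bot_le (m := k - ρ)
      (by simp [hUk])
    have h2 := Nat.mul_le_card_prod (Y := Fin ρ → V)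
      (r := fun w u => (Submodule.span K (Set.range w)).map Z.subtype ⊔
        Submodule.span K (Set.range u) = W) h1
      (b := (Nat.card K ^ (k - 1)) ^ ρ) (fun w hw => by
        rw [bot_sup_eq] at hw
        have := pow_le_card_tuples_span (K := K) (U := U.map Z.subtype) (W := W)
          (Submodule.map_le_iff_le_comap.2 hU) (m := ρ) (by omega)
        rwa [hk, ← hw] at this)
    rwa [hUk, ← pow_mul, ← pow_mul, ← pow_add] at h2
  · rintro ⟨W, _⟩ ⟨W', _⟩ w h h'
    exact Subtype.ext (h.symm.trans h')

omit [Finite K] [Finite V] in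
theorem mul_pow_le_of_mul_pow_le {q N p t Z D : ℕ} (hq : 0 < q) (h : N * q ^ p ≤ q ^ t)
    (hle : t + Z ≤ D + p) : N * q ^ Z ≤ q ^ D := by
  refine Nat.le_of_mul_le_mul_right (c := q ^ p) ?_ (pow_pos hq p)
  calc N * q ^ Z * q ^ p = N * q ^ p * q ^ Z := by ring
    _ ≤ q ^ t * q ^ Z := Nat.mul_le_mul_right _ h
    _ = q ^ (t + Z) := (pow_add _ _ _).symm
    _ ≤ q ^ (D + p) := Nat.pow_le_pow_right hq hle
    _ = q ^ D * q ^ p := pow_add _ _ _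

omit [Finite K] [Finite V] in
theorem sq_le_four_mul_half (d : ℕ) : d ^ 2 ≤ 4 * (d / 2 * (d - d / 2)) + 1 := by
  obtain ⟨k, rfl | rfl⟩ := Nat.even_or_odd' d
  · have : 2 * k / 2 = k := by omega
    rw [this, show 2 * k - k = k by omega]
    nlinarith
  · have : (2 * k + 1) / 2 = k := by omega
    rw [this, show 2 * k + 1 - k = k + 1 by omega]
    nlinarith

omit [Finite K] [Finite V] in
-- The exponent to bound is (d - k + 1)(k - s) with s = 4z + 2. The factors add up to d - 4z - 1
-- instead of about d, so by the arithmetic-geometric mean their product is below d²/4 by about (2z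
-- + 1/2)d, which absorbs Z ≤ zd.
theorem exponent_far_le {d k z Z D : ℕ} (hD : d ^ 2 ≤ 4 * D + 1) (hd : 100 * (z + 1) ≤ d)
    (hk : 8 * z + 5 ≤ k) (hkd : k ≤ d) (hZ : Z ≤ z * d) :
    d * (k - (4 * z + 2)) + Z ≤ D + (k - 1) * (k - (4 * z + 2)) := by
  obtain ⟨v, rfl⟩ : ∃ v, k = 4 * z + 2 + v := ⟨k - (4 * z + 2), by omega⟩
  obtain ⟨l, rfl⟩ : ∃ l, d = 4 * z + 2 + v + l := ⟨d - (4 * z + 2 + v), by omega⟩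
  rw [Nat.add_sub_cancel_left, show 4 * z + 2 + v - 1 = 4 * z + 1 + v by omega]
  zify at *
  nlinarith [sq_nonneg ((l : ℤ) + 1 - v)]

omit [Finite K] [Finite V] in
-- Since κ ≤ d - 100(z + 1), the main term κv - v² with v = k - (8z + 5) is at most (d - 100(z +
-- 1))²/4, a saving of at least 25(z + 1)d. This pays for the 8z + 5 unrestricted vectors and for Z.
theorem exponent_near_le {d k z Z D κ r : ℕ} (hD : d ^ 2 ≤ 4 * D + 1) (hr : 100 * (z + 1) ≤ r)
    (hk : 8 * z + 5 ≤ k) (hkd : k ≤ d) (hZ : Z ≤ z * d) (hκ : κ + r ≤ d) :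
    κ * (k - (8 * z + 5)) + d * (8 * z + 5) + Z ≤
      D + ((k - (8 * z + 5) - 1) * (k - (8 * z + 5)) + (k - 1) * (8 * z + 5)) := by
  obtain ⟨v, rfl⟩ : ∃ v, k = 8 * z + 5 + v := ⟨k - (8 * z + 5), by omega⟩
  rw [Nat.add_sub_cancel_left, show 8 * z + 5 + v - 1 = 8 * z + 4 + v by omega]
  have h1 : κ * v + v * (100 * (z + 1)) ≤ d * v := by nlinarith
  have h2 : (v - 1) * v + v = v * v := by
    rcases v with _ | v
    · rfl
    · rw [Nat.add_sub_cancel]; ring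
  have h3 : 100 * (z + 1) ≤ d := by omega
  generalize (v - 1) * v = y at *
  zify at *
  have h4 : 4 * ((v : ℤ) * (d - 100 * (z + 1) - v)) ≤ (d - 100 * (z + 1)) ^ 2 := by
    nlinarith [sq_nonneg ((d : ℤ) - 100 * (z + 1) - 2 * v)]
  have h5 : ((d : ℤ) - 100 * (z + 1)) ^ 2 ≤ d ^ 2 - 100 * (z + 1) * d := by
    nlinarith
  nlinarith

omit [Finite K] [Finite V] in
theorem exponent_small_le {d k z Z D : ℕ} (hD : d ^ 2 ≤ 4 * D + 1) (hd : 100 * (z + 1) ≤ d)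
    (hk : k < 8 * z + 5) (hZ : Z ≤ z * d) : d * k + Z ≤ D + (k - 1) * k := by
  refine le_trans ?_ (Nat.le_add_right _ _)
  nlinarith

/-- A bound for the number of invariant subspaces of an operator that is far from all
homotheties. -/
theorem card_invariant_le {z Z r : ℕ} (hT : ∀ l : K, r ≤
      finrank K (LinearMap.range (T - l • LinearMap.id))) (hr : 100 * (z + 1) ≤ r)
    (hZ : Z + finrank K V + 2 ≤ z * finrank K V) :
    Nat.card {W : Submodule K V // ∀ w ∈ W, T w ∈ W} * Nat.card K ^ Z ≤
      Nat.card K ^ (finrank K V / 2 * (finrank K V - finrank K V / 2)) := by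
  set d := finrank K V with hd
  set D := d / 2 * (d - d / 2) with hD
  have hq := two_le_natCard_field (K := K)
  have hD' : d ^ 2 ≤ 4 * D + 1 := sq_le_four_mul_half d
  have hκ : ∀ l : K, finrank K (LinearMap.ker (T - l • LinearMap.id)) + r ≤ d := fun l => by
    have h1 := LinearMap.finrank_range_add_finrank_ker (T - l • LinearMap.id)
    have h2 := hT l
    omega
  have hrd : 100 * (z + 1) ≤ d := by have := hκ 0; omega
  -- Subspaces are sorted by dimension and by a homothety close to T on them: `some l` means that W
  -- meets the eigenspace of `l` in codimension at most 8z + 5, `none` that W is small or far from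
  -- every homothety. There are (d + 1)(q + 1) ≤ q^(d + 2) sorts, whence the summand d + 2 in `hZ`.
  let R : {W : Submodule K V // ∀ w ∈ W, T w ∈ W} → Fin (d + 1) × Option K → Prop := fun W g =>
    match g with
    | (k, none) => (8 * z + 5 ≤ (k : ℕ) → ∀ l : K, finrank K ↥(W.1 ⊓
        LinearMap.ker (T - l • LinearMap.id)) + (8 * z + 5) ≤ k) ∧ finrank K W.1 = k
    | (k, some l) => (8 * z + 5 ≤ (k : ℕ) ∧ (k : ℕ) - (8 * z + 5) ≤ finrank K ↥(W.1 ⊓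
        LinearMap.ker (T - l • LinearMap.id))) ∧ finrank K W.1 = k
  have key := Nat.card_mul_le_of_cover R (a := Nat.card K ^ (Z + d + 2))
    (b := Nat.card K ^ D) ?_ ?_
  · have h1 : Nat.card (Fin (d + 1) × Option K) ≤ Nat.card K ^ (d + 2) := by
      rw [Nat.card_prod, Nat.card_fin, Finite.card_option, pow_add]
      refine Nat.mul_le_mul ?_ (by nlinarith)
      exact (Nat.succ_le_of_lt Nat.lt_two_pow_self).trans (Nat.pow_le_pow_left hq d)
    have h2 := key.trans (Nat.mul_le_mul_right _ h1)
    refine Nat.le_of_mul_le_mul_right (c := Nat.card K ^ (d + 2)) ?_ (pow_pos (by omega) _)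
    calc _ = Nat.card {W : Submodule K V // ∀ w ∈ W, T w ∈ W} *
          Nat.card K ^ (Z + d + 2) := by ring
      _ ≤ _ := h2
      _ = _ := mul_comm _ _
  · rintro ⟨W, hW⟩
    have hWd : finrank K W < d + 1 := Nat.lt_succ_of_le (Submodule.finrank_le W)
    by_cases h : 8 * z + 5 ≤ finrank K W ∧ ∃ l : K, finrank K W - (8 * z + 5) ≤
        finrank K ↥(W ⊓ LinearMap.ker (T - l • LinearMap.id))
    · obtain ⟨h1, l, h2⟩ := h
      exact ⟨(⟨_, hWd⟩, some l), ⟨h1, h2⟩, rfl⟩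
    · refine ⟨(⟨_, hWd⟩, none), fun h1 l => ?_, rfl⟩
      have h2 : ¬ (finrank K W - (8 * z + 5) ≤ finrank K ↥(W ⊓
          LinearMap.ker (T - l • LinearMap.id))) := fun h3 => h ⟨h1, l, h3⟩
      simp only at h1 ⊢
      omega
  · rintro ⟨⟨k, hk⟩, _ | l⟩
    · by_cases hρ : 8 * z + 5 ≤ k
      -- The value s = 4z + 2 makes 2s + 1 equal to the threshold 8z + 5.
      · refine mul_pow_le_of_mul_pow_le (by omega) (le_trans (Nat.mul_le_mul_right _ ?_)
          (card_invariant_far_le T k (4 * z + 2)))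
          (exponent_far_le hD' hrd hρ (by omega) hZ)
        refine Nat.card_le_card_of_injective (fun W => ⟨W.1.1, ⟨W.1.2, by omega, fun l => ?_⟩,
          W.2.2⟩) ?_
        · have := W.2.1 hρ l
          simp only at this
          omega
        · intro W W' h
          exact Subtype.ext (Subtype.ext (Subtype.mk.inj h))
      · refine mul_pow_le_of_mul_pow_le (by omega) (le_trans (Nat.mul_le_mul_right _ ?_)
          (card_submodule_finrank_eq (K := K) (V := V) k (fun _ => True)))
          (exponent_small_le hD' hrd (by omega) hZ)
        refine Nat.card_le_card_of_injective (fun W => ⟨W.1.1, trivial, W.2.2⟩) ?_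
        intro W W' h
        exact Subtype.ext (Subtype.ext (Subtype.mk.inj h))
    · by_cases hρ : 8 * z + 5 ≤ k
      · refine mul_pow_le_of_mul_pow_le (by omega) (le_trans (Nat.mul_le_mul_right _ ?_)
          (card_near_le k (8 * z + 5) hρ (fun _ => True)
            (LinearMap.ker (T - l • LinearMap.id))))
          (exponent_near_le hD' hr hρ (by omega) hZ (hκ l))
        refine Nat.card_le_card_of_injective (fun W => ⟨W.1.1, ⟨trivial, W.2.1.2⟩, W.2.2⟩) ?_
        intro W W' h
        exact Subtype.ext (Subtype.ext (Subtype.mk.inj h))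
      · have : IsEmpty {W // R W (⟨k, hk⟩, some l)} := ⟨fun W => hρ W.2.1.1⟩
        rw [Nat.card_of_isEmpty, zero_mul]
        exact Nat.zero_le _

end InvariantSubspaces

/-! ### Subspaces forced to contain a large part of C -/

section CountIdeals

open Module

variable {K V : Type*} [Field K] [Finite K] [AddCommGroup V] [Module K V] [Finite V]
  (C : Submodule K V) (U : Submodule K V → Submodule K V)

omit [Finite K] [Finite V] in
theorem finrank_comap_subtype (W : Submodule K V) :
    finrank K (W.comap C.subtype) = finrank K ↥(W ⊓ C) := by
  rw [(Submodule.equivMapOfInjective C.subtype C.injective_subtype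
    (W.comap C.subtype)).finrank_eq, Submodule.map_comap_subtype, inf_comm]

/-- J is recovered from e vectors that generate it over J ∩ C and k - u vectors of C. The e vectors
together with C already give J + C, hence the u-dimensional subspace `U (J ⊔ C)` of J ∩ C costs
nothing. -/
theorem card_submodule_of_core_le (k e u : ℕ) :
    Nat.card {J : Submodule K V // U (J ⊔ C) ≤ J ⊓ C ∧ finrank K ↥(J ⊓ C) = k ∧
      finrank K ↥(J ⊔ C) = finrank K C + e ∧ finrank K (U (J ⊔ C)) = u} *
      Nat.card K ^ ((k + e - 1) * e + (k - 1) * (k - u)) ≤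
    Nat.card K ^ (finrank K V * e + finrank K C * (k - u)) := by
  have e' : Nat.card ((Fin e → V) × (Fin (k - u) → C)) =
      Nat.card K ^ (finrank K V * e + finrank K C * (k - u)) := by
    rw [Nat.card_prod, natCard_tuples (K := K), natCard_tuples (K := K), ← pow_add]
  rw [← e']
  refine Nat.card_mul_le_of_relation (fun J p =>
    (U (Submodule.span K (Set.range p.1) ⊔ C) ⊔
      (Submodule.span K (Set.range p.2)).map C.subtype) ⊔ Submodule.span K (Set.range p.1) = J.1)
    ?_ ?_
  · rintro ⟨J, hU, hk, he, hu⟩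
    have hdim := Submodule.finrank_sup_add_finrank_inf_eq J C
    have hJ : finrank K J = k + e := by omega
    have h1 := pow_le_card_tuples_span (K := K) (U := J ⊓ C) (W := J) inf_le_left (m := e)
      (by omega)
    have h2 := Nat.mul_le_card_prod (Y := Fin (k - u) → C)
      (r := fun y w => (U (Submodule.span K (Set.range y) ⊔ C) ⊔
        (Submodule.span K (Set.range w)).map C.subtype) ⊔ Submodule.span K (Set.range y) = J) h1
      (b := (Nat.card K ^ (k - 1)) ^ (k - u)) (fun y hy => by
        have hyC : Submodule.span K (Set.range y) ⊔ C = J ⊔ C := by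
          conv_rhs => rw [← hy]
          rw [sup_right_comm, sup_comm (Submodule.span K (Set.range y))]
          congr 1
          exact (sup_eq_right.2 inf_le_right).symm
        have hle : (U (J ⊔ C)).comap C.subtype ≤ J.comap C.subtype :=
          Submodule.comap_mono (hU.trans inf_le_left)
        have hUC : U (J ⊔ C) ⊓ C = U (J ⊔ C) := inf_eq_left.2 (hU.trans inf_le_right)
        have f1 : finrank K ((U (J ⊔ C)).comap C.subtype) = u := by
          rw [finrank_comap_subtype, hUC, hu]
        have f2 : finrank K (J.comap C.subtype) = k := by rw [finrank_comap_subtype, hk]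
        have hku : u ≤ k := by rw [← f1, ← f2]; exact Submodule.finrank_mono hle
        have h3 := pow_le_card_tuples_span (K := K) hle (m := k - u) (by omega)
        rw [f2] at h3
        refine h3.trans (Nat.card_le_card_of_injective (fun w => ⟨w.1, ?_⟩) ?_)
        · have h4 := congrArg (Submodule.map C.subtype) w.2
          rw [Submodule.map_sup, Submodule.map_comap_subtype, Submodule.map_comap_subtype,
            inf_comm C, hUC, inf_comm C] at h4
          rw [hyC, h4, hy]
        · intro w w' h
          exact Subtype.ext (Subtype.mk.inj h))
    rwa [hJ, ← pow_mul, ← pow_mul, ← pow_add] at h2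
  · rintro ⟨W, _⟩ ⟨W', _⟩ w h h'
    exact Subtype.ext (h.symm.trans h')

omit [Finite K] [Finite V] in
-- With l = d - k and v = k - u the exponent is (l + 1)(v + e) + ae - e² + Z. The two factors add up
-- to at most d - g with g = (4z + 7)e - 1, so the product saves at least gd/4 ≥ (e + z + 1/4)d.
-- This covers ae ≤ de and Z ≤ zd, and explains the constant 4z + 8.
theorem exponent_core_le {d a k e u z Z D : ℕ} (hD : d ^ 2 ≤ 4 * D + 1) (he : 1 ≤ e)
    (hu : (4 * z + 8) * e ≤ u) (huk : u ≤ k) (hkd : k ≤ d) (ha : a ≤ d) (hZ : Z ≤ z * d) :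
    (d + a) * e + d * (k - u) + Z ≤ D + ((k + e - 1) * e + (k - 1) * (k - u)) := by
  obtain ⟨v, rfl⟩ : ∃ v, k = u + v := ⟨k - u, by omega⟩
  obtain ⟨l, rfl⟩ : ∃ l, d = u + v + l := ⟨d - (u + v), by omega⟩
  obtain ⟨e, rfl⟩ : ∃ e', e = e' + 1 := ⟨e - 1, by omega⟩
  obtain ⟨u, rfl⟩ : ∃ u', u = u' + 1 := ⟨u - 1, by
    have : (4 * z + 8) * 1 ≤ (4 * z + 8) * (e + 1) := Nat.mul_le_mul_left _ (by omega)
    omega⟩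
  rw [Nat.add_sub_cancel_left, show u + 1 + v - 1 = u + v by omega,
    show u + 1 + v + (e + 1) - 1 = u + v + e + 1 by omega]
  generalize hd : u + 1 + v + l = d at *
  have hd' : (u : ℤ) + v = d - l - 1 := by push_cast [← hd]; ring
  have h1 : a * (e + 1) ≤ d * (e + 1) := Nat.mul_le_mul_right _ ha
  zify at *
  set g : ℤ := (4 * z + 7) * (e + 1) - 1 with hg
  have hlv : (l : ℤ) + v + (e + 1) + 1 ≤ d - g := by linarith
  have h2 : 4 * (((l : ℤ) + 1) * (v + (e + 1))) ≤ (d - g) ^ 2 := by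
    have h3 : 4 * (((l : ℤ) + 1) * (v + (e + 1))) ≤ ((l : ℤ) + v + (e + 1) + 1) ^ 2 := by
      nlinarith [sq_nonneg ((l : ℤ) + 1 - (v + (e + 1)))]
    have h4 : ((l : ℤ) + v + (e + 1) + 1) ^ 2 ≤ (d - g) ^ 2 :=
      pow_le_pow_left₀ (by positivity) hlv 2
    exact h3.trans h4
  have hg0 : 4 * ((e : ℤ) + 1) + 4 * z + 1 ≤ g := by
    rw [hg]; nlinarith [mul_nonneg (Int.natCast_nonneg z) (Int.natCast_nonneg e)]
  have hgd : g ≤ d := by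
    have : (0 : ℤ) ≤ (l : ℤ) + v + (e + 1) + 1 := by positivity
    linarith
  have h5 : ((d : ℤ) - g) ^ 2 ≤ d ^ 2 - g * d := by nlinarith
  have h6 : (4 * ((e : ℤ) + 1) + 4 * z + 1) * d ≤ g * d :=
    mul_le_mul_of_nonneg_right hg0 (by positivity)
  have h7 : (1 : ℤ) ≤ d := by linarith [Int.natCast_nonneg e, Int.natCast_nonneg z]
  rw [hd']
  have h8 : ((d : ℤ) + a) * (e + 1) + d * v + Z - ((d - l - 1 + e + 1) * (e + 1) +
      (d - l - 1) * v) = (l + 1) * (v + (e + 1)) + a * (e + 1) - (e + 1) ^ 2 + Z := by ring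
  nlinarith

/-- A bound for the number of subspaces that contain a large subspace of `C` determined by their
image modulo `C`. -/
theorem card_submodule_of_large_core_le {z Z : ℕ} (hV : finrank K V ≤ 2 * finrank K C)
    (hZ : Z + 3 * finrank K C ≤ z * finrank K C) :
    Nat.card {J : Submodule K V // ¬ J ≤ C ∧ U (J ⊔ C) ≤ J ⊓ C ∧
      (4 * z + 8) * (finrank K ↥(J ⊔ C) - finrank K C) ≤ finrank K (U (J ⊔ C))} *
      Nat.card K ^ Z ≤ Nat.card K ^ (finrank K C / 2 * (finrank K C - finrank K C / 2)) := by
  set d := finrank K C with hd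
  set D := d / 2 * (d - d / 2) with hD
  have hq := two_le_natCard_field (K := K)
  have hD' : d ^ 2 ≤ 4 * D + 1 := sq_le_four_mul_half d
  let S := {J : Submodule K V // ¬ J ≤ C ∧ U (J ⊔ C) ≤ J ⊓ C ∧
      (4 * z + 8) * (finrank K ↥(J ⊔ C) - finrank K C) ≤ finrank K (U (J ⊔ C))}
  -- Sorting by three dimensions gives (d + 1)³ ≤ q^(3d) sorts, the origin of the summand 3d in
  -- `hZ`.
  let R : S → Fin (d + 1) × Fin (d + 1) × Fin (d + 1) → Prop := fun J g =>
    finrank K ↥(J.1 ⊓ C) = g.1 ∧ finrank K ↥(J.1 ⊔ C) = d + g.2.1 ∧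
      finrank K (U (J.1 ⊔ C)) = g.2.2
  have hsup : ∀ J : Submodule K V, d ≤ finrank K ↥(J ⊔ C) := fun J =>
    Submodule.finrank_mono le_sup_right
  have key := Nat.card_mul_le_of_cover R (a := Nat.card K ^ (Z + 3 * d))
    (b := Nat.card K ^ D) ?_ ?_
  · have h0 : d + 1 ≤ Nat.card K ^ d :=
      (Nat.succ_le_of_lt Nat.lt_two_pow_self).trans (Nat.pow_le_pow_left hq d)
    have h1 : Nat.card (Fin (d + 1) × Fin (d + 1) × Fin (d + 1)) ≤ Nat.card K ^ (3 * d) := by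
      rw [Nat.card_prod, Nat.card_prod, Nat.card_fin, show 3 * d = d + (d + d) by ring,
        pow_add, pow_add]
      exact Nat.mul_le_mul h0 (Nat.mul_le_mul h0 h0)
    have h2 := key.trans (Nat.mul_le_mul_right _ h1)
    refine Nat.le_of_mul_le_mul_right (c := Nat.card K ^ (3 * d)) ?_ (pow_pos (by omega) _)
    calc _ = Nat.card S * Nat.card K ^ (Z + 3 * d) := by rw [pow_add, mul_assoc]
      _ ≤ _ := h2
      _ = _ := mul_comm _ _
  · rintro ⟨J, hJ, hU, hM⟩
    have h1 : finrank K ↥(J ⊓ C) < d + 1 :=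
      Nat.lt_succ_of_le (Submodule.finrank_mono inf_le_right)
    have h2 : finrank K ↥(J ⊔ C) - d < d + 1 := by
      have := Submodule.finrank_le (J ⊔ C)
      omega
    have h3 : finrank K (U (J ⊔ C)) < d + 1 :=
      Nat.lt_succ_of_le (Submodule.finrank_mono (hU.trans inf_le_right))
    exact ⟨(⟨_, h1⟩, ⟨_, h2⟩, ⟨_, h3⟩), rfl, by have := hsup J; simp only; omega, rfl⟩
  · rintro ⟨⟨k, hk⟩, ⟨e, he⟩, ⟨u, hu⟩⟩
    by_cases hne : Nonempty {J // R J (⟨k, hk⟩, ⟨e, he⟩, ⟨u, hu⟩)}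
    swap
    · rw [not_nonempty_iff] at hne
      rw [Nat.card_of_isEmpty, zero_mul]
      exact Nat.zero_le _
    obtain ⟨⟨⟨J, hJ, hU, hM⟩, h1, h2, h3⟩⟩ := hne
    simp only at h1 h2 h3
    have he1 : 1 ≤ e := by
      by_contra hcon
      have : e = 0 := by omega
      rw [this, add_zero, hd] at h2
      have h4 := Submodule.eq_of_le_of_finrank_eq (le_sup_right : C ≤ J ⊔ C) h2.symm
      exact hJ (h4 ▸ le_sup_left)
    have huk : u ≤ k := by rw [← h3, ← h1]; exact Submodule.finrank_mono hU
    rw [h2, h3, ← hd, Nat.add_sub_cancel_left] at hM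
    obtain ⟨a, ha⟩ : ∃ a, finrank K V = d + a :=
      ⟨finrank K V - d, by have := Submodule.finrank_le C; omega⟩
    have h5 := card_submodule_of_core_le C U k e u
    rw [ha, ← hd] at h5
    refine mul_pow_le_of_mul_pow_le (by omega) (le_trans (Nat.mul_le_mul_right _ ?_) h5)
      (exponent_core_le hD' he1 hM huk (by omega) (by omega) hZ)
    refine Nat.card_le_card_of_injective (fun J => ⟨J.1.1, J.1.2.2.1, J.2⟩) ?_
    intro W W' h
    exact Subtype.ext (Subtype.ext (Subtype.mk.inj h))

end CountIdeals

/-! ### Both kinds of bad ideals in a free algebra -/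

section CountIdealsOfAlgebra

open Module

variable {𝔽 : Type u} [Field 𝔽] [Finite 𝔽] {A : Type u} [NonUnitalNonAssocRing A] [Module 𝔽 A]
  [IsScalarTower 𝔽 A A] [SMulCommClass 𝔽 A A] [Finite A]

/-- A bound for the number of ideals that are not contained in `A ^ c`. -/
theorem IsFreeBasis.card_ideal_not_le {n : ℕ} {x : Fin n → A} (hx : IsFreeBasis 𝔽 x) {c : ℕ}
    (hc0 : 1 ≤ c) (hc : algPower 𝔽 A (c + 1) = ⊥)
    (hcent : algAnnihilator 𝔽 A = algPower 𝔽 A c) {z Z : ℕ}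
    (hn : 2 * c ^ 2 * (4 * z + 8) + 3 * c ≤ n)
    (hZ : Z + 3 * finrank 𝔽 (algPower 𝔽 A c) ≤ z * finrank 𝔽 (algPower 𝔽 A c)) :
    Nat.card {J : Submodule 𝔽 A // (∀ y ∈ J, ∀ a : A, a * y ∈ J ∧ y * a ∈ J) ∧
      ¬ J ≤ algPower 𝔽 A c} * Nat.card 𝔽 ^ Z ≤
    Nat.card 𝔽 ^ (finrank 𝔽 (algPower 𝔽 A c) / 2 *
      (finrank 𝔽 (algPower 𝔽 A c) - finrank 𝔽 (algPower 𝔽 A c) / 2)) := by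
  set C := algPower 𝔽 A c with hC
  have hc2 : 0 < 2 * c ^ 2 := by positivity
  have hV : finrank 𝔽 A ≤ 2 * finrank 𝔽 C := by
    have h1 := hx.mul_finrank_sub_le hc0 hc hcent (by omega)
    have h2 : 2 * c ^ 2 * (finrank 𝔽 A - finrank 𝔽 C) ≤
        (n - c) * (finrank 𝔽 A - finrank 𝔽 C) := by
      refine Nat.mul_le_mul_right _ ?_
      have : 2 * c ^ 2 * 1 ≤ 2 * c ^ 2 * (4 * z + 8) := Nat.mul_le_mul_left _ (by omega)
      omega
    have h3 := Nat.le_of_mul_le_mul_left (h2.trans h1) hc2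
    rw [← hC] at h3
    omega
  refine le_trans (Nat.mul_le_mul_right _ ?_) (card_submodule_of_large_core_le C
    (fun E => prodSpan x (E ⊓ annSeries 𝔽 A 2)) hV hZ)
  have hann : ∀ f ∈ C, ∀ a : A, a * f = 0 ∧ f * a = 0 := fun f hf => by
    rw [← hcent] at hf
    exact hf
  refine Nat.card_le_card_of_injective (fun J => ⟨J.1, J.2.2, le_inf ?_
    (IsFreeBasis.prodSpan_annSeries_two_le hcent _), ?_⟩) ?_
  · refine prodSpan_le fun y hy t => ?_
    obtain ⟨j, hj, f, hf, rfl⟩ := Submodule.mem_sup.1 hy.1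
    rw [add_mul, mul_add, (hann f hf _).1, (hann f hf _).2, add_zero, add_zero]
    exact ⟨(J.2.1 j hj (x t)).2, (J.2.1 j hj (x t)).1⟩
  -- The estimate is applied to J + C, which has the same products as J because C is the
  -- annihilator; the hypothesis on n makes n - c at least 2c²(4z + 8).
  · have h1 := hx.mul_finrank_ideal_le hc0 hc hcent (by omega) (J.1 ⊔ C) (fun y hy t => by
      obtain ⟨j, hj, f, hf, rfl⟩ := Submodule.mem_sup.1 hy
      rw [add_mul, mul_add, (hann f hf _).1, (hann f hf _).2, add_zero, add_zero]
      exact ⟨Submodule.mem_sup_left (J.2.1 j hj (x t)).2,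
        Submodule.mem_sup_left (J.2.1 j hj (x t)).1⟩)
    rw [inf_eq_right.2 (le_sup_right : C ≤ J.1 ⊔ C)] at h1
    refine Nat.le_of_mul_le_mul_left (le_trans ?_ h1) hc2
    rw [← mul_assoc]
    exact Nat.mul_le_mul_right _ (by omega)
  · intro W W' h
    exact Subtype.ext (Subtype.mk.inj h)

/-- A bound for the number of subspaces of `A ^ c` that are preserved by a linear substitution
which is not a homothety. -/
theorem IsFreeBasis.card_preserved_le {n : ℕ} {x : Fin n → A} (hx : IsFreeBasis 𝔽 x) {c : ℕ}
    (hc2 : 2 ≤ c) (hne : algPower 𝔽 A c ≠ ⊥) {z Z : ℕ} (hn : 100 * (z + 1) + c ≤ n)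
    (hZ : Z + finrank 𝔽 (algPower 𝔽 A c) + 2 ≤ z * finrank 𝔽 (algPower 𝔽 A c))
    {g : (Fin n → 𝔽) →ₗ[𝔽] (Fin n → 𝔽)} (hg : Function.Injective g)
    (hgs : ∀ l : 𝔽, g ≠ l • LinearMap.id) :
    Nat.card {I : Submodule 𝔽 A // I ≤ algPower 𝔽 A c ∧ ∀ y ∈ I, hx.linEndo g y ∈ I} *
      Nat.card 𝔽 ^ Z ≤
    Nat.card 𝔽 ^ (finrank 𝔽 (algPower 𝔽 A c) / 2 *
      (finrank 𝔽 (algPower 𝔽 A c) - finrank 𝔽 (algPower 𝔽 A c) / 2)) := by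
  set C := algPower 𝔽 A c with hC
  let T : C →ₗ[𝔽] C := (hx.linEndo g : A →ₗ[𝔽] A).restrict
    (fun y hy => map_mem_algPower (hx.linEndo g) hy)
  refine le_trans (Nat.mul_le_mul_right _ ?_) (card_invariant_le T (r := n - c) (z := z)
    (fun l => ?_) (by omega) hZ)
  · refine Nat.card_le_card_of_injective (fun I => ⟨I.1.comap C.subtype, fun w hw => I.2.2 _ hw⟩) ?_
    intro I I' h
    have h1 := congrArg (Submodule.map C.subtype) (Subtype.mk.inj h)
    rw [Submodule.map_comap_subtype, Submodule.map_comap_subtype, inf_eq_right.2 I.2.1,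
      inf_eq_right.2 I'.2.1] at h1
    exact Subtype.ext h1
  · refine (hx.le_finrank_map_linEndo hc2 (by omega) hne hg hgs l).trans (le_of_eq ?_)
    have : C.map ((hx.linEndo g : A →ₗ[𝔽] A) - l • LinearMap.id) =
        (LinearMap.range (T - l • LinearMap.id)).map C.subtype := by
      ext y
      constructor
      · rintro ⟨w, hw, rfl⟩
        exact ⟨_, ⟨⟨w, hw⟩, rfl⟩, rfl⟩
      · rintro ⟨_, ⟨w, rfl⟩, rfl⟩
        exact ⟨w, w.2, rfl⟩
    rw [← hC, this]
    exact (Submodule.equivMapOfInjective C.subtype C.injective_subtype _).finrank_eq.symm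

end CountIdealsOfAlgebra

/-! ### Automorphisms congruent to the identity modulo the square -/

/-- A monomial `m` of degree at least two arises from a shorter monomial by substituting a product
of two letters for a new letter `l`. -/
theorem FreeMagma.exists_contract {ι : Type*} [DecidableEq ι] (m : FreeMagma ι)
    (hm : 2 ≤ m.length) {l : ι} (hl : l ∉ m.support) :
    ∃ (m' : FreeMagma ι) (a b : ι), m'.length + 1 = m.length ∧ a ∈ m.support ∧ b ∈ m.support ∧
      m'.support ⊆ insert l m.support ∧
      ∀ {B : Type u} [NonUnitalNonAssocRing B] (y : ι → B),
        FreeMagma.lift (Function.update y l (y l + y a * y b)) m' =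
          FreeMagma.lift y m' + FreeMagma.lift y m := by
  induction m using FreeMagma.recOnMul with
  | ih1 i => simp [FreeMagma.length] at hm
  | ih2 u v hu hv =>
    rw [support_mul, Finset.mem_union, not_or] at hl
    have hconst : ∀ w : FreeMagma ι, l ∉ w.support → ∀ {B : Type u} [NonUnitalNonAssocRing B]
        (y : ι → B) (z : B), FreeMagma.lift (Function.update y l z) w = FreeMagma.lift y w :=
      fun w hw _ _ y z => lift_congr w fun j hj =>
        Function.update_of_ne (by rintro rfl; exact hw hj) _ _
    by_cases h1 : 2 ≤ u.length
    · obtain ⟨u', a, b, h2, ha, hb, hs, he⟩ := hu h1 hl.1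
      refine ⟨u' * v, a, b, by rw [length_mul, length_mul]; omega, Finset.mem_union_left _ ha,
        Finset.mem_union_left _ hb, ?_, fun y => ?_⟩
      · rw [support_mul, support_mul, ← Finset.insert_union]
        exact Finset.union_subset_union_left hs
      · rw [map_mul, map_mul, map_mul, he, hconst v hl.2, add_mul]
    · by_cases h3 : 2 ≤ v.length
      · obtain ⟨v', a, b, h2, ha, hb, hs, he⟩ := hv h3 hl.2
        refine ⟨u * v', a, b, by rw [length_mul, length_mul]; omega, Finset.mem_union_right _ ha,
          Finset.mem_union_right _ hb, ?_, fun y => ?_⟩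
        · rw [support_mul, support_mul, ← Finset.union_insert]
          exact Finset.union_subset_union_right hs
        · rw [map_mul, map_mul, map_mul, he, hconst u hl.1, mul_add]
      · cases u using FreeMagma.recOnMul with
        | ih2 u₁ u₂ =>
          have := u₁.one_le_length
          have := u₂.one_le_length
          rw [length_mul] at h1
          omega
        | ih1 a =>
          cases v using FreeMagma.recOnMul with
          | ih2 u₁ u₂ =>
            have := u₁.one_le_length
            have := u₂.one_le_length
            rw [length_mul] at h3
            omega
          | ih1 b =>
            refine ⟨FreeMagma.of l, a, b, rfl, ?_, ?_, ?_, fun y => ?_⟩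
            · simp [support_mul, support_of]
            · simp [support_mul, support_of]
            · simp [support_of]
            · simp

open scoped commutatorElement

section Automorphisms

variable {𝔽 : Type u} [Field 𝔽] {A : Type u} [NonUnitalNonAssocRing A] [Module 𝔽 A]

/-- An automorphism as a homomorphism. -/
def algAutHom (e : algAut 𝔽 A) : A →ₙₐ[𝔽] A where
  toFun := e.1
  map_smul' r a := e.1.map_smul r a
  map_zero' := e.1.map_zero
  map_add' := e.1.map_add
  map_mul' := e.2

theorem algAutHom_apply (e : algAut 𝔽 A) (a : A) : algAutHom e a = e.1 a := rfl

theorem algAut_mul_apply (e f : algAut 𝔽 A) (a : A) : (e * f).1 a = e.1 (f.1 a) := rfl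

theorem algAut_apply_inv_self (e : algAut 𝔽 A) (a : A) : e.1 ((e⁻¹).1 a) = a :=
  e.1.apply_symm_apply a

theorem MonomialsSpan.algAut_ext {ι : Type*} {y : ι → A} (hy : MonomialsSpan 𝔽 y)
    {e f : algAut 𝔽 A} (h : ∀ i, e.1 (y i) = f.1 (y i)) : e = f := by
  have h1 : algAutHom e = algAutHom f := hy.hom_ext h
  apply Subtype.ext
  ext a
  exact congrArg (fun φ : A →ₙₐ[𝔽] A => φ a) h1

theorem exists_algAut_of_injective [Finite A] {φ : A →ₙₐ[𝔽] A} (hφ : Function.Injective φ) :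
    ∃ e : algAut 𝔽 A, ∀ a, e.1 a = φ a :=
  ⟨⟨LinearEquiv.ofBijective (φ : A →ₗ[𝔽] A) (Finite.injective_iff_bijective.1 hφ),
    fun a b => map_mul φ a b⟩, fun _ => rfl⟩

variable [IsScalarTower 𝔽 A A] [SMulCommClass 𝔽 A A]

/-- An element of the kernel that lies in A^k also lies in A^(k+1), because φ moves elements of A^k
only by elements of A^(k+1). -/
theorem injective_of_sub_mem {c : ℕ} (hc : algPower 𝔽 A (c + 1) = ⊥) {φ : A →ₙₐ[𝔽] A}
    (h : ∀ a, φ a - a ∈ algPower 𝔽 A 2) : Function.Injective φ := by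
  rw [injective_iff_map_eq_zero]
  intro a ha
  have key : ∀ k, a ∈ algPower 𝔽 A (k + 1) := by
    intro k
    induction k with
    | zero => rw [algPower_one]; trivial
    | succ k ih =>
      have := sub_mem_algPower_add (φ := φ) (ψ := NonUnitalAlgHom.id 𝔽 A) (r := 1) h ih
      change φ a - a ∈ _ at this
      rw [ha, zero_sub] at this
      exact neg_mem_iff.1 this
  have := key c
  rwa [hc] at this

/-- The automorphisms that are congruent to the identity modulo `A ^ (k + 2)`. -/
def congAut (𝔽 : Type u) [Field 𝔽] (A : Type u) [NonUnitalNonAssocRing A] [Module 𝔽 A] (k : ℕ) :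
    Subgroup (algAut 𝔽 A) where
  carrier := {e | ∀ a, e.1 a - a ∈ algPower 𝔽 A (k + 2)}
  one_mem' := fun a => by
    change a - a ∈ _
    rw [sub_self]
    exact zero_mem _
  mul_mem' := fun {e f} he hf a => by
    rw [algAut_mul_apply, ← sub_add_sub_cancel _ (f.1 a)]
    exact add_mem (he _) (hf _)
  inv_mem' := fun {e} he a => by
    have := he ((e⁻¹).1 a)
    rw [algAut_apply_inv_self] at this
    rw [← neg_sub]
    exact neg_mem this

/-- The commutator sends gxb to xgb, and the displacement is xgb - gxb = (x - 1)(gb - b) - (g -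
1)(xb - b). Each term lies deep enough by `sub_mem_algPower_add`. -/
theorem commutator_congAut_le (k : ℕ) :
    ⁅congAut 𝔽 A k, congAut 𝔽 A 0⁆ ≤ congAut 𝔽 A (k + 1) := by
  refine Subgroup.commutator_le.2 fun x hx g hg a => ?_
  obtain ⟨b, rfl⟩ : ∃ b, a = (g * x).1 b := ⟨((g * x)⁻¹).1 a, (algAut_apply_inv_self _ _).symm⟩
  have h1 : (⁅x, g⁆ : algAut 𝔽 A).1 ((g * x).1 b) = x.1 (g.1 b) := by
    rw [← algAut_mul_apply, ← algAut_mul_apply, commutatorElement_def]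
    congr 2
    group
  rw [h1, algAut_mul_apply]
  have h2 := sub_mem_algPower_add (φ := algAutHom x) (ψ := NonUnitalAlgHom.id 𝔽 A) (r := k + 1)
    hx (hg b)
  have h3 := sub_mem_algPower_add (φ := algAutHom g) (ψ := NonUnitalAlgHom.id 𝔽 A) (r := 1)
    hg (hx b)
  change x.1 (g.1 b - b) - (g.1 b - b) ∈ _ at h2
  change g.1 (x.1 b - b) - (x.1 b - b) ∈ _ at h3
  have h4 : x.1 (g.1 b) - g.1 (x.1 b) =
      (x.1 (g.1 b - b) - (g.1 b - b)) - (g.1 (x.1 b - b) - (x.1 b - b)) := by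
    rw [map_sub, map_sub]; abel
  rw [h4]
  refine sub_mem ?_ ?_
  · convert h2 using 2; ring
  · convert h3 using 2

theorem lowerCentralSeries_congAut_le (k : ℕ) :
    (congAut 𝔽 A 0).lowerCentralSeries k ≤ congAut 𝔽 A k := by
  induction k with
  | zero => exact le_rfl
  | succ k ih => exact (Subgroup.commutator_mono ih le_rfl).trans (commutator_congAut_le k)

omit [IsScalarTower 𝔽 A A] [SMulCommClass 𝔽 A A] in
theorem congAut_eq_bot {c k : ℕ} (hc : algPower 𝔽 A (c + 1) = ⊥) (hk : k + 1 = c) :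
    congAut 𝔽 A k = ⊥ := by
  rw [eq_bot_iff]
  intro e he
  rw [Subgroup.mem_bot]
  apply Subtype.ext
  ext a
  have := he a
  rw [show k + 2 = c + 1 by omega, hc] at this
  exact sub_eq_zero.1 this

section Elementary

variable {n : ℕ} {y : Fin n → A} (hy : MonomialsSpan 𝔽 y)

include hy in
theorem mem_congAut_zero_of_gen {e : algAut 𝔽 A} (h : ∀ i, e.1 (y i) - y i ∈ algPower 𝔽 A 2) :
    e ∈ congAut 𝔽 A 0 := fun a =>
  hy.sub_mem_two (φ := algAutHom e) (ψ := NonUnitalAlgHom.id 𝔽 A) h a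

variable [Finite A] {c : ℕ}
  (hlift : ∀ p : Fin n → A, (∀ i, p i ∈ algPower 𝔽 A 2) →
    ∃ φ : A →ₙₐ[𝔽] A, ∀ i, φ (y i) = y i + p i)

include hy hlift

theorem exists_congAut (hc : algPower 𝔽 A (c + 1) = ⊥) (p : Fin n → A)
    (hp : ∀ i, p i ∈ algPower 𝔽 A 2) :
    ∃ e ∈ congAut 𝔽 A 0, ∀ i, e.1 (y i) = y i + p i := by
  obtain ⟨φ, hφ⟩ := hlift p hp
  obtain ⟨e, he⟩ := exists_algAut_of_injective (φ := φ) (injective_of_sub_mem hc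
    (hy.sub_mem_two (φ := φ) (ψ := NonUnitalAlgHom.id 𝔽 A) fun i => by
      change φ (y i) - y i ∈ _
      rw [hφ, add_sub_cancel_left]
      exact hp i))
  exact ⟨e, fun a => by
    rw [he]
    exact hy.sub_mem_two (φ := φ) (ψ := NonUnitalAlgHom.id 𝔽 A) (fun i => by
      change φ (y i) - y i ∈ _
      rw [hφ, add_sub_cancel_left]
      exact hp i) a, fun i => by rw [he, hφ]⟩

theorem exists_elementary (hc : algPower 𝔽 A (c + 1) = ⊥) (j : Fin n) {w : A}
    (hw : w ∈ algPower 𝔽 A 2) :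
    ∃ e ∈ congAut 𝔽 A 0, e.1 (y j) = y j + w ∧ ∀ i, i ≠ j → e.1 (y i) = y i := by
  obtain ⟨e, he, h⟩ := exists_congAut hy hlift hc (fun i => if i = j then w else 0) (fun i => by
    split_ifs
    · exact hw
    · exact zero_mem _)
  exact ⟨e, he, by rw [h, if_pos rfl], fun i hi => by rw [h, if_neg hi, add_zero]⟩

/-- Elementary automorphisms given by monomials of degree `k + 2` lie in the corresponding term
of the lower central series. -/
theorem elementary_mem_lowerCentralSeries (hc : algPower 𝔽 A (c + 1) = ⊥) (k : ℕ)
    (hk : k + 4 ≤ n) (m : FreeMagma (Fin n)) (hm : m.length = k + 2) (j : Fin n)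
    (hj : j ∉ m.support) (e : algAut 𝔽 A) (hej : e.1 (y j) = y j + FreeMagma.lift y m)
    (hei : ∀ i, i ≠ j → e.1 (y i) = y i) :
    e ∈ (congAut 𝔽 A 0).lowerCentralSeries k := by
  induction k generalizing m e with
  | zero =>
    refine mem_congAut_zero_of_gen hy fun i => ?_
    by_cases hi : i = j
    · subst hi
      rw [hej, add_sub_cancel_left]
      have := lift_mem_algPower' (𝔽 := 𝔽) y m
      rwa [hm] at this
    · rw [hei i hi, sub_self]
      exact zero_mem _
  | succ k ih =>
    -- The monomial uses at most k + 3 letters and `j` is one more, while n ≥ k + 5.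
    obtain ⟨l, hl⟩ : ∃ l, l ∉ insert j m.support := by
      by_contra hcon
      push Not at hcon
      have h1 := Finset.card_le_card (fun l (_ : l ∈ Finset.univ) => hcon l)
      have h2 := Finset.card_insert_le j m.support
      have h3 := m.card_support_le
      rw [Finset.card_univ, Fintype.card_fin] at h1
      omega
    rw [Finset.mem_insert, not_or] at hl
    obtain ⟨m', a, b, hm', ha, hb, hsupp, hadd⟩ := m.exists_contract (by omega) hl.2
    have hjm' : j ∉ m'.support := fun h => by
      rcases Finset.mem_insert.1 (hsupp h) with h | h
      · exact hl.1 h.symm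
      · exact hj h
    have haj : a ≠ j := by rintro rfl; exact hj ha
    have hbj : b ≠ j := by rintro rfl; exact hj hb
    have hw' : FreeMagma.lift y m' ∈ algPower 𝔽 A 2 :=
      algPower_le (by norm_num) (by omega) (lift_mem_algPower' y m')
    obtain ⟨φ, -, hφj, hφi⟩ := exists_elementary hy hlift hc j hw'
    obtain ⟨ψ, hψ, hψl, hψi⟩ := exists_elementary hy hlift hc l
      (mul_mem_algPower_two (𝔽 := 𝔽) (y a) (y b))
    have hφ := ih (by omega) m' (by omega) hjm' φ hφj hφi
    have hfix : ∀ (f : algAut 𝔽 A), (∀ i, i ≠ j → f.1 (y i) = y i) → ∀ u : FreeMagma (Fin n),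
        j ∉ u.support → f.1 (FreeMagma.lift y u) = FreeMagma.lift y u := fun f hf u hu => by
      rw [← algAutHom_apply, hom_freeMagma_lift]
      exact FreeMagma.lift_congr u fun i hi => hf i (by rintro rfl; exact hu hi)
    have hψm' : ψ.1 (FreeMagma.lift y m') = FreeMagma.lift y m' + FreeMagma.lift y m := by
      rw [← hadd, ← algAutHom_apply, hom_freeMagma_lift]
      refine FreeMagma.lift_congr _ fun i _ => ?_
      by_cases hi : i = l
      · subst hi
        rw [Function.update_self, algAutHom_apply, hψl]
      · rw [Function.update_of_ne hi, algAutHom_apply, hψi i hi]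
    -- `φ` adds `m'` to the letter `j`, and `ψ` adds `y a * y b` to the letter `l`, which turns `m'`
    -- into `m' + m`. Interchanging them therefore adds precisely `m` to the letter `j`, which is
    -- the effect of `e`.
    have hrel : φ * e * ψ = ψ * φ := by
      refine hy.algAut_ext fun i => ?_
      rw [algAut_mul_apply, algAut_mul_apply, algAut_mul_apply]
      by_cases hij : i = j
      · subst hij
        rw [hψi i (Ne.symm hl.1), hej, map_add, hφj, hfix φ hφi m hj, map_add,
          hψi i (Ne.symm hl.1), hψm', add_assoc]
      · rw [hφi i hij]
        by_cases hil : i = l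
        · subst hil
          rw [hψl, map_add, e.2, hei i hij, hei a haj, hei b hbj, map_add, φ.2, hφi i hij,
            hφi a haj, hφi b hbj]
        · rw [hψi i hil, hei i hij, hφi i hij]
    have he : e = ⁅φ⁻¹, ψ⁆ := by
      rw [commutatorElement_def, inv_inv, mul_assoc φ⁻¹, ← hrel]
      group
    rw [he]
    exact Subgroup.commutator_mem_commutator (inv_mem hφ) hψ

/-- The lower central series descends along the congruence subgroups, so the class is at most c - 1.
If it were smaller, every elementary automorphism that adds a monomial of degree c to an unused
generator would be trivial; then all these monomials would vanish, and `A ^ c` with them. -/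
theorem nilpotencyClass_congAut (hc2 : 2 ≤ c) (hn : c + 2 ≤ n) (hc : algPower 𝔽 A (c + 1) = ⊥)
    (hne : algPower 𝔽 A c ≠ ⊥) : Group.IsNilpotent (congAut 𝔽 A 0) ∧
      Group.nilpotencyClass (congAut 𝔽 A 0) = c - 1 := by
  have h1 : (congAut 𝔽 A 0).lowerCentralSeries (c - 1) = ⊥ :=
    eq_bot_iff.2 ((lowerCentralSeries_congAut_le (c - 1)).trans
      (congAut_eq_bot hc (by omega)).le)
  have hnil : Group.IsNilpotent (congAut 𝔽 A 0) :=
    (Subgroup.isNilpotent_iff_lowerCentralSeries _).2 ⟨_, h1⟩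
  refine ⟨hnil, le_antisymm ?_ ?_⟩
  · rw [← Subgroup.lowerCentralSeries_eq_bot_iff_nilpotencyClass_le, ← Subgroup.map_subtype_inj,
      Subgroup.map_bot, Subgroup.top_subtype_lowerCentralSeries, h1]
  · by_contra hcon
    have h2 : (congAut 𝔽 A 0).lowerCentralSeries (c - 2) = ⊥ := by
      rw [← Subgroup.top_subtype_lowerCentralSeries,
        Subgroup.lowerCentralSeries_eq_bot_iff_nilpotencyClass_le.2 (by omega), Subgroup.map_bot]
    refine hne (eq_bot_iff.2 ?_)
    rw [hy.algPower_eq_span hc, Submodule.span_le]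
    rintro _ ⟨m, hm, rfl⟩
    obtain ⟨j, hj⟩ : ∃ j, j ∉ m.support := by
      by_contra hcon
      push Not at hcon
      have h1 := Finset.card_le_card (fun l (_ : l ∈ Finset.univ) => hcon l)
      have h3 := m.card_support_le
      rw [Finset.card_univ, Fintype.card_fin] at h1
      omega
    obtain ⟨e, -, hej, hei⟩ := exists_elementary hy hlift hc j (w := FreeMagma.lift y m)
      (algPower_le (by norm_num) (by omega) (lift_mem_algPower' y m))
    have h3 := elementary_mem_lowerCentralSeries hy hlift hc (c - 2) (by omega) m (by omega) j hj e
      hej hei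
    rw [h2, Subgroup.mem_bot] at h3
    rw [h3] at hej
    change y j = y j + _ at hej
    exact (Submodule.mem_bot 𝔽).2 (left_eq_add.1 hej)

end Elementary

end Automorphisms

/-! ### Order and structure of the automorphism group -/

section Structure

variable {𝔽 : Type u} [Field 𝔽] {A : Type u} [NonUnitalNonAssocRing A] [Module 𝔽 A]
  {n : ℕ} {y : Fin n → A}

theorem IsMinGen.smul_unique (hy : IsMinGen 𝔽 y) (i : Fin n) {l l' : 𝔽}
    (h : l • y i - l' • y i ∈ algPower 𝔽 A 2) : l = l' := by
  classical
  have := hy.ind (Pi.single i (l - l')) (by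
    rw [Finset.sum_eq_single i (fun j _ hj => by rw [Pi.single_eq_of_ne hj, zero_smul])
      (fun hi => absurd (Finset.mem_univ i) hi), Pi.single_eq_same, sub_smul]
    exact h)
  have h2 := congrFun this i
  rw [Pi.single_eq_same] at h2
  exact sub_eq_zero.1 h2

/-- If every automorphism is scalar modulo the square, its factor defines a character. -/
theorem IsMinGen.exists_character (hy : IsMinGen 𝔽 y) (i₀ : Fin n)
    (hscal : ∀ e : algAut 𝔽 A, ∃ l : 𝔽, ∀ i, e.1 (y i) - l • y i ∈ algPower 𝔽 A 2) :
    ∃ χ : algAut 𝔽 A →* 𝔽ˣ, ∀ e i, e.1 (y i) - (χ e : 𝔽) • y i ∈ algPower 𝔽 A 2 := by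
  choose χ hχ using hscal
  have huniq : ∀ e l, e.1 (y i₀) - l • y i₀ ∈ algPower 𝔽 A 2 → χ e = l := fun e l h =>
    hy.smul_unique i₀ (by
      have := sub_mem h (hχ e i₀)
      rwa [sub_sub_sub_cancel_left] at this)
  let f : algAut 𝔽 A →* 𝔽 :=
    { toFun := χ
      map_one' := huniq 1 1 (by
        rw [one_smul]
        change y i₀ - y i₀ ∈ _
        rw [sub_self]
        exact zero_mem _)
      map_mul' := fun e g => huniq _ _ (by
        rw [algAut_mul_apply]
        have h1 := map_mem_algPower (𝔽 := 𝔽) (algAutHom e) (hχ g i₀)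
        change e.1 _ ∈ _ at h1
        rw [map_sub, map_smul] at h1
        have h2 := Submodule.smul_mem _ (χ g) (hχ e i₀)
        have := add_mem h1 h2
        rwa [smul_sub, sub_add_sub_cancel, smul_smul, mul_comm] at this) }
  exact ⟨f.toHomUnits, fun e i => hχ e i⟩

theorem MonomialsSpan.exists_scalarHom [Finite A] (hy : MonomialsSpan 𝔽 y)
    (hlift : ∀ l : 𝔽ˣ, ∃ φ : A →ₙₐ[𝔽] A, ∀ i, φ (y i) = (l : 𝔽) • y i) :
    ∃ s : 𝔽ˣ →* algAut 𝔽 A, ∀ l i, (s l).1 (y i) = (l : 𝔽) • y i := by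
  choose φ hφ using hlift
  have hinj : ∀ l, Function.Injective (φ l) := fun l => by
    have h : (φ l⁻¹).comp (φ l) = NonUnitalAlgHom.id 𝔽 A := hy.hom_ext fun i => by
      change φ l⁻¹ (φ l (y i)) = y i
      rw [hφ, map_smul, hφ, smul_smul, Units.mul_inv, one_smul]
    exact Function.LeftInverse.injective (g := φ l⁻¹) fun a =>
      congrArg (fun ψ : A →ₙₐ[𝔽] A => ψ a) h
  choose s hs using fun l => exists_algAut_of_injective (hinj l)
  have hs' : ∀ l i, (s l).1 (y i) = (l : 𝔽) • y i := fun l i => by rw [hs, hφ]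
  exact ⟨{  toFun := s
            map_one' := hy.algAut_ext fun i => by
              rw [hs', Units.val_one, one_smul]; rfl
            map_mul' := fun a b => hy.algAut_ext fun i => by
              rw [algAut_mul_apply, hs', hs', map_smul, hs', smul_smul, Units.val_mul, mul_comm] },
    hs'⟩

variable [IsScalarTower 𝔽 A A] [SMulCommClass 𝔽 A A]

/-- The displacements of the n generators can be prescribed freely in the square, and they determine
the automorphism. -/
theorem natCard_congAut_zero [Finite A] {c : ℕ} (hy : MonomialsSpan 𝔽 y)
    (hlift : ∀ p : Fin n → A, (∀ i, p i ∈ algPower 𝔽 A 2) →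
      ∃ φ : A →ₙₐ[𝔽] A, ∀ i, φ (y i) = y i + p i)
    (hc : algPower 𝔽 A (c + 1) = ⊥) :
    Nat.card (congAut 𝔽 A 0) = Nat.card (algPower 𝔽 A 2) ^ n := by
  have h : Function.Bijective (fun (e : congAut 𝔽 A 0) (i : Fin n) =>
      (⟨e.1.1 (y i) - y i, e.2 (y i)⟩ : algPower 𝔽 A 2)) := by
    refine ⟨fun e f hef => Subtype.ext (hy.algAut_ext fun i => ?_), fun p => ?_⟩
    · exact sub_left_injective (congrArg Subtype.val (congrFun hef i))
    · obtain ⟨e, he, h⟩ := exists_congAut hy hlift hc (fun i => (p i).1) fun i => (p i).2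
      refine ⟨⟨e, he⟩, funext fun i => Subtype.ext ?_⟩
      change e.1 (y i) - y i = p i
      rw [h, add_sub_cancel_left]
  rw [Nat.card_congr (Equiv.ofBijective _ h), Nat.card_fun, Nat.card_fin]

theorem isInternalSemidirect_ker_range {G H : Type*} [Group G] [Group H] (χ : G →* H) (s : H →* G)
    (h : ∀ l, χ (s l) = l) : IsInternalSemidirect χ.ker s.range := by
  refine ⟨inferInstance, ?_, ?_⟩
  · rw [eq_bot_iff]
    rintro _ ⟨h1, l, rfl⟩
    have h1 : χ (s l) = 1 := h1
    rw [h] at h1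
    rw [h1, map_one]
    exact Subgroup.mem_bot.2 rfl
  · rw [eq_top_iff]
    intro g _
    rw [← inv_mul_cancel_right g (s (χ g))]
    refine Subgroup.mul_mem_sup ?_ ⟨χ g, rfl⟩
    rw [MonoidHom.mem_ker, map_mul, map_inv, h, mul_inv_cancel]

/-- The structure of the automorphism group when all automorphisms are scalar modulo the square and
all substitutions that are scalar modulo the square are endomorphisms. -/
theorem IsMinGen.algAut_structure [Finite 𝔽] [Finite A] {c : ℕ} (hy : IsMinGen 𝔽 y) (hc2 : 2 ≤ c)
    (hn : c + 2 ≤ n) (hc : algPower 𝔽 A (c + 1) = ⊥) (hne : algPower 𝔽 A c ≠ ⊥)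
    (hscal : ∀ e : algAut 𝔽 A, ∃ l : 𝔽, ∀ i, e.1 (y i) - l • y i ∈ algPower 𝔽 A 2)
    (hlift : ∀ (l : 𝔽) (p : Fin n → A), (∀ i, p i ∈ algPower 𝔽 A 2) →
      ∃ φ : A →ₙₐ[𝔽] A, ∀ i, φ (y i) = l • y i + p i) :
    (Nat.card (algAut 𝔽 A) : ℝ)
        = ((Nat.card 𝔽 : ℝ) - 1) * ((Nat.card A : ℝ) / (Nat.card 𝔽 : ℝ) ^ n) ^ n ∧
      Group.IsSolvable (algAut 𝔽 A) ∧
      ∃ N H : Subgroup (algAut 𝔽 A), IsInternalSemidirect N H ∧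
        Group.IsNilpotent N ∧ Group.nilpotencyClass N = c - 1 ∧ Nonempty (H ≃* 𝔽ˣ) := by
  have hlift1 : ∀ p : Fin n → A, (∀ i, p i ∈ algPower 𝔽 A 2) →
      ∃ φ : A →ₙₐ[𝔽] A, ∀ i, φ (y i) = y i + p i := fun p hp => by
    simpa only [one_smul] using hlift 1 p hp
  let i₀ : Fin n := ⟨0, by omega⟩
  obtain ⟨χ, hχ⟩ := hy.exists_character i₀ hscal
  obtain ⟨s, hs⟩ := hy.gen.exists_scalarHom fun l => by
    simpa only [Pi.zero_apply, add_zero] using hlift l 0 fun _ => zero_mem _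
  have hχs : ∀ l, χ (s l) = l := fun l => Units.ext (hy.smul_unique i₀ (by
    have := hχ (s l) i₀
    rw [hs] at this
    rw [← neg_mem_iff, neg_sub]
    exact this))
  have hker : χ.ker = congAut 𝔽 A 0 := by
    ext e
    rw [MonoidHom.mem_ker]
    constructor
    · intro he
      refine mem_congAut_zero_of_gen hy.gen fun i => ?_
      have := hχ e i
      rwa [he, Units.val_one, one_smul] at this
    · intro he
      refine Units.ext (hy.smul_unique i₀ ?_)
      have h1 := hχ e i₀
      have h2 := he (y i₀)
      have := sub_mem h2 h1
      rwa [sub_sub_sub_cancel_left, Units.val_one, one_smul] at *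
  obtain ⟨hN, hcl⟩ := nilpotencyClass_congAut hy.gen hlift1 hc2 hn hc hne
  have hsd := isInternalSemidirect_ker_range χ s hχs
  have hsinj : Function.Injective s := Function.LeftInverse.injective hχs
  have hχsurj : Function.Surjective χ := Function.RightInverse.surjective hχs
  refine ⟨?_, ?_, χ.ker, s.range, hsd, by rw [hker]; exact hN, by rw [hker]; exact hcl,
    ⟨(MonoidHom.ofInjective hsinj).symm⟩⟩
  · have h1 : Nat.card (algAut 𝔽 A) = Nat.card (algPower 𝔽 A 2) ^ n * Nat.card 𝔽ˣ := by
      rw [← natCard_congAut_zero hy.gen hlift1 hc, ← hker, ← Subgroup.card_mul_index χ.ker,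
        Subgroup.index_ker, MonoidHom.range_eq_top.2 hχsurj, Subgroup.card_top]
    have h2 : Nat.card A = Nat.card 𝔽 ^ n * Nat.card (algPower 𝔽 A 2) := by
      rw [Module.natCard_eq_pow_finrank (K := 𝔽) (V := A),
        Module.natCard_eq_pow_finrank (K := 𝔽) (V := algPower 𝔽 A 2), hy.finrank_eq,
        Fintype.card_fin, pow_add]
    have hq : (Nat.card 𝔽 : ℝ) ≠ 0 := Nat.cast_ne_zero.2 Nat.card_pos.ne'
    have h3 : (Nat.card 𝔽ˣ : ℝ) = (Nat.card 𝔽 : ℝ) - 1 := by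
      rw [Nat.card_units, Nat.cast_sub Nat.card_pos, Nat.cast_one]
    rw [h1, h2, Nat.cast_mul, Nat.cast_mul, Nat.cast_pow, Nat.cast_pow, h3,
      mul_div_cancel_left₀ _ (pow_ne_zero _ hq), mul_comm]
  · have : Group.IsNilpotent χ.ker := by rw [hker]; exact hN
    -- The group is an extension of the commutative group `𝔽ˣ` by a nilpotent one.
    exact Group.isSolvable_of_ker_le_range χ.ker.subtype χ (by rw [Subgroup.range_subtype])

end Structure

/-! ### Nonzero monomials in few letters, and images of generating families -/

section MonomialValues

theorem FreeMagma.lift_map {α β B : Type*} [Mul B] (g : α → β) (z : β → B) (m : FreeMagma α) :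
    FreeMagma.lift z (FreeMagma.map g m) = FreeMagma.lift (fun a => z (g a)) m := by
  induction m using FreeMagma.recOnMul with
  | ih1 a => rfl
  | ih2 a b ha hb => rw [map_mul, map_mul, map_mul, ha, hb]

variable {𝔽 : Type u} [Field 𝔽] {A : Type u} [NonUnitalNonAssocRing A] [Module 𝔽 A]

/-- A monomial of degree c involves at most c ≤ n elements, so its letters can be renamed
injectively by indices below n. -/
theorem exists_lift_ne_zero {c n : ℕ} (hcn : c ≤ n) (hne : algPower 𝔽 A c ≠ ⊥) :
    ∃ m : FreeMagma (Fin n), m.length = c ∧ ∃ z : Fin n → A, FreeMagma.lift z m ≠ 0 := by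
  classical
  rw [algPower, Ne, Submodule.span_eq_bot] at hne
  push Not at hne
  obtain ⟨_, ⟨m, hm, rfl⟩, h0⟩ := hne
  obtain ⟨e⟩ : Nonempty (m.support ↪ Fin n) := Function.Embedding.nonempty_of_card_le (by
    rw [Fintype.card_coe, Fintype.card_fin]
    exact m.card_support_le.trans (hm.le.trans hcn))
  have hpos : 0 < n := lt_of_lt_of_le (hm ▸ m.one_le_length) hcn
  let g : A → Fin n := fun a => if h : a ∈ m.support then e ⟨a, h⟩ else ⟨0, hpos⟩
  let z : Fin n → A := Function.extend e Subtype.val 0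
  refine ⟨FreeMagma.map g m, by rw [FreeMagma.length_map, hm], z, ?_⟩
  rw [FreeMagma.lift_map, FreeMagma.lift_congr (z := id) m fun a ha => ?_]
  · exact h0
  · change z (g a) = a
    rw [show g a = e ⟨a, ha⟩ from dif_pos ha]
    exact e.injective.extend_apply _ _ _

theorem MonomialsSpan.map {B : Type u} [NonUnitalNonAssocRing B] [Module 𝔽 B] {ι : Type*}
    {x : ι → A} (hx : MonomialsSpan 𝔽 x) {φ : A →ₙₐ[𝔽] B} (hφ : Function.Surjective φ) :
    MonomialsSpan 𝔽 (fun i => φ (x i)) := by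
  rw [MonomialsSpan, eq_top_iff]
  intro b _
  obtain ⟨a, rfl⟩ := hφ b
  refine hx.induction (p := fun a => φ a ∈ Submodule.span 𝔽 _) a (fun m => ?_) ?_
    (fun a b ha hb => ?_) fun r a ha => ?_
  · rw [hom_freeMagma_lift]
    exact Submodule.subset_span ⟨m, rfl⟩
  · rw [map_zero]; exact zero_mem _
  · rw [map_add]; exact add_mem ha hb
  · rw [map_smul]; exact Submodule.smul_mem _ _ ha

theorem MonomialsSpan.adjoin_eq_top [IsScalarTower 𝔽 A A] [SMulCommClass 𝔽 A A] {ι : Type*}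
    {x : ι → A} (hx : MonomialsSpan 𝔽 x) : NonUnitalAlgebra.adjoin 𝔽 (Set.range x) = ⊤ := by
  rw [eq_top_iff]
  intro a _
  refine hx.induction (p := fun a => a ∈ NonUnitalAlgebra.adjoin 𝔽 (Set.range x)) a (fun m => ?_)
    (zero_mem _) (fun a b ha hb => add_mem ha hb) fun r a ha => SMulMemClass.smul_mem r ha
  induction m using FreeMagma.recOnMul with
  | ih1 i => exact NonUnitalAlgebra.subset_adjoin 𝔽 ⟨i, rfl⟩
  | ih2 u v hu hv => rw [map_mul]; exact mul_mem hu hv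

theorem MonomialsSpan.surjective {B : Type u} [NonUnitalNonAssocRing B] [Module 𝔽 B] {ι : Type*}
    {x : ι → A} {y : ι → B} (hy : MonomialsSpan 𝔽 y) {φ : A →ₙₐ[𝔽] B} (h : ∀ i, φ (x i) = y i) :
    Function.Surjective φ := fun b => by
  refine hy.induction (p := fun b => ∃ a, φ a = b) b (fun m => ⟨FreeMagma.lift x m, ?_⟩)
    ⟨0, map_zero φ⟩ ?_ ?_
  · rw [hom_freeMagma_lift]
    simp only [h]
  · rintro _ _ ⟨a, rfl⟩ ⟨b, rfl⟩
    exact ⟨a + b, map_add φ a b⟩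
  · rintro r _ ⟨a, rfl⟩
    exact ⟨r • a, map_smul φ r a⟩

end MonomialValues

/-! ### Kernels and factorization of homomorphisms -/

section Ideals

variable {𝔽 : Type u} [Field 𝔽] {A : Type u} [NonUnitalNonAssocRing A] [Module 𝔽 A]

/-- The projection onto a quotient algebra as a homomorphism. -/
def AlgIdeal.projHom (I : AlgIdeal 𝔽 A) : A →ₙₐ[𝔽] I.Quot where
  toFun := I.proj
  map_smul' r a := I.proj.map_smul r a
  map_zero' := I.proj.map_zero
  map_add' := I.proj.map_add
  map_mul' := I.proj_mul

theorem AlgIdeal.projHom_eq_zero (I : AlgIdeal 𝔽 A) {a : A} :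
    I.projHom a = 0 ↔ a ∈ I.toSubmodule := Submodule.Quotient.mk_eq_zero _

/-- The kernel of a homomorphism. -/
def kerIdeal {B : Type u} [NonUnitalNonAssocRing B] [Module 𝔽 B] (φ : A →ₙₐ[𝔽] B) :
    AlgIdeal 𝔽 A where
  toSubmodule := LinearMap.ker (φ : A →ₗ[𝔽] B)
  mul_mem_left' a x hx := by
    change φ (a * x) = 0
    rw [map_mul, show φ x = 0 from hx, mul_zero]
  mul_mem_right' a x hx := by
    change φ (x * a) = 0
    rw [map_mul, show φ x = 0 from hx, zero_mul]

theorem mem_kerIdeal {B : Type u} [NonUnitalNonAssocRing B] [Module 𝔽 B] (φ : A →ₙₐ[𝔽] B) {a : A} :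
    a ∈ (kerIdeal φ).toSubmodule ↔ φ a = 0 := Iff.rfl

/-- A homomorphism that vanishes on the kernel of a surjective homomorphism factors through it. -/
theorem exists_factor {B C : Type u} [NonUnitalNonAssocRing B] [Module 𝔽 B]
    [NonUnitalNonAssocRing C] [Module 𝔽 C] {π : A →ₙₐ[𝔽] B} (hπ : Function.Surjective π)
    (φ : A →ₙₐ[𝔽] C) (h : ∀ a, π a = 0 → φ a = 0) : ∃ ψ : B →ₙₐ[𝔽] C, ∀ a, ψ (π a) = φ a := by
  choose s hs using hπ
  have hf : ∀ a, φ (s (π a)) = φ a := fun a => by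
    rw [← sub_eq_zero, ← map_sub]
    exact h _ (by rw [map_sub, hs, sub_self])
  exact ⟨{  toFun := fun b => φ (s b)
            map_smul' := fun r b => by
              obtain ⟨a, rfl⟩ : ∃ a, π a = b := ⟨s b, hs b⟩
              rw [← map_smul, hf, hf, map_smul]
              rfl
            map_zero' := by rw [← map_zero π, hf, map_zero]
            map_add' := fun b b' => by
              obtain ⟨a, rfl⟩ : ∃ a, π a = b := ⟨s b, hs b⟩
              obtain ⟨a', rfl⟩ : ∃ a, π a = b' := ⟨s b', hs b'⟩
              rw [← map_add, hf, hf, hf, map_add]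
            map_mul' := fun b b' => by
              obtain ⟨a, rfl⟩ : ∃ a, π a = b := ⟨s b, hs b⟩
              obtain ⟨a', rfl⟩ : ∃ a, π a = b' := ⟨s b', hs b'⟩
              rw [← map_mul, hf, hf, hf, map_mul] }, hf⟩

end Ideals

/-! ### Relatively free algebras and their quotients -/

section RelativelyFree

variable {𝔽 : Type u} [Field 𝔽]

theorem FreeNonUnitalNonAssocAlgebra.hom_lift {X : Type*} {A B : Type u} [NonUnitalNonAssocRing A]
    [Module 𝔽 A] [IsScalarTower 𝔽 A A] [SMulCommClass 𝔽 A A] [NonUnitalNonAssocRing B]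
    [Module 𝔽 B] [IsScalarTower 𝔽 B B] [SMulCommClass 𝔽 B B] (φ : A →ₙₐ[𝔽] B) (a : X → A)
    (w : FreeNonUnitalNonAssocAlgebra 𝔽 X) :
    φ (lift 𝔽 a w) = lift 𝔽 (fun i => φ (a i)) w := by
  have : φ.comp (lift 𝔽 a) = lift 𝔽 (fun i => φ (a i)) := hom_ext 𝔽 fun i => by
    change φ (lift 𝔽 a (of 𝔽 i)) = _
    rw [lift_of_apply, lift_of_apply]
  exact congrArg (fun ψ : FreeNonUnitalNonAssocAlgebra 𝔽 X →ₙₐ[𝔽] B => ψ w) this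

/-- By the universal property the identity factors through the subalgebra generated by the letters.
-/
theorem FreeNonUnitalNonAssocAlgebra.monomialsSpan_of (X : Type) :
    MonomialsSpan 𝔽 (of 𝔽 : X → FreeNonUnitalNonAssocAlgebra 𝔽 X) := by
  refine monomialsSpan_of_adjoin ?_
  let S := NonUnitalAlgebra.adjoin 𝔽 (Set.range (of 𝔽 : X → FreeNonUnitalNonAssocAlgebra 𝔽 X))
  let φ : FreeNonUnitalNonAssocAlgebra 𝔽 X →ₙₐ[𝔽] S :=
    lift 𝔽 fun i => ⟨of 𝔽 i, NonUnitalAlgebra.subset_adjoin 𝔽 ⟨i, rfl⟩⟩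
  rw [eq_top_iff]
  intro a _
  have h : (NonUnitalSubalgebraClass.subtype S).comp φ = NonUnitalAlgHom.id 𝔽 _ :=
    hom_ext 𝔽 fun i => by
      change (φ (of 𝔽 i) : FreeNonUnitalNonAssocAlgebra 𝔽 X) = _
      rw [lift_of_apply]
      rfl
  have h2 : (φ a : FreeNonUnitalNonAssocAlgebra 𝔽 X) = a :=
    congrArg (fun ψ : FreeNonUnitalNonAssocAlgebra 𝔽 X →ₙₐ[𝔽] _ => ψ a) h
  rw [← h2]
  exact (φ a).2

theorem InClass.of_surjective {W : Set (FreeNonUnitalNonAssocAlgebra 𝔽 ℕ)} {A B : Type u}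
    [NonUnitalNonAssocRing A] [Module 𝔽 A] [IsScalarTower 𝔽 A A] [SMulCommClass 𝔽 A A]
    [NonUnitalNonAssocRing B] [Module 𝔽 B] [IsScalarTower 𝔽 B B] [SMulCommClass 𝔽 B B]
    (hA : InClass W A) {φ : A →ₙₐ[𝔽] B} (hφ : Function.Surjective φ) : InClass W B := by
  intro w hw b
  choose a ha using fun i => hφ (b i)
  obtain rfl : b = fun i => φ (a i) := funext fun i => (ha i).symm
  rw [← FreeNonUnitalNonAssocAlgebra.hom_lift, hA w hw a, map_zero]

variable (W : Set (FreeNonUnitalNonAssocAlgebra 𝔽 ℕ)) (n : ℕ)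

theorem inClass_relFree : InClass W (RelFree W n) := by
  intro w hw b
  choose a ha using fun i => (verbalIdeal W (FreeNonUnitalNonAssocAlgebra 𝔽 (Fin n))).proj_surjective
    (b i)
  obtain rfl : b = fun i => AlgIdeal.projHom _ (a i) := funext fun i => (ha i).symm
  rw [← FreeNonUnitalNonAssocAlgebra.hom_lift, AlgIdeal.projHom_eq_zero]
  exact fun I hI => hI w hw a

/-- The free generators of the relatively free algebra. -/
noncomputable def RelFree.gen (i : Fin n) : RelFree W n :=
  AlgIdeal.projHom _ (FreeNonUnitalNonAssocAlgebra.of 𝔽 i)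

variable {W n}

theorem RelFree.exists_hom {P : Type u} [NonUnitalNonAssocRing P] [Module 𝔽 P]
    [IsScalarTower 𝔽 P P] [SMulCommClass 𝔽 P P] (hP : InClass W P) (y : Fin n → P) :
    ∃ φ : RelFree W n →ₙₐ[𝔽] P, ∀ i, φ (RelFree.gen W n i) = y i := by
  obtain ⟨ψ, hψ⟩ := exists_factor
    (π := (verbalIdeal W (FreeNonUnitalNonAssocAlgebra 𝔽 (Fin n))).projHom)
    (AlgIdeal.proj_surjective _) (FreeNonUnitalNonAssocAlgebra.lift 𝔽 y) fun a ha =>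
      (mem_kerIdeal _).1 <| (AlgIdeal.projHom_eq_zero _).1 ha
        (kerIdeal (FreeNonUnitalNonAssocAlgebra.lift 𝔽 y)) fun w hw b => by
          rw [mem_kerIdeal, FreeNonUnitalNonAssocAlgebra.hom_lift]
          exact hP w hw _
  exact ⟨ψ, fun i => by
    rw [RelFree.gen, hψ, FreeNonUnitalNonAssocAlgebra.lift_of_apply]⟩

variable (W n) in
theorem RelFree.isFreeBasis_gen : IsFreeBasis 𝔽 (RelFree.gen W n) where
  gen := (FreeNonUnitalNonAssocAlgebra.monomialsSpan_of (Fin n)).map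
    (φ := AlgIdeal.projHom _) (AlgIdeal.proj_surjective _)
  ext y := RelFree.exists_hom (inClass_relFree W n) y

theorem RelFree.algPower_eq_bot {c : ℕ} (hnil : IsNilpotentClass W c) :
    algPower 𝔽 (RelFree W n) (c + 1) = ⊥ :=
  hnil.1 (NAAlgebra.mk (RelFree W n)) (inClass_relFree W n)

theorem RelFree.algPower_ne_bot {c : ℕ} (hnil : IsNilpotentClass W c) (hn : c ≤ n) :
    algPower 𝔽 (RelFree W n) c ≠ ⊥ := by
  obtain ⟨A, hA, hne⟩ := hnil.2
  obtain ⟨m, hm, z, hz⟩ := exists_lift_ne_zero hn hne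
  obtain ⟨φ, hφ⟩ := RelFree.exists_hom (n := n) hA z
  intro h
  have h1 : FreeMagma.lift (RelFree.gen W n) m ∈ algPower 𝔽 (RelFree W n) c :=
    hm ▸ lift_mem_algPower' _ m
  rw [h, Submodule.mem_bot] at h1
  apply hz
  rw [← funext hφ, ← hom_freeMagma_lift, h1, map_zero]

/-- The quotient of the relatively free algebra by an ideal as an `n`-generated algebra. -/
noncomputable def RelFree.quotient (J : AlgIdeal 𝔽 (RelFree W n)) : NGenAlgebra W n :=
  ⟨NAAlgebra.mk J.Quot, (inClass_relFree W n).of_surjective (φ := J.projHom) J.proj_surjective,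
    fun i => J.projHom (RelFree.gen W n i),
    ((RelFree.isFreeBasis_gen W n).gen.map (φ := J.projHom) J.proj_surjective).adjoin_eq_top⟩

theorem RelFree.mk_quotient_kerIdeal {P : NGenAlgebra W n} {φ : RelFree W n →ₙₐ[𝔽] P.1}
    (hφ : Function.Surjective φ) :
    IsoClass.mk (RelFree.quotient (kerIdeal φ)) = IsoClass.mk P := by
  refine Quotient.sound ⟨LinearMap.quotKerEquivOfSurjective (φ : RelFree W n →ₗ[𝔽] P.1) hφ, ?_⟩
  intro a b
  obtain ⟨a, rfl⟩ := (kerIdeal φ).proj_surjective a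
  obtain ⟨b, rfl⟩ := (kerIdeal φ).proj_surjective b
  exact map_mul φ a b

theorem RelFree.exists_surjective (P : NGenAlgebra W n) :
    ∃ φ : RelFree W n →ₙₐ[𝔽] P.1, Function.Surjective φ := by
  obtain ⟨hP, y, hy⟩ := P.2
  obtain ⟨φ, hφ⟩ := RelFree.exists_hom hP y
  exact ⟨φ, (monomialsSpan_of_adjoin hy).surjective hφ⟩

theorem RelFree.mk_quotient_surjective :
    Function.Surjective fun J : AlgIdeal 𝔽 (RelFree W n) => IsoClass.mk (RelFree.quotient J) := by
  intro X
  obtain ⟨P, rfl⟩ := Quotient.exists_rep X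
  obtain ⟨φ, hφ⟩ := RelFree.exists_surjective P
  exact ⟨kerIdeal φ, RelFree.mk_quotient_kerIdeal hφ⟩

theorem RelFree.finite [Finite 𝔽] {c : ℕ} (hnil : IsNilpotentClass W c) : Finite (RelFree W n) :=
  (RelFree.isFreeBasis_gen W n).gen.finite_of_nilpotent (RelFree.algPower_eq_bot hnil)

theorem AlgIdeal.toSubmodule_injective {A : Type u} [NonUnitalNonAssocRing A] [Module 𝔽 A] :
    Function.Injective (AlgIdeal.toSubmodule : AlgIdeal 𝔽 A → Submodule 𝔽 A) := by
  rintro ⟨I, _, _⟩ ⟨J, _, _⟩ h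
  congr

theorem IsoClass.finite [Finite 𝔽] {c : ℕ} (hnil : IsNilpotentClass W c) : Finite (IsoClass W n) := by
  have := RelFree.finite (n := n) hnil
  have : Finite (AlgIdeal 𝔽 (RelFree W n)) := Finite.of_injective _ AlgIdeal.toSubmodule_injective
  exact Finite.of_surjective _ RelFree.mk_quotient_surjective

end RelativelyFree

/-! ### Linear parts of endomorphisms, lifting of isomorphisms, rigid subspaces -/

section LinearPart

variable {𝔽 : Type u} [Field 𝔽] {A : Type u} [NonUnitalNonAssocRing A] [Module 𝔽 A]
  {n : ℕ} {x : Fin n → A}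

/-- The linear part of an endomorphism with respect to the generators `x`. -/
def IsLinearPart (x : Fin n → A) (φ : A →ₙₐ[𝔽] A) (g : (Fin n → 𝔽) →ₗ[𝔽] (Fin n → 𝔽)) : Prop :=
  ∀ r, φ (linComb x r) - linComb x (g r) ∈ algPower 𝔽 A 2

theorem IsLinearPart.comp {φ ψ : A →ₙₐ[𝔽] A} {g h : (Fin n → 𝔽) →ₗ[𝔽] (Fin n → 𝔽)}
    (hg : IsLinearPart x φ g) (hh : IsLinearPart x ψ h) :
    IsLinearPart x (φ.comp ψ) (g ∘ₗ h) := fun r => by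
  have h1 := map_mem_algPower (𝔽 := 𝔽) φ (hh r)
  rw [map_sub] at h1
  have := add_mem h1 (hg (h r))
  rwa [sub_add_sub_cancel] at this

theorem IsMinGen.linComb_mem_two (hx : IsMinGen 𝔽 x) {r : Fin n → 𝔽}
    (h : linComb x r ∈ algPower 𝔽 A 2) : r = 0 := hx.ind r h

theorem IsLinearPart.eq (hx : IsMinGen 𝔽 x) {φ ψ : A →ₙₐ[𝔽] A}
    {g h : (Fin n → 𝔽) →ₗ[𝔽] (Fin n → 𝔽)} (hg : IsLinearPart x φ g) (hh : IsLinearPart x ψ h)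
    (hφψ : ∀ a, φ a - ψ a ∈ algPower 𝔽 A 2) : g = h := by
  refine LinearMap.ext fun r => sub_eq_zero.1 (hx.linComb_mem_two ?_)
  rw [map_sub]
  have := sub_mem (add_mem (hφψ (linComb x r)) (hh r)) (hg r)
  convert this using 1
  abel

variable [IsScalarTower 𝔽 A A] [SMulCommClass 𝔽 A A]

theorem IsMinGen.exists_isLinearPart (hx : IsMinGen 𝔽 x) (φ : A →ₙₐ[𝔽] A) :
    ∃ g, IsLinearPart x φ g :=
  ⟨hx.coord ∘ₗ (φ : A →ₗ[𝔽] A) ∘ₗ linComb x, fun _ => hx.coord_spec _⟩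

/-- Endomorphisms that agree modulo the square agree on `A ^ c` modulo `A ^ (c + 1) = 0`. -/
theorem IsFreeBasis.apply_eq_linEndo (hx : IsFreeBasis 𝔽 x) {c : ℕ}
    (hc : algPower 𝔽 A (c + 1) = ⊥) {φ : A →ₙₐ[𝔽] A} {g : (Fin n → 𝔽) →ₗ[𝔽] (Fin n → 𝔽)}
    (hg : IsLinearPart x φ g) {a : A} (ha : a ∈ algPower 𝔽 A c) : φ a = hx.linEndo g a := by
  have h1 : ∀ a, φ a - hx.linEndo g a ∈ algPower 𝔽 A (1 + 1) := hx.gen.sub_mem_two fun i => by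
    have := hg (Pi.single i 1)
    rwa [← hx.linEndo_linComb, linComb_single] at this
  have h2 := sub_mem_algPower_add h1 ha
  rw [hc] at h2
  exact sub_eq_zero.1 h2

theorem IsFreeBasis.linEndo_smul_id (hx : IsFreeBasis 𝔽 x) {c : ℕ}
    (hc : algPower 𝔽 A (c + 1) = ⊥) (l : 𝔽) {a : A} (ha : a ∈ algPower 𝔽 A c) :
    hx.linEndo (l • LinearMap.id) a = l ^ c • a := by
  have hm : ∀ m : FreeMagma (Fin n), hx.linEndo (l • LinearMap.id) (FreeMagma.lift x m) =
      l ^ m.length • FreeMagma.lift x m := fun m => by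
    induction m using FreeMagma.recOnMul with
    | ih1 i =>
      change hx.linEndo _ (x i) = l ^ 1 • x i
      rw [← linComb_single (𝔽 := 𝔽) x i, hx.linEndo_linComb, pow_one, ← map_smul]
      rfl
    | ih2 u v hu hv =>
      rw [map_mul, map_mul, hu, hv, FreeMagma.length_mul, smul_mul_assoc, mul_smul_comm, smul_smul,
        pow_add]
  rw [hx.gen.algPower_eq_span hc] at ha
  induction ha using Submodule.span_induction with
  | mem a ha => obtain ⟨m, rfl, rfl⟩ := ha; exact hm m
  | zero => rw [map_zero, smul_zero]
  | add a b _ _ ha hb => rw [map_add, ha, hb, smul_add]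
  | smul r a _ ha => rw [map_smul, ha, smul_comm]

omit [IsScalarTower 𝔽 A A] [SMulCommClass 𝔽 A A] in
theorem IsFreeBasis.exists_lift (hx : IsFreeBasis 𝔽 x) {P : Type u} [NonUnitalNonAssocRing P]
    [Module 𝔽 P] (f : A →ₙₐ[𝔽] P) {π : A →ₙₐ[𝔽] P}
    (hπ : Function.Surjective π) : ∃ φ : A →ₙₐ[𝔽] A, ∀ a, π (φ a) = f a := by
  choose s hs using hπ
  refine ⟨hx.endo fun i => s (f (x i)), fun a => ?_⟩
  have : π.comp (hx.endo fun i => s (f (x i))) = f := hx.gen.hom_ext fun i => by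
    change π (hx.endo _ (x i)) = _
    rw [hx.endo_apply, hs]
  exact congrArg (fun ψ : A →ₙₐ[𝔽] P => ψ a) this

/-- An isomorphism between quotients by ideals in the last power comes from a linear
substitution. -/
theorem IsFreeBasis.exists_lift_iso (hx : IsFreeBasis 𝔽 x) {c : ℕ} (hc2 : 2 ≤ c)
    (hc : algPower 𝔽 A (c + 1) = ⊥) (hne : algPower 𝔽 A c ≠ ⊥) {P Q : Type u}
    [NonUnitalNonAssocRing P] [Module 𝔽 P] [NonUnitalNonAssocRing Q] [Module 𝔽 Q]
    {π : A →ₙₐ[𝔽] P} (hπ : Function.Surjective π) {ρ : A →ₙₐ[𝔽] Q} (hρ : Function.Surjective ρ)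
    (hkπ : ∀ a, π a = 0 → a ∈ algPower 𝔽 A c) (e : P ≃ₗ[𝔽] Q) (he : ∀ a b, e (a * b) = e a * e b) :
    ∃ (φ : A →ₙₐ[𝔽] A) (g : (Fin n → 𝔽) →ₗ[𝔽] (Fin n → 𝔽)), IsLinearPart x φ g ∧
      Function.Injective g ∧ (∀ a, ρ (φ a) = e (π a)) ∧
      ∀ a ∈ algPower 𝔽 A c, π a = 0 ↔ ρ (hx.linEndo g a) = 0 := by
  have hm := hx.isMinGen hc hne
  let f : P →ₙₐ[𝔽] Q := { (e : P →ₗ[𝔽] Q) with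
    map_smul' := e.map_smul, map_zero' := e.map_zero, map_mul' := he }
  let f' : Q →ₙₐ[𝔽] P := { (e.symm : Q →ₗ[𝔽] P) with
    map_smul' := e.symm.map_smul, map_zero' := e.symm.map_zero,
    map_mul' := fun a b => by
      change e.symm (a * b) = e.symm a * e.symm b
      apply e.injective
      rw [he]
      simp }
  obtain ⟨φ, hφ⟩ := hx.exists_lift (f.comp π) hρ
  obtain ⟨ψ, hψ⟩ := hx.exists_lift (f'.comp ρ) hπ
  obtain ⟨g, hg⟩ := hm.exists_isLinearPart φ
  obtain ⟨h, hh⟩ := hm.exists_isLinearPart ψ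
  have hφ : ∀ a, ρ (φ a) = e (π a) := hφ
  have hψ : ∀ a, π (ψ a) = e.symm (ρ a) := hψ
  -- The composite of the two lifts is the identity modulo the kernel of `π`. This kernel lies in
  -- A^c, hence in A², so the linear parts are mutually inverse.
  have hhg : h ∘ₗ g = LinearMap.id := IsLinearPart.eq hm (hh.comp hg)
    (ψ := NonUnitalAlgHom.id 𝔽 A) (h := LinearMap.id) (fun r => by
      change linComb x r - linComb x r ∈ algPower 𝔽 A 2
      rw [sub_self]
      exact zero_mem _) fun a => algPower_le (by norm_num) hc2 (hkπ _ (by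
        rw [map_sub]
        change π (ψ (φ a)) - π a = 0
        rw [hψ, hφ, e.symm_apply_apply, sub_self]))
  refine ⟨φ, g, hg, Function.LeftInverse.injective (g := h) fun r => LinearMap.congr_fun hhg r, hφ,
    fun a ha => ?_⟩
  rw [← hx.apply_eq_linEndo hc hg ha, hφ, LinearEquiv.map_eq_zero_iff]

/-- A subspace of the last power is rigid if only scalar linear substitutions preserve it. -/
def IsFreeBasis.IsRigid (hx : IsFreeBasis 𝔽 x) (c : ℕ) (I : Submodule 𝔽 A) : Prop :=
  I ≤ algPower 𝔽 A c ∧ ∀ g : (Fin n → 𝔽) →ₗ[𝔽] (Fin n → 𝔽), Function.Injective g →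
    (∀ a ∈ I, hx.linEndo g a ∈ I) → ∃ l : 𝔽, g = l • LinearMap.id

omit [IsScalarTower 𝔽 A A] [SMulCommClass 𝔽 A A] in
theorem exists_injective_nonscalar (hn : 2 ≤ n) : ∃ g : (Fin n → 𝔽) →ₗ[𝔽] (Fin n → 𝔽),
    Function.Injective g ∧ ∀ l : 𝔽, g ≠ l • LinearMap.id := by
  let i : Fin n := ⟨0, by omega⟩
  let j : Fin n := ⟨1, by omega⟩
  have hij : i ≠ j := fun h => by simpa [i, j] using congrArg Fin.val h
  refine ⟨LinearMap.funLeft 𝔽 𝔽 (Equiv.swap i j),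
    LinearMap.funLeft_injective_of_surjective _ _ _ (Equiv.surjective _), fun l h => ?_⟩
  have := congrFun (LinearMap.congr_fun h (Pi.single i 1)) j
  rw [LinearMap.funLeft_apply, Equiv.swap_apply_right, Pi.single_eq_same, LinearMap.smul_apply,
    LinearMap.id_apply, Pi.smul_apply, Pi.single_eq_of_ne hij.symm, smul_zero] at this
  exact one_ne_zero this

/-- Quotients by rigid ideals have the generic automorphism group. -/
theorem IsFreeBasis.algAut_structure [Finite 𝔽] [Finite A] (hx : IsFreeBasis 𝔽 x) {c : ℕ}
    (hc2 : 2 ≤ c) (hn : c + 2 ≤ n) (hc : algPower 𝔽 A (c + 1) = ⊥) (hne : algPower 𝔽 A c ≠ ⊥)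
    {P : Type u} [NonUnitalNonAssocRing P] [Module 𝔽 P] [IsScalarTower 𝔽 P P]
    [SMulCommClass 𝔽 P P] {π : A →ₙₐ[𝔽] P} (hπ : Function.Surjective π)
    (hrig : hx.IsRigid c (kerIdeal π).toSubmodule) :
    (Nat.card (algAut 𝔽 P) : ℝ)
        = ((Nat.card 𝔽 : ℝ) - 1) * ((Nat.card P : ℝ) / (Nat.card 𝔽 : ℝ) ^ n) ^ n ∧
      Group.IsSolvable (algAut 𝔽 P) ∧
      ∃ N H : Subgroup (algAut 𝔽 P), IsInternalSemidirect N H ∧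
        Group.IsNilpotent N ∧ Group.nilpotencyClass N = c - 1 ∧ Nonempty (H ≃* 𝔽ˣ) := by
  have : Finite P := Finite.of_surjective π hπ
  have hm := hx.isMinGen hc hne
  have hker : ∀ a, π a = 0 → a ∈ algPower 𝔽 A c := fun a ha => hrig.1 ha
  have hker2 : ∀ a, π a = 0 → a ∈ algPower 𝔽 A 2 := fun a ha =>
    algPower_le (by norm_num) hc2 (hker a ha)
  have hy : IsMinGen 𝔽 fun i => π (x i) := by
    refine ⟨hx.gen.map hπ, fun r hr => hm.ind r ?_⟩
    obtain ⟨b, hb, hbr⟩ := exists_mem_algPower_of_surjective π hπ hr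
    have h1 : π (∑ i, r i • x i - b) = 0 := by
      rw [map_sub, map_sum, hbr]
      simp only [map_smul, sub_self]
    have := add_mem (hker2 _ h1) hb
    rwa [sub_add_cancel] at this
  refine hy.algAut_structure hc2 hn ?_ ?_ (fun e => ?_) fun l p hp => ?_
  · rw [eq_bot_iff]
    intro b hb
    obtain ⟨a, ha, rfl⟩ := exists_mem_algPower_of_surjective π hπ hb
    rw [hc, Submodule.mem_bot] at ha
    rw [ha, map_zero]
    exact zero_mem _
  -- If P^c were zero, the kernel would be preserved by every substitution, in particular by a
  -- nonscalar one such as a transposition of two generators.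
  · intro h
    obtain ⟨g, hg, hgs⟩ := exists_injective_nonscalar (𝔽 := 𝔽) (n := n) (by omega)
    obtain ⟨l, hl⟩ := hrig.2 g hg fun a ha => by
      have := map_mem_algPower (𝔽 := 𝔽) π (map_mem_algPower (𝔽 := 𝔽) (hx.linEndo g) (hrig.1 ha))
      rw [h] at this
      exact this
    exact hgs l hl
  · obtain ⟨φ, g, hg, hginj, hφ, hlin⟩ := hx.exists_lift_iso hc2 hc hne hπ hπ hker e.1 e.2
    obtain ⟨l, rfl⟩ := hrig.2 g hginj fun a ha => (hlin a (hrig.1 ha)).1 ha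
    refine ⟨l, fun i => ?_⟩
    have := map_mem_algPower (𝔽 := 𝔽) π (hg (Pi.single i 1))
    rw [LinearMap.smul_apply, LinearMap.id_apply, map_smul, linComb_single, map_sub, map_smul,
      hφ] at this
    exact this
  · choose p' hp' hpp using fun i => exists_mem_algPower_of_surjective π hπ (hp i)
    let φ := hx.endo fun i => l • x i + p' i
    have hφ : IsLinearPart x φ (l • LinearMap.id) := fun r => by
      rw [linComb_apply, map_sum, LinearMap.smul_apply, LinearMap.id_apply, map_smul, linComb_apply,
        Finset.smul_sum, ← Finset.sum_sub_distrib]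
      refine sum_mem fun i _ => ?_
      rw [map_smul, hx.endo_apply, smul_add, smul_comm, add_sub_cancel_left]
      exact Submodule.smul_mem _ _ (hp' i)
    -- On the kernel, which lies in A^c, `φ` is multiplication by l^c, so it descends to the
    -- quotient, also for l = 0.
    obtain ⟨ψ, hψ⟩ := exists_factor hπ (π.comp φ) fun a ha => by
      change π (φ a) = 0
      rw [hx.apply_eq_linEndo hc hφ (hker a ha), hx.linEndo_smul_id hc l (hker a ha), map_smul, ha,
        smul_zero]
    refine ⟨ψ, fun i => ?_⟩
    rw [hψ]
    change π (φ (x i)) = _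
    rw [hx.endo_apply, map_add, map_smul, hpp]

end LinearPart

/-! ### Comparison of bad ideals with isomorphism classes -/

section Counting

open Module

variable {𝔽 : Type u} [Field 𝔽] [Finite 𝔽]

omit [Finite 𝔽] in
theorem natCard_end (n : ℕ) :
    Nat.card ((Fin n → 𝔽) →ₗ[𝔽] (Fin n → 𝔽)) = Nat.card 𝔽 ^ (n * n) := by
  rw [Module.natCard_eq_pow_finrank (K := 𝔽), Module.finrank_linearMap, Module.finrank_fin_fun]

omit [Finite 𝔽] in
/-- The number of subspaces of a subspace. -/
theorem pow_le_card_le_submodule {V : Type u} [AddCommGroup V] [Module 𝔽 V] [Finite V]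
    (C : Submodule 𝔽 V) :
    Nat.card 𝔽 ^ (finrank 𝔽 C / 2 * (finrank 𝔽 C - finrank 𝔽 C / 2)) ≤
      Nat.card {I : Submodule 𝔽 V // I ≤ C} := by
  have h : Nat.card (Submodule 𝔽 C) = Nat.card {I : Submodule 𝔽 V // I ≤ C} :=
    Nat.card_congr (Submodule.mapIic C).toEquiv
  rw [← h]
  exact pow_le_card_submodule _ _ (by omega)

variable {A : Type u} [NonUnitalNonAssocRing A] [Module 𝔽 A]
  [IsScalarTower 𝔽 A A] [SMulCommClass 𝔽 A A] [Finite A] {n : ℕ} {x : Fin n → A}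

/-- Subspaces of the last power that are not rigid are rare. -/
theorem IsFreeBasis.card_not_isRigid_le (hx : IsFreeBasis 𝔽 x) {c : ℕ} (hc2 : 2 ≤ c)
    (hne : algPower 𝔽 A c ≠ ⊥) {z Z : ℕ} (hn : 100 * (z + 1) + c ≤ n)
    (hZ : Z + finrank 𝔽 (algPower 𝔽 A c) + 2 ≤ z * finrank 𝔽 (algPower 𝔽 A c)) :
    Nat.card {I : Submodule 𝔽 A // I ≤ algPower 𝔽 A c ∧ ¬ hx.IsRigid c I} * Nat.card 𝔽 ^ Z ≤
      Nat.card 𝔽 ^ (n * n) *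
        Nat.card 𝔽 ^ (finrank 𝔽 (algPower 𝔽 A c) / 2 *
          (finrank 𝔽 (algPower 𝔽 A c) - finrank 𝔽 (algPower 𝔽 A c) / 2)) := by
  rw [← natCard_end]
  have : Finite ((Fin n → 𝔽) →ₗ[𝔽] (Fin n → 𝔽)) := Module.finite_of_finite 𝔽
  refine Nat.card_mul_le_of_cover (fun (I : {I : Submodule 𝔽 A // I ≤ algPower 𝔽 A c ∧
    ¬ hx.IsRigid c I}) (g : (Fin n → 𝔽) →ₗ[𝔽] (Fin n → 𝔽)) => Function.Injective g ∧
    (∀ l : 𝔽, g ≠ l • LinearMap.id) ∧ ∀ a ∈ I.1, hx.linEndo g a ∈ I.1) (fun I => ?_) fun g => ?_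
  · by_contra hcon
    push Not at hcon
    refine I.2.2 ⟨I.2.1, fun g hg hgI => ?_⟩
    by_contra hl
    push Not at hl
    obtain ⟨a, ha, h⟩ := hcon g hg hl
    exact h (hgI a ha)
  · by_cases h : Function.Injective g ∧ ∀ l : 𝔽, g ≠ l • LinearMap.id
    · refine le_trans (Nat.mul_le_mul_right _ ?_) (hx.card_preserved_le hc2 hne hn hZ h.1 h.2)
      exact Nat.card_le_card_of_injective
        (fun I => ⟨I.1.1, I.1.2.1, I.2.2.2⟩) fun I J hIJ =>
          Subtype.ext (Subtype.ext (Subtype.mk.inj hIJ))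
    · have : IsEmpty {I : {I : Submodule 𝔽 A // I ≤ algPower 𝔽 A c ∧ ¬ hx.IsRigid c I} //
          Function.Injective g ∧ (∀ l : 𝔽, g ≠ l • LinearMap.id) ∧
            ∀ a ∈ I.1, hx.linEndo g a ∈ I.1} := ⟨fun I => h ⟨I.2.1, I.2.2.1⟩⟩
      rw [Nat.card_of_isEmpty, zero_mul]
      exact Nat.zero_le _

omit [Finite 𝔽] [Finite A] in
/-- Any subspace of the last power is an ideal. -/
theorem exists_algIdeal_of_le {c : ℕ} (hc : algPower 𝔽 A (c + 1) = ⊥)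
    {I : Submodule 𝔽 A} (hI : I ≤ algPower 𝔽 A c) : ∃ J : AlgIdeal 𝔽 A, J.toSubmodule = I := by
  have h1 : ∀ a b : A, b ∈ I → a * b = 0 ∧ b * a = 0 := fun a b hb => by
    have h2 := algPower_mul_left a (hI hb)
    have h3 := algPower_mul_right a (hI hb)
    rw [hc, Submodule.mem_bot] at h2 h3
    exact ⟨h2, h3⟩
  exact ⟨{  toSubmodule := I
            mul_mem_left' := fun a b hb => by rw [(h1 a b hb).1]; exact I.zero_mem
            mul_mem_right' := fun a b hb => by rw [(h1 a b hb).2]; exact I.zero_mem }, rfl⟩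

variable {W : Set (FreeNonUnitalNonAssocAlgebra 𝔽 ℕ)}

/-- A subspace of the last power is encoded by the class of its quotient and a matrix carrying it to
the representative of that class chosen by `Function.invFun`. -/
theorem RelFree.card_le_card_isoClass {c : ℕ} (hc2 : 2 ≤ c) (hnil : IsNilpotentClass W c)
    (hn : c ≤ n) :
    Nat.card {I : Submodule 𝔽 (RelFree W n) // I ≤ algPower 𝔽 (RelFree W n) c} ≤
      Nat.card (IsoClass W n) * Nat.card 𝔽 ^ (n * n) := by
  have := RelFree.finite (n := n) hnil
  have := IsoClass.finite (n := n) hnil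
  have : Finite ((Fin n → 𝔽) →ₗ[𝔽] (Fin n → 𝔽)) := Module.finite_of_finite 𝔽
  have hc := RelFree.algPower_eq_bot (n := n) hnil
  have hne := RelFree.algPower_ne_bot hnil hn
  have hx := RelFree.isFreeBasis_gen W n
  choose J hJ using fun I : {I : Submodule 𝔽 (RelFree W n) // I ≤ algPower 𝔽 (RelFree W n) c} =>
    exists_algIdeal_of_le hc I.2
  let cls := fun I => IsoClass.mk (RelFree.quotient (J I))
  have : Nonempty {I : Submodule 𝔽 (RelFree W n) // I ≤ algPower 𝔽 (RelFree W n) c} :=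
    ⟨⟨⊥, bot_le⟩⟩
  have key : ∀ I, ∃ g : (Fin n → 𝔽) →ₗ[𝔽] (Fin n → 𝔽), ∀ a ∈ algPower 𝔽 (RelFree W n) c,
      a ∈ I.1 ↔ hx.linEndo g a ∈ (Function.invFun cls (cls I)).1 := fun I => by
    obtain ⟨e, he⟩ := Quotient.exact (Function.invFun_eq (f := cls) ⟨I, rfl⟩).symm
    obtain ⟨φ, g, -, -, -, h⟩ := hx.exists_lift_iso hc2 hc hne (π := (J I).projHom)
      (J I).proj_surjective (ρ := (J (Function.invFun cls (cls I))).projHom)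
      (AlgIdeal.proj_surjective _) (fun a ha => I.2 (by
        rwa [AlgIdeal.projHom_eq_zero, hJ] at ha)) e he
    refine ⟨g, fun a ha => ?_⟩
    have := h a ha
    rwa [AlgIdeal.projHom_eq_zero, AlgIdeal.projHom_eq_zero, hJ, hJ] at this
  choose g hg using key
  rw [← natCard_end, ← Nat.card_prod]
  refine Nat.card_le_card_of_injective (fun I => (cls I, g I)) fun I I' h => ?_
  obtain ⟨h1, h2⟩ := Prod.mk.inj h
  ext a
  constructor
  · intro ha
    have := (hg I a (I.2 ha)).1 ha
    rw [h1, h2] at this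
    exact (hg I' a (I.2 ha)).2 this
  · intro ha
    have := (hg I' a (I'.2 ha)).1 ha
    rw [← h1, ← h2] at this
    exact (hg I a (I'.2 ha)).2 this

/-- The classes outside `T` come from ideals that are not rigid. -/
theorem RelFree.ncard_compl_le {c : ℕ} (hnil : IsNilpotentClass W c) {T : Set (IsoClass W n)}
    (hT : ∀ (P : NGenAlgebra W n) (φ : RelFree W n →ₙₐ[𝔽] P.1), Function.Surjective φ →
      (RelFree.isFreeBasis_gen W n).IsRigid c (kerIdeal φ).toSubmodule → IsoClass.mk P ∈ T) :
    Tᶜ.ncard ≤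
      Nat.card {J : Submodule 𝔽 (RelFree W n) // (∀ y ∈ J, ∀ a : RelFree W n, a * y ∈ J ∧ y * a ∈ J) ∧
        ¬ J ≤ algPower 𝔽 (RelFree W n) c} +
      Nat.card {I : Submodule 𝔽 (RelFree W n) // I ≤ algPower 𝔽 (RelFree W n) c ∧
        ¬ (RelFree.isFreeBasis_gen W n).IsRigid c I} := by
  have := RelFree.finite (n := n) hnil
  have := IsoClass.finite (n := n) hnil
  rw [← Nat.card_coe_set_eq, ← Nat.card_sum]
  have key : ∀ X : (Tᶜ : Set (IsoClass W n)), ∃ J : AlgIdeal 𝔽 (RelFree W n),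
      IsoClass.mk (RelFree.quotient J) = X.1 := fun X => RelFree.mk_quotient_surjective X.1
  choose J hJ using key
  have hbad : ∀ X, ¬ (RelFree.isFreeBasis_gen W n).IsRigid c (J X).toSubmodule := fun X h => by
    refine X.2 ?_
    rw [← hJ X]
    refine hT (RelFree.quotient (J X)) (J X).projHom (J X).proj_surjective ?_
    have h2 : (kerIdeal (J X).projHom).toSubmodule = (J X).toSubmodule :=
      Submodule.ext fun a => (J X).projHom_eq_zero
    rw [← h2] at h
    exact h
  classical
  refine Nat.card_le_card_of_injective (fun X =>
    if h : (J X).toSubmodule ≤ algPower 𝔽 (RelFree W n) c then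
      Sum.inr ⟨(J X).toSubmodule, h, hbad X⟩
    else Sum.inl ⟨(J X).toSubmodule, fun y hy a => ⟨(J X).mul_mem_left' a hy,
      (J X).mul_mem_right' a hy⟩, h⟩) fun X Y h => ?_
  suffices h : (J X).toSubmodule = (J Y).toSubmodule by
    apply Subtype.ext
    rw [← hJ X, ← hJ Y, AlgIdeal.toSubmodule_injective h]
  dsimp only at h
  split_ifs at h
  · exact congrArg Subtype.val (Sum.inr_injective h)
  · exact congrArg Subtype.val (Sum.inl_injective h)

theorem RelFree.ncard_compl_mul_le {c : ℕ} (hc2 : 2 ≤ c) (hnil : IsNilpotentClass W c)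
    (hcent : IsCentralClass W c) {T : Set (IsoClass W n)}
    (hT : ∀ (P : NGenAlgebra W n) (φ : RelFree W n →ₙₐ[𝔽] P.1), Function.Surjective φ →
      (RelFree.isFreeBasis_gen W n).IsRigid c (kerIdeal φ).toSubmodule → IsoClass.mk P ∈ T)
    (hn1 : 2 * c ^ 2 * (4 * (12 * c ^ 2 + 3) + 8) + 3 * c ≤ n)
    (hn2 : 100 * (12 * c ^ 2 + 3 + 1) + c ≤ n) :
    Tᶜ.ncard * Nat.card 𝔽 ^ n ≤ 2 * Nat.card (IsoClass W n) := by
  have := RelFree.finite (n := n) hnil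
  have hc := RelFree.algPower_eq_bot (n := n) hnil
  have hne := RelFree.algPower_ne_bot hnil (show c ≤ n by omega)
  have hx := RelFree.isFreeBasis_gen W n
  have hcent := hcent n (by omega)
  have h0 := RelFree.ncard_compl_le hnil hT
  have h3 := RelFree.card_le_card_isoClass hc2 hnil (show c ≤ n by omega)
  have h4 := pow_le_card_le_submodule (algPower 𝔽 (RelFree W n) c)
  have hd1 := hx.mul_finrank_sub_le (by omega) hc hcent (by omega)
  have hd2 := hx.le_finrank_sub hc2 hc hne
  -- In Z, one n² pays for the choice of g in the nonrigid case, one for passing from ideals to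
  -- classes, and n gives the decay q^(-n). As n² ≤ 4c²d, one has Z + 3d ≤ 3n² + 3d ≤ (12c² + 3)d,
  -- which fixes z.
  have h1 := hx.card_ideal_not_le (z := 12 * c ^ 2 + 3) (Z := 2 * (n * n) + n) (by omega) hc hcent
    hn1
  have h2 := hx.card_not_isRigid_le (z := 12 * c ^ 2 + 3) (Z := 2 * (n * n) + n) hc2 hne hn2
  set d := finrank 𝔽 (algPower 𝔽 (RelFree W n) c)
  set D := d / 2 * (d - d / 2)
  set q := Nat.card 𝔽
  have hq : 0 < q := Nat.card_pos
  -- The n generators are independent modulo the last power, and the growth estimate multiplies this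
  -- n by about n/(2c²).
  have hnn : n * n ≤ 4 * c ^ 2 * d := by
    have h5 : (n - c) * n ≤ 2 * c ^ 2 * d := (Nat.mul_le_mul_left _ hd2).trans hd1
    have h6 : n ≤ 2 * (n - c) := by omega
    nlinarith
  have hnn' : n ≤ n * n := Nat.le_mul_self n
  have hn2 : 2 ≤ n := by omega
  have hd : 1 ≤ d := by
    rcases Nat.eq_zero_or_pos d with h | h
    · rw [h] at hnn; omega
    · exact h
  have hzd : (12 * c ^ 2 + 3) * d = 3 * (4 * c ^ 2 * d) + 3 * d := by ring
  have h1 := h1 (by omega)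
  have h2 := h2 (by omega)
  have hsplit : q ^ (2 * (n * n) + n) = q ^ (n * n) * (q ^ (n * n) * q ^ n) := by
    rw [two_mul, pow_add, pow_add, mul_assoc]
  have hQ : 0 < q ^ (n * n) := pow_pos hq _
  have h6 : Tᶜ.ncard * q ^ (2 * (n * n) + n) ≤ 2 * (q ^ (n * n) * q ^ D) := by
    refine (Nat.mul_le_mul_right _ h0).trans ?_
    rw [add_mul, two_mul (q ^ (n * n) * q ^ D)]
    exact add_le_add (h1.trans (Nat.le_mul_of_pos_left _ hQ)) h2
  have h7 : Tᶜ.ncard * q ^ (2 * (n * n) + n) ≤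
      2 * (q ^ (n * n) * (Nat.card (IsoClass W n) * q ^ (n * n))) :=
    h6.trans (Nat.mul_le_mul_left _ (Nat.mul_le_mul_left _ (h4.trans h3)))
  rw [hsplit] at h7
  refine Nat.le_of_mul_le_mul_left (c := q ^ (n * n) * q ^ (n * n)) ?_ (Nat.mul_pos hQ hQ)
  calc _ = Tᶜ.ncard * (q ^ (n * n) * (q ^ (n * n) * q ^ n)) := by ring
    _ ≤ _ := h7
    _ = _ := by ring

end Counting

/-! ### The limit and the main theorem -/

theorem tendsto_ncard_div {S : ℕ → Type*} [∀ n, Finite (S n)] (T : ∀ n, Set (S n)) {q N : ℕ}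
    (hq : 2 ≤ q) (h0 : ∀ n, N ≤ n → 0 < Nat.card (S n))
    (h : ∀ n, N ≤ n → (T n)ᶜ.ncard * q ^ n ≤ 2 * Nat.card (S n)) :
    Tendsto (fun n => ((T n).ncard : ℝ) / (Nat.card (S n) : ℝ)) atTop (𝓝 1) := by
  have hlim : Tendsto (fun n : ℕ => 1 - 2 * ((q : ℝ)⁻¹) ^ n) atTop (𝓝 1) := by
    have := (tendsto_pow_atTop_nhds_zero_of_lt_one (r := (q : ℝ)⁻¹) (by positivity)
      (inv_lt_one_of_one_lt₀ (by exact_mod_cast hq))).const_mul 2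
    simpa using this.const_sub 1
  refine tendsto_of_tendsto_of_tendsto_of_le_of_le' hlim tendsto_const_nhds ?_ ?_
  · filter_upwards [eventually_ge_atTop N] with n hn
    have hpos : (0 : ℝ) < Nat.card (S n) := by exact_mod_cast h0 n hn
    have hqn : (0 : ℝ) < (q : ℝ) ^ n := pow_pos (by exact_mod_cast (by omega : 0 < q)) n
    have h1 : ((T n).ncard : ℝ) + (T n)ᶜ.ncard = Nat.card (S n) := by
      exact_mod_cast Set.ncard_add_ncard_compl (T n)
    have h2 : ((T n)ᶜ.ncard : ℝ) * (q : ℝ) ^ n ≤ 2 * Nat.card (S n) := by exact_mod_cast h n hn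
    rw [le_div_iff₀ hpos, inv_pow]
    have h3 : ((T n)ᶜ.ncard : ℝ) ≤ 2 * Nat.card (S n) * ((q : ℝ) ^ n)⁻¹ := by
      rwa [← div_eq_mul_inv, le_div_iff₀ hqn]
    linarith
  · filter_upwards with n
    refine div_le_one_of_le₀ ?_ (Nat.cast_nonneg _)
    rw [← Set.ncard_univ]
    exact_mod_cast Set.ncard_le_ncard (Set.subset_univ _)

theorem mainTheorem11 {𝔽 : Type u} [Field 𝔽] [Finite 𝔽] (c : ℕ) (hc : 2 ≤ c)
    (W : Set (FreeNonUnitalNonAssocAlgebra 𝔽 ℕ)) (hnil : IsNilpotentClass W c)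
    (hcent : IsCentralClass W c) :
    IsGeneric (IsoClass W) (fun n => {x | ∀ P : NGenAlgebra W n, IsoClass.mk P = x →
      (Nat.card (algAut 𝔽 P.1) : ℝ)
          = ((Nat.card 𝔽 : ℝ) - 1) * ((Nat.card P.1 : ℝ) / (Nat.card 𝔽 : ℝ) ^ n) ^ n ∧
        Group.IsSolvable (algAut 𝔽 P.1) ∧
        ∃ N H : Subgroup (algAut 𝔽 P.1), IsInternalSemidirect N H ∧
          Group.IsNilpotent N ∧ Group.nilpotencyClass N = c - 1 ∧
          Nonempty (H ≃* 𝔽ˣ)}) := by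
  have hfin : ∀ n, Finite (IsoClass W n) := fun n => IsoClass.finite hnil
  refine ⟨hfin, tendsto_ncard_div _ (two_le_natCard_field (K := 𝔽))
    (N := (2 * c ^ 2 * (4 * (12 * c ^ 2 + 3) + 8) + 3 * c) + (100 * (12 * c ^ 2 + 3 + 1) + c))
    (fun n _ => ?_) fun n hn => ?_⟩
  · have : Nonempty (IsoClass W n) := ⟨IsoClass.mk (RelFree.quotient (verbalIdeal W _))⟩
    exact Nat.card_pos
  · refine RelFree.ncard_compl_mul_le hc hnil hcent (fun P φ hφ hrig P' hP' => ?_) (by omega)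
      (by omega)
    have := RelFree.finite (n := n) hnil
    -- The property is required of every representative of the class; composing the surjection with
    -- the isomorphism does not change its kernel.
    obtain ⟨e, he⟩ := Quotient.exact hP'.symm
    let ψ : P.1 →ₙₐ[𝔽] P'.1 := { (e : P.1 →ₗ[𝔽] P'.1) with
      map_smul' := e.map_smul, map_zero' := e.map_zero, map_mul' := he }
    refine (RelFree.isFreeBasis_gen W n).algAut_structure hc (by omega)
      (RelFree.algPower_eq_bot hnil) (RelFree.algPower_ne_bot hnil (by omega)) (π := ψ.comp φ)
      (e.surjective.comp hφ) ?_
    have h2 : (kerIdeal (ψ.comp φ)).toSubmodule = (kerIdeal φ).toSubmodule :=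
      Submodule.ext fun a => e.map_eq_zero_iff
    rw [h2]
    exact hrig
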